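/- **Theorem 3.1.** Let $\lambda>0$, let $f,g\in C^\infty(\mathbb R,\mathbb R)$ with $g(0)=0$, and let $\bar u\in H^1(\mathbb R)$. For $\xi\in\mathbb R$ let $\bar y(\xi)$ be the unique real number with $\int_0^{\bar y(\xi)}(1+\bar u_x^2)\,dx=\xi$. For $(k,v,q)$ depending on $(t,\xi)$ put $$h=\Big(e^{\lambda t}g(e^{-\lambda t}k)\cos^2\tfrac v2+\tfrac12e^{-\lambda t}f''(e^{-\lambda t}k)\sin^2\tfrac v2\Big)q,\qquad K(t,\xi,\xi')=\exp\Big(-\Big|\int_\xi^{\xi'}\cos^2\tfrac{v(t,s)}2\,q(t,s)\,ds\Big|\Big),$$ $$\widetilde P(t,\xi)=\tfrac12\int_{-\infty}^{\infty}K(t,\xi,\xi')\,h(t,\xi')\,d\xi',\qquad \widetilde P_x(t,\xi)=\tfrac12\Big(\int_\xi^\infty-\int_{-\infty}^\xi\Big)K(t,\xi,\xi')\,h(t,\xi')\,d\xi'.$$ Consider the Cauchy problem $$\begin{cases}k_t=-\widetilde P_x,\\ v_t=2\big(e^{\lambda t}g(e^{-\lambda t}k)-\widetilde P\big)\cos^2\frac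 v2-e^{-\lambda t}f''(e^{-\lambda t}k)\sin^2\frac v2,\\ q_t=\frac12\sin v\cdot q\,\big(e^{-\lambda t}f''(e^{-\lambda t}k)+2e^{\lambda t}g(e^{-\lambda t}k)-2\widetilde P\big),\end{cases}$$ $$k(0,\xi)=\bar u(\bar y(\xi)),\quad v(0,\xi)=2\arctan\bar u_x(\bar y(\xi)),\quad q(0,\xi)=1,$$ as an ordinary differential equation in the Banach space $X=H^1(\mathbb R)\times(L^2(\mathbb R)\cap L^\infty(\mathbb R))\times L^\infty(\mathbb R)$ with norm $\|k\|_{H^1}+\|v\|_{L^2}+\|v\|_{L^\infty}+\|q\|_{L^\infty}$: a solution on an interval $I\ni0$ is a curve in $X$, differentiable in the norm of $X$ at every $t\in I$ (one-sidedly at an end point), that satisfies the equations and the initial conditions almost everywhere in $\xi$. Then this problem has a solution defined for all $t\ge0$, along which the integrals defining $\widetilde P$ and $\widetilde P_x$ converge absolutely for all $t\ge 0$ and $\xi\in\mathbb R$. This solution is unique: every solution on $[0,\infty)$, and every solution on an interval $[0,T)$ with $0<T<\infty$, coincides with it on its interval of definition. -/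

import Mathlib

open MeasureTheory Set

open scoped ENNReal ContDiff

noncomputable section

namespace WaveSystem

/-- The real Lebesgue space `L²(ℝ)`. -/
abbrev L2 : Type := Lp ℝ 2 (volume : Measure ℝ)

/-- The real Lebesgue space `L^∞(ℝ)`. -/
abbrev Linf : Type := Lp ℝ ∞ (volume : Measure ℝ)

/-- `w` is the weak (distributional) derivative of `u` on `ℝ`. -/
def IsWeakDeriv (u w : ℝ → ℝ) : Prop :=
  ∀ φ : ℝ → ℝ, ContDiff ℝ ∞ φ → HasCompactSupport φ →
    ∫ x, u x * deriv φ x = -∫ x, w x * φ x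

lemma integrable_L2_mul (u : L2) {φ : ℝ → ℝ} (h1 : Continuous φ) (h2 : HasCompactSupport φ) :
    Integrable (fun x => u x * φ x) :=
  (Lp.memLp u).integrable_mul (q := 2) (h1.memLp_of_hasCompactSupport h2)

/-- The Sobolev space `H¹(ℝ)`: pairs `(u, u_x)` of `L²` functions, the second one being the weak
derivative of the first, with the norm `(‖u‖² + ‖u_x‖²)^{1/2}`. -/
def H1 : Submodule ℝ (WithLp 2 (L2 × L2)) where
  carrier := {p | IsWeakDeriv p.fst p.snd}
  zero_mem' := by
    intro φ _ _
    have h0 := Lp.coeFn_zero ℝ 2 (volume : Measure ℝ)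
    have e1 : ∫ x, (0 : L2) x * deriv φ x = 0 := by
      rw [integral_congr_ae (g := fun _ => (0 : ℝ)) (by
        filter_upwards [h0] with x hx; rw [hx]; simp)]
      simp
    have e2 : ∫ x, (0 : L2) x * φ x = 0 := by
      rw [integral_congr_ae (g := fun _ => (0 : ℝ)) (by
        filter_upwards [h0] with x hx; rw [hx]; simp)]
      simp
    change ∫ x, (0 : L2) x * deriv φ x = -∫ x, (0 : L2) x * φ x
    rw [e1, e2, neg_zero]
  add_mem' := by
    intro a b ha hb φ h1 h2
    have hd : Continuous (deriv φ) := h1.continuous_deriv (by simp)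
    have e1 : ∫ x, (a.fst + b.fst : L2) x * deriv φ x
        = (∫ x, a.fst x * deriv φ x) + ∫ x, b.fst x * deriv φ x := by
      rw [← integral_add (integrable_L2_mul _ hd h2.deriv) (integrable_L2_mul _ hd h2.deriv)]
      refine integral_congr_ae ?_
      filter_upwards [Lp.coeFn_add a.fst b.fst] with x hx
      rw [hx, Pi.add_apply, add_mul]
    have e2 : ∫ x, (a.snd + b.snd : L2) x * φ x
        = (∫ x, a.snd x * φ x) + ∫ x, b.snd x * φ x := by
      rw [← integral_add (integrable_L2_mul _ h1.continuous h2)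
        (integrable_L2_mul _ h1.continuous h2)]
      refine integral_congr_ae ?_
      filter_upwards [Lp.coeFn_add a.snd b.snd] with x hx
      rw [hx, Pi.add_apply, add_mul]
    rw [WithLp.add_fst, WithLp.add_snd, e1, e2, ha φ h1 h2, hb φ h1 h2]
    ring
  smul_mem' := by
    intro c a ha φ h1 h2
    have e1 : ∫ x, (c • a.fst : L2) x * deriv φ x = c * ∫ x, a.fst x * deriv φ x := by
      rw [← integral_const_mul]
      refine integral_congr_ae ?_
      filter_upwards [Lp.coeFn_smul c a.fst] with x hx
      simp [hx, mul_assoc]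
    have e2 : ∫ x, (c • a.snd : L2) x * φ x = c * ∫ x, a.snd x * φ x := by
      rw [← integral_const_mul]
      refine integral_congr_ae ?_
      filter_upwards [Lp.coeFn_smul c a.snd] with x hx
      simp [hx, mul_assoc]
    rw [WithLp.smul_fst, WithLp.smul_snd, e1, e2, ha φ h1 h2]
    ring

/-- The space `L²(ℝ) ∩ L^∞(ℝ)` with the norm `‖v‖_{L²} + ‖v‖_{L^∞}`: an element is given by its
class in `L²` and its class in `L^∞`, which agree almost everywhere. -/
def L2Linf : Submodule ℝ (WithLp 1 (L2 × Linf)) where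
  carrier := {p | (p.fst : ℝ → ℝ) =ᵐ[volume] p.snd}
  zero_mem' := by
    have h1 := Lp.coeFn_zero ℝ 2 (volume : Measure ℝ)
    have h2 := Lp.coeFn_zero ℝ ∞ (volume : Measure ℝ)
    exact h1.trans h2.symm
  add_mem' := by
    intro a b (ha : (a.fst : ℝ → ℝ) =ᵐ[volume] a.snd) (hb : (b.fst : ℝ → ℝ) =ᵐ[volume] b.snd)
    exact ((Lp.coeFn_add a.fst b.fst).trans (ha.add hb)).trans (Lp.coeFn_add a.snd b.snd).symm
  smul_mem' := by
    intro c a (ha : (a.fst : ℝ → ℝ) =ᵐ[volume] a.snd)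
    exact ((Lp.coeFn_smul c a.fst).trans (ha.const_smul c)).trans (Lp.coeFn_smul c a.snd).symm

/-- The Banach space `X = H¹ × (L² ∩ L^∞) × L^∞` with the norm
`‖k‖_{H¹} + ‖v‖_{L²} + ‖v‖_{L^∞} + ‖q‖_{L^∞}`. -/
abbrev X : Type := WithLp 1 (H1 × WithLp 1 (L2Linf × Linf))

/-- The function underlying an element of `H¹`. -/
def H1.fn (u : H1) : ℝ → ℝ := (u : WithLp 2 (L2 × L2)).fst

/-- The weak derivative of an element of `H¹`. -/
def H1.dx (u : H1) : ℝ → ℝ := (u : WithLp 2 (L2 × L2)).snd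

/-- The first component of a point of `X`, as a function on `ℝ`. -/
def X.k (z : X) : ℝ → ℝ := H1.fn z.fst

/-- The second component of a point of `X`, as a function on `ℝ`. -/
def X.v (z : X) : ℝ → ℝ := (z.snd.fst : WithLp 1 (L2 × Linf)).fst

/-- The third component of a point of `X`, as a function on `ℝ`. -/
def X.q (z : X) : ℝ → ℝ := z.snd.snd

section InitialCoordinate

lemma intervalIntegrable_dx_sq (u : H1) (a b : ℝ) :
    IntervalIntegrable (fun x => H1.dx u x ^ 2) volume a b :=
  (Lp.memLp (u : WithLp 2 (L2 × L2)).snd).integrable_sq.intervalIntegrable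

lemma intervalIntegrable_energy (u : H1) (a b : ℝ) :
    IntervalIntegrable (fun x => 1 + H1.dx u x ^ 2) volume a b :=
  intervalIntegrable_const.add (intervalIntegrable_dx_sq u a b)

lemma sub_le_integral_energy (u : H1) {a b : ℝ} (hab : a ≤ b) :
    b - a ≤ ∫ x in a..b, (1 + H1.dx u x ^ 2) := by
  have h := intervalIntegral.integral_mono_on hab (intervalIntegrable_const (c := (1 : ℝ)))
    (intervalIntegrable_energy u a b) (fun x _ => by nlinarith [sq_nonneg (H1.dx u x)])
  simpa using h

lemma existsUnique_ybar (u : H1) (ξ : ℝ) :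
    ∃! y : ℝ, ∫ x in (0 : ℝ)..y, (1 + H1.dx u x ^ 2) = ξ := by
  set F : ℝ → ℝ := fun y => ∫ x in (0 : ℝ)..y, (1 + H1.dx u x ^ 2) with hF
  have hdiff : ∀ a b, a ≤ b → b - a ≤ F b - F a := by
    intro a b hab
    have := intervalIntegral.integral_interval_sub_left (intervalIntegrable_energy u 0 b)
      (intervalIntegrable_energy u 0 a)
    simp only [hF]
    rw [this]
    exact sub_le_integral_energy u hab
  have hcont : Continuous F :=
    intervalIntegral.continuous_primitive (fun a b => intervalIntegrable_energy u a b) 0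
  have h0 : F 0 = 0 := by simp [hF]
  have hex : ∃ y, F y = ξ := by
    have hlo : F (-|ξ|) ≤ ξ := by
      have := hdiff (-|ξ|) 0 (by simp)
      have := neg_abs_le ξ
      linarith
    have hhi : ξ ≤ F |ξ| := by
      have := hdiff 0 |ξ| (abs_nonneg ξ)
      have := le_abs_self ξ
      linarith
    exact mem_range_of_exists_le_of_exists_ge hcont ⟨_, hlo⟩ ⟨_, hhi⟩
  obtain ⟨y, hy⟩ := hex
  refine ⟨y, hy, fun z hz => ?_⟩
  have hz' : F z = ξ := hz
  rcases le_total y z with h | h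
  · have := hdiff y z h
    linarith
  · have := hdiff z y h
    linarith

/-- The map `ξ ↦ ȳ(ξ)` determined by `∫₀^{ȳ(ξ)} (1 + ū_x²) dx = ξ`. -/
def ybar (u : H1) (ξ : ℝ) : ℝ := (existsUnique_ybar u ξ).choose

lemma ybar_spec (u : H1) (ξ : ℝ) : ∫ x in (0 : ℝ)..ybar u ξ, (1 + H1.dx u x ^ 2) = ξ :=
  (existsUnique_ybar u ξ).choose_spec.1

end InitialCoordinate

/-- The density
`(e^{λt} g(e^{-λt}k) cos²(v/2) + ½ e^{-λt} f''(e^{-λt}k) sin²(v/2)) q` at the point `ξ`. -/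
def density (lam : ℝ) (f g : ℝ → ℝ) (t : ℝ) (k v q : ℝ → ℝ) (ξ : ℝ) : ℝ :=
  (Real.exp (lam * t) * g (Real.exp (-(lam * t)) * k ξ) * Real.cos (v ξ / 2) ^ 2
    + 1 / 2 * Real.exp (-(lam * t)) * iteratedDeriv 2 f (Real.exp (-(lam * t)) * k ξ)
      * Real.sin (v ξ / 2) ^ 2) * q ξ

/-- The integrand, as a function of `η`, of the nonlocal terms at the point `ξ`:
`exp(-|∫_ξ^η cos²(v/2) q ds|)` times the density at `η`. -/
def integrand (lam : ℝ) (f g : ℝ → ℝ) (t : ℝ) (k v q : ℝ → ℝ) (ξ η : ℝ) : ℝ :=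
  Real.exp (-|∫ s in ξ..η, Real.cos (v s / 2) ^ 2 * q s|) * density lam f g t k v q η

/-- The nonlocal term `P̃(t, ξ)`. -/
def Pt (lam : ℝ) (f g : ℝ → ℝ) (t : ℝ) (k v q : ℝ → ℝ) (ξ : ℝ) : ℝ :=
  1 / 2 * ∫ η, integrand lam f g t k v q ξ η

/-- The nonlocal term `P̃_x(t, ξ)`. -/
def Px (lam : ℝ) (f g : ℝ → ℝ) (t : ℝ) (k v q : ℝ → ℝ) (ξ : ℝ) : ℝ :=
  1 / 2 * ((∫ η in Ioi ξ, integrand lam f g t k v q ξ η)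
    - ∫ η in Iic ξ, integrand lam f g t k v q ξ η)

/-- The right-hand side of the equation for `k`. -/
def rhsK (lam : ℝ) (f g : ℝ → ℝ) (t : ℝ) (k v q : ℝ → ℝ) (ξ : ℝ) : ℝ :=
  -Px lam f g t k v q ξ

/-- The right-hand side of the equation for `v`. -/
def rhsV (lam : ℝ) (f g : ℝ → ℝ) (t : ℝ) (k v q : ℝ → ℝ) (ξ : ℝ) : ℝ :=
  2 * (Real.exp (lam * t) * g (Real.exp (-(lam * t)) * k ξ) - Pt lam f g t k v q ξ)
      * Real.cos (v ξ / 2) ^ 2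
    - Real.exp (-(lam * t)) * iteratedDeriv 2 f (Real.exp (-(lam * t)) * k ξ)
      * Real.sin (v ξ / 2) ^ 2

/-- The right-hand side of the equation for `q`. -/
def rhsQ (lam : ℝ) (f g : ℝ → ℝ) (t : ℝ) (k v q : ℝ → ℝ) (ξ : ℝ) : ℝ :=
  1 / 2 * Real.sin (v ξ) * q ξ
    * (iteratedDeriv 2 f (Real.exp (-(lam * t)) * k ξ) * Real.exp (-(lam * t))
      + 2 * Real.exp (lam * t) * g (Real.exp (-(lam * t)) * k ξ) - 2 * Pt lam f g t k v q ξ)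

/-- `z = (k, v, q)` solves the Cauchy problem on the time set `I` (an interval containing `0`),
as an ordinary differential equation in the Banach space `X`: the curve `z` is differentiable
in the norm of `X` at every time of `I` (one-sidedly at an end point), its derivative is the
right-hand side of the system, and it has the prescribed initial value. -/
structure IsSolutionOn (lam : ℝ) (f g : ℝ → ℝ) (ubar : H1) (I : Set ℝ) (z : ℝ → X) : Prop where
  init_k : X.k (z 0) =ᵐ[volume] fun ξ => H1.fn ubar (ybar ubar ξ)
  init_v : X.v (z 0) =ᵐ[volume] fun ξ => 2 * Real.arctan (H1.dx ubar (ybar ubar ξ))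
  init_q : X.q (z 0) =ᵐ[volume] fun _ => 1
  ode : ∀ t ∈ I, ∃ z' : X, HasDerivWithinAt z z' I t ∧
    X.k z' =ᵐ[volume] rhsK lam f g t (X.k (z t)) (X.v (z t)) (X.q (z t)) ∧
    X.v z' =ᵐ[volume] rhsV lam f g t (X.k (z t)) (X.v (z t)) (X.q (z t)) ∧
    X.q z' =ᵐ[volume] rhsQ lam f g t (X.k (z t)) (X.v (z t)) (X.q (z t))

end WaveSystem

end

/-!
The right-hand side of the system is a vector field on the Banach space `X`, and the solution is
obtained by Picard–Lindelöf steps whose length is bounded below by means of a priori bounds.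

*The vector field.* The only nonlocal ingredient is the kernel `exp(-|∫_ξ^η cos²(v/2) q|)`. If
`q ≥ m > 0` and `∫ sin²(v/2) q ≤ M`, then `cos²(v/2) q ≥ m - sin²(v/2) q` shows that the kernel is
at most `e^M e^{-m|ξ-η|}`. Hence `P̃` and `P̃_x` are controlled by convolutions with an integrable
exponential, which act on `L²` and on `L^∞`, and the same holds for the differences of the
right-hand sides at two points (`exists_rhs_pair`). Moreover `-P̃_x` has the weak derivative
`h - cos²(v/2) q P̃` (`isPrim_rhsK`), so that it belongs to `H¹`. The result is a vector field
`field` which is Lipschitz and of linear growth on the sets `Adm`, on which `|k|`, `q`, `1/q` and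
`∫ sin²(v/2) q` are bounded (`exists_field_bound`). The linear growth constant does not depend on
the norm of the point of `X` otherwise.

*A priori bounds.* The relation `k_ξ = ½ sin v · q` holds initially, by the change of variables
`dξ = (1 + ū_x²) dx` (`exists_initial`), and is preserved: the integral of the defect over any set
of finite measure is a functional of `X` whose derivative annihilates the vector field
(`exists_hasFDerivAt_defect`). Under this relation the time derivative of the energy
`∫ (k² cos²(v/2) + sin²(v/2)) q` is the integral of an exact `ξ`-derivative, hence zero
(`energy_stationary`). The energy bounds `∫ sin²(v/2) q`, and it bounds `k` uniformly, since
`|(k²)_ξ| = |k sin v| q` is at most its density (`Compat.sq_le_energy`). The kernel has mass at most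
`2` against `cos²(v/2) q` (`integral_kern_mul_jac_le`), so `P̃` is bounded in terms of the energy
alone (`abs_Pt_le`). Thus the logarithmic rate of change of `q` is bounded and `q` stays between
`e^{-cT}` and `e^{cT}` (`IsCurve.q_bound`). Now the curve lies in a set `Adm` that is known
beforehand, and the linear growth of the vector field with Gronwall's inequality bounds the norm
(`exists_a_priori_bound`).

*Conclusion.* A vector field that is uniformly regular near the points satisfying the a priori
bounds has a global solution, and solutions are unique as long as one of them stays in the region
of regularity (`exists_global_solution`). Since a point of `X` is determined by its components
almost everywhere, the solutions of the Cauchy problem are the integral curves of `field`.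
-/

open Filter Topology

noncomputable section

namespace WaveSystem

/-! ### Absolutely continuous functions on the line -/

/-- `u` is a primitive of the locally integrable function `w`; equivalently, `u` is locally
absolutely continuous with derivative `w` almost everywhere. -/
structure IsPrim (u w : ℝ → ℝ) : Prop where
  loc : LocallyIntegrable w volume
  eq : ∀ a b, u b - u a = ∫ x in a..b, w x

namespace IsPrim

variable {u w u₁ w₁ u₂ w₂ : ℝ → ℝ}

lemma intervalIntegrable (h : IsPrim u w) (a b : ℝ) : IntervalIntegrable w volume a b :=
  intervalIntegrable_iff.mpr <|
    (h.loc.integrableOn_isCompact isCompact_uIcc).mono_set uIoc_subset_uIcc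

lemma eq_add (h : IsPrim u w) (a x : ℝ) : u x = u a + ∫ y in a..x, w y := by
  rw [← h.eq a x]; ring

lemma of_integral (hw : LocallyIntegrable w volume) (c a : ℝ) :
    IsPrim (fun x => c + ∫ y in a..x, w y) w where
  loc := hw
  eq p q := by
    have hi : ∀ p q, IntervalIntegrable w volume p q := fun p q =>
      intervalIntegrable_iff.mpr <|
        (hw.integrableOn_isCompact isCompact_uIcc).mono_set uIoc_subset_uIcc
    simp only [add_sub_add_left_eq_sub]
    rw [intervalIntegral.integral_interval_sub_left (hi a q) (hi a p)]

lemma ac (h : IsPrim u w) (a b : ℝ) : AbsolutelyContinuousOnInterval u a b := by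
  have h1 := (h.intervalIntegrable a b).absolutelyContinuousOnInterval_intervalIntegral
    (c := a) left_mem_uIcc
  have h2 : AbsolutelyContinuousOnInterval (fun _ : ℝ => u a) a b :=
    (LipschitzWith.const (u a)).lipschitzOnWith.absolutelyContinuousOnInterval
  have h3 := h2.add h1
  have : u = (fun _ : ℝ => u a) + fun x => ∫ y in a..x, w y := by
    ext x; exact h.eq_add a x
  rw [this]; exact h3

lemma continuous (h : IsPrim u w) : Continuous u := by
  have : u = fun x => u 0 + ∫ y in (0 : ℝ)..x, w y := funext (h.eq_add 0)
  rw [this]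
  exact continuous_const.add (intervalIntegral.continuous_primitive h.intervalIntegrable 0)

lemma ae_hasDerivAt (h : IsPrim u w) : ∀ᵐ x, HasDerivAt u (w x) x := by
  filter_upwards [LocallyIntegrable.ae_hasDerivAt_integral h.loc] with x hx
  have : u = fun x => u 0 + ∫ y in (0 : ℝ)..x, w y := funext (h.eq_add 0)
  rw [this]
  exact (hx 0).const_add _

lemma of_ac (hu : ∀ a b, AbsolutelyContinuousOnInterval u a b) (hw : LocallyIntegrable w volume)
    (hd : ∀ᵐ x, HasDerivAt u (w x) x) : IsPrim u w where
  loc := hw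
  eq a b := by
    rw [← (hu a b).integral_deriv_eq_sub]
    refine intervalIntegral.integral_congr_ae ?_
    filter_upwards [hd] with x hx _ using hx.deriv

lemma congr_deriv (h : IsPrim u w) (hw : w =ᵐ[volume] w₁) : IsPrim u w₁ where
  loc := h.loc.congr hw
  eq a b := by
    rw [h.eq a b]
    refine intervalIntegral.integral_congr_ae ?_
    filter_upwards [hw] with x hx _ using hx

lemma add (h₁ : IsPrim u₁ w₁) (h₂ : IsPrim u₂ w₂) :
    IsPrim (fun x => u₁ x + u₂ x) (fun x => w₁ x + w₂ x) where
  loc := h₁.loc.add h₂.loc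
  eq a b := by
    rw [intervalIntegral.integral_add (h₁.intervalIntegrable a b) (h₂.intervalIntegrable a b),
      ← h₁.eq, ← h₂.eq]; ring

lemma const_mul (h : IsPrim u w) (c : ℝ) : IsPrim (fun x => c * u x) (fun x => c * w x) where
  loc := h.loc.smul c
  eq a b := by rw [intervalIntegral.integral_const_mul, ← h.eq]; ring

lemma mul (h₁ : IsPrim u₁ w₁) (h₂ : IsPrim u₂ w₂) :
    IsPrim (fun x => u₁ x * u₂ x) (fun x => w₁ x * u₂ x + u₁ x * w₂ x) := by
  refine of_ac (fun a b => (h₁.ac a b).fun_mul (h₂.ac a b)) ?_ ?_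
  · refine LocallyIntegrable.add ?_ ?_
    · have := h₁.loc.smul_continuous h₂.continuous
      simpa only [smul_eq_mul] using this
    · have := h₂.loc.continuous_smul h₁.continuous
      simpa only [smul_eq_mul] using this
  · filter_upwards [h₁.ae_hasDerivAt, h₂.ae_hasDerivAt] with x hx₁ hx₂ using hx₁.mul hx₂

lemma of_contDiff (hu : ContDiff ℝ 1 u) : IsPrim u (deriv u) :=
  of_ac (fun _ _ => hu.contDiffOn.absolutelyContinuousOnInterval)
    (hu.continuous_deriv le_rfl).locallyIntegrable
    (ae_of_all _ fun x => (hu.differentiable one_ne_zero x).hasDerivAt)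

/-- The chain rule for a `C¹` function applied to a locally absolutely continuous one. -/
lemma comp {Φ φ : ℝ → ℝ} (h : IsPrim u w) (hΦ : ∀ y, HasDerivAt Φ (φ y) y)
    (hφ : Continuous φ) : IsPrim (fun x => Φ (u x)) (fun x => φ (u x) * w x) := by
  have hd : deriv Φ = φ := funext fun y => (hΦ y).deriv
  have hC : ContDiff ℝ 1 Φ :=
    contDiff_one_iff_deriv.mpr ⟨fun y => (hΦ y).differentiableAt, hd ▸ hφ⟩
  refine of_ac (fun a b => ?_) ?_ ?_
  · obtain ⟨B, hB⟩ := (h.ac a b).exists_bound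
    obtain ⟨K, hK⟩ := hC.contDiffOn.exists_lipschitzOnWith one_ne_zero
      (convex_Icc (-B) B) isCompact_Icc
    rw [absolutelyContinuousOnInterval_iff]
    intro ε hε
    obtain ⟨δ, hδ, H⟩ := (absolutelyContinuousOnInterval_iff u a b).1 (h.ac a b)
      (ε / (K + 1)) (by positivity)
    refine ⟨δ, hδ, fun E hE hs => ?_⟩
    have hmem : ∀ y ∈ uIcc a b, u y ∈ Icc (-B) B := fun y hy => abs_le.1 (hB y hy)
    calc _ ≤ ∑ i ∈ Finset.range E.1, K * dist (u (E.2 i).1) (u (E.2 i).2) := by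
          refine Finset.sum_le_sum fun i hi => ?_
          exact hK.dist_le_mul _ (hmem _ (hE.1 i hi).1) _ (hmem _ (hE.1 i hi).2)
      _ = K * ∑ i ∈ Finset.range E.1, dist (u (E.2 i).1) (u (E.2 i).2) :=
          (Finset.mul_sum _ _ _).symm
      _ ≤ K * (ε / (K + 1)) := by gcongr; exact (H E hE hs).le
      _ < (K + 1) * (ε / (K + 1)) := by gcongr; linarith
      _ = ε := by field
  · have := h.loc.continuous_smul (hφ.comp h.continuous)
    simpa only [smul_eq_mul, Function.comp_apply] using this
  · filter_upwards [h.ae_hasDerivAt] with x hx using (hΦ _).comp x hx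

/-- Integration by parts against a test function. -/
lemma isWeakDeriv (h : IsPrim u w) : IsWeakDeriv u w := by
  intro φ hφ hc
  have h1 : IsPrim φ (deriv φ) := of_contDiff (hφ.of_le (by simp))
  have h2 := h.mul h1
  have hI1 : Integrable fun x => w x * φ x := by
    have := h.loc.integrable_smul_right_of_hasCompactSupport hφ.continuous hc
    simpa only [smul_eq_mul] using this
  have hI2 : Integrable fun x => u x * deriv φ x :=
    (h.continuous.mul (hφ.continuous_deriv (by simp))).integrable_of_hasCompactSupport
      hc.deriv.mul_left
  obtain ⟨R, hR⟩ := hc.isCompact.isBounded.subset_closedBall 0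
  have hz : ∀ x, R < |x| → φ x = 0 := fun x hx => by
    by_contra h0
    have := hR (subset_tsupport φ h0)
    rw [mem_closedBall_zero_iff, Real.norm_eq_abs] at this
    linarith
  have key : ∫ x, (w x * φ x + u x * deriv φ x) = 0 := by
    have hlim := intervalIntegral_tendsto_integral (hI1.add hI2) tendsto_neg_atTop_atBot tendsto_id
    have hev : (fun i : ℝ => ∫ x in (-i)..id i, (w x * φ x + u x * deriv φ x)) =ᶠ[atTop]
        fun _ => (0 : ℝ) := by
      filter_upwards [eventually_gt_atTop (max R 0)] with i hi
      have hi0 : 0 < i := lt_of_le_of_lt (le_max_right _ _) hi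
      have hiR : R < i := lt_of_le_of_lt (le_max_left _ _) hi
      rw [← h2.eq]
      simp [hz i (by rwa [abs_of_pos hi0]), hz (-i) (by rwa [abs_neg, abs_of_pos hi0])]
    exact tendsto_nhds_unique (hlim.congr' hev) tendsto_const_nhds |>.symm ▸ rfl
  rw [integral_add hI1 hI2] at key
  linarith

end IsPrim

lemma locallyIntegrable_of_memLp_two {u : ℝ → ℝ} (hu : MemLp u 2 volume) :
    LocallyIntegrable u volume :=
  hu.locallyIntegrable (by norm_num)

/-- A locally integrable function with vanishing weak derivative is constant. -/
lemma IsWeakDeriv.ae_const {u : ℝ → ℝ} (hu : LocallyIntegrable u volume)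
    (h : IsWeakDeriv u fun _ => 0) : ∃ c : ℝ, ∀ᵐ x, u x = c := by
  obtain ⟨ψ⟩ : Nonempty (ContDiffBump (0 : ℝ)) := ⟨⟨1, 2, one_pos, one_lt_two⟩⟩
  set ρ : ℝ → ℝ := ψ.normed volume with hρ
  have hρs : ContDiff ℝ ∞ ρ := ψ.contDiff_normed
  have hρc : HasCompactSupport ρ := ψ.hasCompactSupport_normed
  have hρi : ∫ x, ρ x = 1 := ψ.integral_normed
  refine ⟨∫ x, ρ x * u x, ?_⟩
  set c := ∫ x, ρ x * u x with hc
  have hint : ∀ φ : ℝ → ℝ, Continuous φ → HasCompactSupport φ → Integrable fun x => φ x * u x := by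
    intro φ h1 h2
    have := hu.integrable_smul_left_of_hasCompactSupport h1 h2
    simpa only [smul_eq_mul] using this
  have : ∀ᵐ x, u x - c = 0 := by
    refine ae_eq_zero_of_integral_contDiff_smul_eq_zero (hu.sub (locallyIntegrable_const c)) ?_
    intro φ hφ hφc
    have hφi : Integrable φ := hφ.continuous.integrable_of_hasCompactSupport hφc
    have hρI : Integrable ρ := hρs.continuous.integrable_of_hasCompactSupport hρc
    -- `φ - (∫ φ) ρ` has integral zero, hence is the derivative of a test function `Ψ`
    set a := ∫ x, φ x with ha
    set χ : ℝ → ℝ := fun x => φ x - a * ρ x with hχ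
    have hχs : ContDiff ℝ ∞ χ := hφ.sub (contDiff_const.mul hρs)
    have hχc : HasCompactSupport χ := hφc.sub hρc.mul_left
    have hχI : Integrable χ := hφi.sub (hρI.const_mul a)
    have hχ0 : ∫ x, χ x = 0 := by
      rw [hχ, integral_sub hφi (hρI.const_mul a), integral_const_mul, hρi]; simp [ha]
    obtain ⟨R, hR⟩ := hχc.isCompact.isBounded.subset_closedBall 0
    have hz : ∀ x, R < |x| → χ x = 0 := fun x hx => by
      by_contra h0
      have := hR (subset_tsupport χ h0)
      rw [mem_closedBall_zero_iff, Real.norm_eq_abs] at this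
      linarith
    set Ψ : ℝ → ℝ := fun x => ∫ y in Iic x, χ y with hΨ
    have hΨd : ∀ x, HasDerivAt Ψ (χ x) x := by
      intro x
      have e : Ψ = fun x => (∫ y in Iic 0, χ y) + ∫ y in (0 : ℝ)..x, χ y := by
        ext x
        rw [← intervalIntegral.integral_Iic_sub_Iic hχI.integrableOn hχI.integrableOn]
        simp [hΨ]
      rw [e]
      exact ((hχs.continuous.integral_hasStrictDerivAt 0 x).hasDerivAt).const_add _
    have hΨd' : deriv Ψ = χ := funext fun x => (hΨd x).deriv
    have hΨs : ContDiff ℝ ∞ Ψ := by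
      rw [contDiff_infty_iff_deriv]
      exact ⟨fun x => (hΨd x).differentiableAt, hΨd' ▸ hχs⟩
    have hΨc : HasCompactSupport Ψ := by
      refine HasCompactSupport.intro (isCompact_closedBall (0 : ℝ) R) fun x hx => ?_
      rw [mem_closedBall_zero_iff, Real.norm_eq_abs, not_le] at hx
      rcases le_total 0 x with h0 | h0
      · rw [abs_of_nonneg h0] at hx
        have : ∫ y in Ioi x, χ y = 0 := setIntegral_eq_zero_of_forall_eq_zero fun y hy =>
          hz y (by rw [abs_of_nonneg (h0.trans (le_of_lt hy))]; exact hx.trans hy)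
        have h2 := intervalIntegral.integral_Iic_add_Ioi (b := x) hχI.integrableOn hχI.integrableOn
        rw [this, hχ0, add_zero] at h2
        exact h2
      · rw [abs_of_nonpos h0] at hx
        exact setIntegral_eq_zero_of_forall_eq_zero fun y hy =>
          hz y (by
            have hy' : y ≤ x := hy
            rw [abs_of_nonpos (hy'.trans h0)]; linarith)
    have h1 := h Ψ hΨs hΨc
    rw [hΨd'] at h1
    simp only [zero_mul, integral_zero, neg_zero] at h1
    have e1 : ∫ x, u x * χ x = (∫ x, φ x * u x) - a * c := by
      rw [hc, ← integral_const_mul, ← integral_sub (hint φ hφ.continuous hφc)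
        ((hint ρ hρs.continuous hρc).const_mul a)]
      congr 1; ext x; simp only [hχ]; ring
    have e2 : ∫ x, φ x • (u x - c) = (∫ x, φ x * u x) - a * c := by
      rw [ha, ← integral_mul_const, ← integral_sub (hint φ hφ.continuous hφc)
        (hφi.mul_const c)]
      congr 1; ext x; simp only [smul_eq_mul]; ring
    exact e2.trans (e1.symm.trans h1)
  filter_upwards [this] with x hx using sub_eq_zero.1 hx

/-- A locally integrable function with locally integrable weak derivative has a locally absolutely
continuous representative. -/
lemma IsWeakDeriv.exists_isPrim {u w : ℝ → ℝ} (hu : LocallyIntegrable u volume)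
    (hw : LocallyIntegrable w volume) (h : IsWeakDeriv u w) :
    ∃ u' : ℝ → ℝ, IsPrim u' w ∧ u =ᵐ[volume] u' := by
  have hp := IsPrim.of_integral hw 0 0
  set W : ℝ → ℝ := fun x => 0 + ∫ y in (0 : ℝ)..x, w y with hW
  obtain ⟨c, hc⟩ := IsWeakDeriv.ae_const (hu.sub hp.continuous.locallyIntegrable)
    (u := u - W) (by
      intro φ h1 h2
      have i1 : Integrable fun x => u x * deriv φ x := by
        have := hu.integrable_smul_right_of_hasCompactSupport
          (h1.continuous_deriv (by simp)) h2.deriv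
        simpa only [smul_eq_mul] using this
      have i2 : Integrable fun x => W x * deriv φ x :=
        (hp.continuous.mul (h1.continuous_deriv (by simp))).integrable_of_hasCompactSupport
          h2.deriv.mul_left
      have e : ∀ x, (u - W) x * deriv φ x = u x * deriv φ x - W x * deriv φ x := fun x => by
        simp [sub_mul]
      simp only [e]
      rw [integral_sub i1 i2, h φ h1 h2, hp.isWeakDeriv φ h1 h2]
      simp)
  refine ⟨fun x => c + ∫ y in (0 : ℝ)..x, w y, IsPrim.of_integral hw c 0, ?_⟩
  filter_upwards [hc] with x hx
  simp only [hW, Pi.sub_apply, zero_add] at hx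
  linarith

lemma IsWeakDeriv.unique {u w w' : ℝ → ℝ} (hw : LocallyIntegrable w volume)
    (hw' : LocallyIntegrable w' volume) (h : IsWeakDeriv u w) (h' : IsWeakDeriv u w') :
    w =ᵐ[volume] w' := by
  refine ae_eq_of_integral_contDiff_smul_eq hw hw' fun φ h1 h2 => ?_
  have := (h φ h1 h2).symm.trans (h' φ h1 h2)
  simp only [smul_eq_mul, mul_comm (φ _)]
  linarith

lemma IsWeakDeriv.congr {u w u' w' : ℝ → ℝ} (h : IsWeakDeriv u w) (hu : u =ᵐ[volume] u')
    (hw : w =ᵐ[volume] w') : IsWeakDeriv u' w' := by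
  intro φ h1 h2
  have e1 : ∫ x, u' x * deriv φ x = ∫ x, u x * deriv φ x :=
    integral_congr_ae (hu.symm.mul (EventuallyEq.refl _ (deriv φ)))
  have e2 : ∫ x, w' x * φ x = ∫ x, w x * φ x :=
    integral_congr_ae (hw.symm.mul (EventuallyEq.refl _ φ))
  rw [e1, e2]
  exact h φ h1 h2

/-- A square integrable function takes arbitrarily small values. -/
lemma exists_sq_lt_of_memLp_two {u : ℝ → ℝ} (hu : MemLp u 2 volume) {ε : ℝ} (hε : 0 < ε) :
    ∃ y, u y ^ 2 < ε := by
  by_contra! H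
  have h1 : Integrable (fun _ : ℝ => ε) :=
    hu.integrable_sq.mono' aestronglyMeasurable_const
      (ae_of_all _ fun x => by rw [Real.norm_of_nonneg hε.le]; exact H x)
  rw [integrable_const_iff] at h1
  rcases h1 with h1 | h1
  · exact hε.ne' h1
  · exact absurd (h1.measure_univ_lt_top) (by simp)

/-- If `(u²)' = 2 u w` is dominated by an integrable function `e`, then `u² ≤ ∫ e`. -/
lemma IsPrim.sq_le_integral {u w e : ℝ → ℝ} (h : IsPrim u w) (hu : MemLp u 2 volume)
    (he : Integrable e) (hb : ∀ᵐ x, |2 * (u x * w x)| ≤ e x) (x : ℝ) : u x ^ 2 ≤ ∫ y, e y := by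
  refine le_of_forall_pos_le_add fun ε hε => ?_
  obtain ⟨y, hy⟩ := exists_sq_lt_of_memLp_two hu hε
  have h2 := (h.mul h).eq y x
  have he0 : ∀ᵐ x, 0 ≤ e x := hb.mono fun x hx => (abs_nonneg _).trans hx
  have h3 : |∫ t in y..x, (w t * u t + u t * w t)| ≤ ∫ t, e t := by
    calc _ ≤ ∫ t in uIoc y x, ‖w t * u t + u t * w t‖ := by
          rw [← Real.norm_eq_abs]
          exact intervalIntegral.norm_integral_le_integral_norm_uIoc
      _ ≤ ∫ t in uIoc y x, e t := by
          refine setIntegral_mono_ae_restrict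
            (intervalIntegrable_iff.1 ((h.mul h).intervalIntegrable y x)).norm
            he.integrableOn ?_
          refine ae_restrict_of_ae ?_
          filter_upwards [hb] with t ht
          rw [Real.norm_eq_abs, show w t * u t + u t * w t = 2 * (u t * w t) by ring]
          exact ht
      _ ≤ ∫ t, e t := setIntegral_le_integral he he0
  rw [← h2] at h3
  have := (abs_le.1 h3).2
  nlinarith

/-! ### The phase space -/

/-- The weak derivative of the first component of a point of `X`. -/
def X.dx (z : X) : ℝ → ℝ := H1.dx z.fst

/-- `z ↦ k` as a continuous linear map into `L²`. -/
def kL : X →L[ℝ] L2 :=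
  (WithLp.fstL 2 ℝ L2 L2).comp ((H1.subtypeL).comp (WithLp.fstL 1 ℝ H1 (WithLp 1 (L2Linf × Linf))))

/-- `z ↦ k_ξ` as a continuous linear map into `L²`. -/
def dxL : X →L[ℝ] L2 :=
  (WithLp.sndL 2 ℝ L2 L2).comp ((H1.subtypeL).comp (WithLp.fstL 1 ℝ H1 (WithLp 1 (L2Linf × Linf))))

/-- `z ↦ v` as a continuous linear map into `L²`. -/
def vL : X →L[ℝ] L2 :=
  (WithLp.fstL 1 ℝ L2 Linf).comp ((L2Linf.subtypeL).comp
    ((WithLp.fstL 1 ℝ L2Linf Linf).comp (WithLp.sndL 1 ℝ H1 (WithLp 1 (L2Linf × Linf)))))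

/-- `z ↦ v` as a continuous linear map into `L^∞`. -/
def vinfL : X →L[ℝ] Linf :=
  (WithLp.sndL 1 ℝ L2 Linf).comp ((L2Linf.subtypeL).comp
    ((WithLp.fstL 1 ℝ L2Linf Linf).comp (WithLp.sndL 1 ℝ H1 (WithLp 1 (L2Linf × Linf)))))

/-- `z ↦ q` as a continuous linear map into `L^∞`. -/
def qL : X →L[ℝ] Linf :=
  (WithLp.sndL 1 ℝ L2Linf Linf).comp (WithLp.sndL 1 ℝ H1 (WithLp 1 (L2Linf × Linf)))

lemma coe_kL (z : X) : (kL z : ℝ → ℝ) = X.k z := rfl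
lemma coe_dxL (z : X) : (dxL z : ℝ → ℝ) = X.dx z := rfl
lemma coe_vL (z : X) : (vL z : ℝ → ℝ) = X.v z := rfl
lemma coe_qL (z : X) : (qL z : ℝ → ℝ) = X.q z := rfl
lemma coe_vinfL (z : X) : X.v z =ᵐ[volume] vinfL z := z.snd.fst.2

lemma norm_X_eq (z : X) :
    ‖z‖ = √(‖kL z‖ ^ 2 + ‖dxL z‖ ^ 2) + ((‖vL z‖ + ‖vinfL z‖) + ‖qL z‖) := by
  rw [WithLp.prod_norm_eq_of_L1, WithLp.prod_norm_eq_of_L1]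
  have h1 : ‖z.fst‖ = √(‖kL z‖ ^ 2 + ‖dxL z‖ ^ 2) := by
    change ‖(z.fst : WithLp 2 (L2 × L2))‖ = _
    rw [WithLp.prod_norm_eq_of_L2]; rfl
  have h2 : ‖z.snd.fst‖ = ‖vL z‖ + ‖vinfL z‖ := by
    change ‖(z.snd.fst : WithLp 1 (L2 × Linf))‖ = _
    rw [WithLp.prod_norm_eq_of_L1]; rfl
  rw [h1, h2]; rfl

lemma norm_X_le_sum (z : X) :
    ‖z‖ ≤ ‖kL z‖ + ‖dxL z‖ + ‖vL z‖ + ‖vinfL z‖ + ‖qL z‖ := by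
  rw [norm_X_eq]
  have : √(‖kL z‖ ^ 2 + ‖dxL z‖ ^ 2) ≤ ‖kL z‖ + ‖dxL z‖ := by
    rw [Real.sqrt_le_left (by positivity)]
    nlinarith [norm_nonneg (kL z), norm_nonneg (dxL z)]
  linarith

lemma norm_kL_le (z : X) : ‖kL z‖ ≤ ‖z‖ := by
  rw [norm_X_eq z]
  have : ‖kL z‖ ≤ √(‖kL z‖ ^ 2 + ‖dxL z‖ ^ 2) := Real.le_sqrt_of_sq_le (by nlinarith [sq_nonneg ‖dxL z‖])
  have := norm_nonneg (vL z); have := norm_nonneg (vinfL z); have := norm_nonneg (qL z)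
  linarith

lemma norm_dxL_le (z : X) : ‖dxL z‖ ≤ ‖z‖ := by
  rw [norm_X_eq z]
  have : ‖dxL z‖ ≤ √(‖kL z‖ ^ 2 + ‖dxL z‖ ^ 2) := Real.le_sqrt_of_sq_le (by nlinarith [sq_nonneg ‖kL z‖])
  have := norm_nonneg (vL z); have := norm_nonneg (vinfL z); have := norm_nonneg (qL z)
  linarith

lemma norm_vL_le (z : X) : ‖vL z‖ ≤ ‖z‖ := by
  rw [norm_X_eq z]
  have := Real.sqrt_nonneg (‖kL z‖ ^ 2 + ‖dxL z‖ ^ 2)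
  have := norm_nonneg (vinfL z); have := norm_nonneg (qL z)
  linarith

lemma norm_vinfL_le (z : X) : ‖vinfL z‖ ≤ ‖z‖ := by
  rw [norm_X_eq z]
  have := Real.sqrt_nonneg (‖kL z‖ ^ 2 + ‖dxL z‖ ^ 2)
  have := norm_nonneg (vL z); have := norm_nonneg (qL z)
  linarith

lemma norm_qL_le (z : X) : ‖qL z‖ ≤ ‖z‖ := by
  rw [norm_X_eq z]
  have := Real.sqrt_nonneg (‖kL z‖ ^ 2 + ‖dxL z‖ ^ 2)
  have := norm_nonneg (vL z); have := norm_nonneg (vinfL z)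
  linarith

lemma Linf_ae_le (f : Linf) : ∀ᵐ x, |f x| ≤ ‖f‖ := by
  have := ae_le_lpNorm_exponent_top (Lp.memLp f)
  rwa [← toReal_eLpNorm (Lp.aestronglyMeasurable f), ← Lp.norm_def] at this

lemma norm_Lp_le {p : ℝ≥0∞} (f : Lp ℝ p (volume : Measure ℝ)) {D : ℝ → ℝ}
    (hD : MemLp D p volume) {C : ℝ} (h : ∀ᵐ x, |f x| ≤ C * |D x|) :
    ‖f‖ ≤ C * lpNorm D p volume := by
  have h1 := Lp.norm_le_mul_norm_of_ae_le_mul (f := f) (g := hD.toLp D) (c := C) (by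
    filter_upwards [h, hD.coeFn_toLp] with x hx hx'
    rw [hx']; exact hx)
  rwa [Lp.norm_toLp, toReal_eLpNorm hD.1] at h1

lemma memLp_k (z : X) : MemLp (X.k z) 2 volume := Lp.memLp (kL z)
lemma memLp_dx (z : X) : MemLp (X.dx z) 2 volume := Lp.memLp (dxL z)
lemma memLp_v (z : X) : MemLp (X.v z) 2 volume := Lp.memLp (vL z)
lemma memLp_v_top (z : X) : MemLp (X.v z) ∞ volume :=
  (memLp_congr_ae (coe_vinfL z)).2 (Lp.memLp (vinfL z))
lemma memLp_q (z : X) : MemLp (X.q z) ∞ volume := Lp.memLp (qL z)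
lemma measurable_k (z : X) : Measurable (X.k z) := (Lp.stronglyMeasurable (kL z)).measurable
lemma measurable_v (z : X) : Measurable (X.v z) := (Lp.stronglyMeasurable (vL z)).measurable
lemma measurable_q (z : X) : Measurable (X.q z) := (Lp.stronglyMeasurable (qL z)).measurable

lemma isWeakDeriv_X (z : X) : IsWeakDeriv (X.k z) (X.dx z) := z.fst.2

lemma lpNorm_k_le (z : X) : lpNorm (X.k z) 2 volume ≤ ‖z‖ := by
  have := norm_kL_le z
  rwa [Lp.norm_def, toReal_eLpNorm (Lp.aestronglyMeasurable _)] at this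

lemma lpNorm_dx_le (z : X) : lpNorm (X.dx z) 2 volume ≤ ‖z‖ := by
  have := norm_dxL_le z
  rwa [Lp.norm_def, toReal_eLpNorm (Lp.aestronglyMeasurable _)] at this

lemma lpNorm_v_le (z : X) : lpNorm (X.v z) 2 volume ≤ ‖z‖ := by
  have := norm_vL_le z
  rwa [Lp.norm_def, toReal_eLpNorm (Lp.aestronglyMeasurable _)] at this

lemma ae_abs_v_le (z : X) : ∀ᵐ x, |X.v z x| ≤ ‖z‖ := by
  filter_upwards [Linf_ae_le (vinfL z), coe_vinfL z] with x h1 h2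
  rw [h2]; exact h1.trans (norm_vinfL_le z)

lemma ae_abs_q_le (z : X) : ∀ᵐ x, |X.q z x| ≤ ‖z‖ := by
  filter_upwards [Linf_ae_le (qL z)] with x h1
  exact h1.trans (norm_qL_le z)

lemma integral_sq_eq {f : ℝ → ℝ} (hf : MemLp f 2 volume) :
    ∫ x, f x ^ 2 = lpNorm f 2 volume ^ 2 := by
  rw [lpNorm_eq_integral_norm_rpow_toReal (by simp) (by simp) hf.1]
  have h0 : 0 ≤ ∫ x, f x ^ 2 := integral_nonneg fun x => sq_nonneg _
  simp only [ENNReal.toReal_ofNat, Real.rpow_ofNat, Real.norm_eq_abs, sq_abs]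
  rw [← Real.rpow_natCast, ← Real.rpow_mul h0]; norm_num

/-- The Sobolev embedding `H¹ ⊂ L^∞`. -/
lemma ae_abs_k_le (z : X) : ∀ᵐ x, |X.k z x| ≤ 2 * ‖z‖ := by
  obtain ⟨u, hu, hku⟩ := (isWeakDeriv_X z).exists_isPrim
    (locallyIntegrable_of_memLp_two (memLp_k z)) (locallyIntegrable_of_memLp_two (memLp_dx z))
  have hu2 : MemLp u 2 volume := (memLp_congr_ae hku).1 (memLp_k z)
  have h := hu.sq_le_integral hu2 (e := fun x => X.k z x ^ 2 + X.dx z x ^ 2)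
    ((memLp_k z).integrable_sq.add (memLp_dx z).integrable_sq) (by
      filter_upwards [hku] with x hx
      rw [hx, abs_le]
      constructor <;> nlinarith [sq_nonneg (u x - X.dx z x), sq_nonneg (u x + X.dx z x)])
  rw [integral_add (memLp_k z).integrable_sq (memLp_dx z).integrable_sq,
    integral_sq_eq (memLp_k z), integral_sq_eq (memLp_dx z)] at h
  filter_upwards [hku] with x hx
  rw [hx]
  refine abs_le_of_sq_le_sq ?_ (by positivity)
  have h1 := lpNorm_k_le z
  have h2 := lpNorm_dx_le z
  have h3 : (0 : ℝ) ≤ lpNorm (X.k z) 2 volume := lpNorm_nonneg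
  have h4 : (0 : ℝ) ≤ lpNorm (X.dx z) 2 volume := lpNorm_nonneg
  nlinarith [h x, norm_nonneg z]

lemma X.k_sub (z w : X) : X.k (z - w) =ᵐ[volume] fun x => X.k z x - X.k w x := by
  rw [← coe_kL, map_sub]; exact Lp.coeFn_sub _ _
lemma X.dx_sub (z w : X) : X.dx (z - w) =ᵐ[volume] fun x => X.dx z x - X.dx w x := by
  rw [← coe_dxL, map_sub]; exact Lp.coeFn_sub _ _
lemma X.v_sub (z w : X) : X.v (z - w) =ᵐ[volume] fun x => X.v z x - X.v w x := by
  rw [← coe_vL, map_sub]; exact Lp.coeFn_sub _ _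
lemma X.q_sub (z w : X) : X.q (z - w) =ᵐ[volume] fun x => X.q z x - X.q w x := by
  rw [← coe_qL, map_sub]; exact Lp.coeFn_sub _ _

/-- A pointwise bound of all components by one function of `L² ∩ L^∞` bounds the norm of `X`. -/
lemma norm_X_le {z : X} {D : ℝ → ℝ} {C : ℝ} (h2 : MemLp D 2 volume) (hi : MemLp D ∞ volume)
    (hk : ∀ᵐ x, |X.k z x| ≤ C * |D x|) (hd : ∀ᵐ x, |X.dx z x| ≤ C * |D x|)
    (hv : ∀ᵐ x, |X.v z x| ≤ C * |D x|) (hq : ∀ᵐ x, |X.q z x| ≤ C * |D x|) :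
    ‖z‖ ≤ C * (3 * lpNorm D 2 volume + 2 * lpNorm D ∞ volume) := by
  have h1 := norm_Lp_le (kL z) h2 hk
  have h3 := norm_Lp_le (dxL z) h2 hd
  have h4 := norm_Lp_le (vL z) h2 hv
  have h5 := norm_Lp_le (vinfL z) hi (C := C) (by
    filter_upwards [hv, coe_vinfL z] with x h1 h2
    rwa [← h2])
  have h6 := norm_Lp_le (qL z) hi hq
  linarith [norm_X_le_sum z]

/-- Functions with the appropriate integrability define a point of `X`. -/
lemma exists_X {k w v q : ℝ → ℝ} (hk : MemLp k 2 volume) (hw : MemLp w 2 volume)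
    (hkw : IsWeakDeriv k w) (hv : MemLp v 2 volume) (hvi : MemLp v ∞ volume)
    (hq : MemLp q ∞ volume) :
    ∃ z : X, X.k z =ᵐ[volume] k ∧ X.dx z =ᵐ[volume] w ∧ X.v z =ᵐ[volume] v ∧
      X.q z =ᵐ[volume] q := by
  refine ⟨WithLp.toLp 1 (⟨WithLp.toLp 2 (hk.toLp k, hw.toLp w), ?_⟩,
    WithLp.toLp 1 (⟨WithLp.toLp 1 (hv.toLp v, hvi.toLp v), ?_⟩, hq.toLp q)),
    hk.coeFn_toLp, hw.coeFn_toLp, hv.coeFn_toLp, hq.coeFn_toLp⟩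
  · exact hkw.congr hk.coeFn_toLp.symm hw.coeFn_toLp.symm
  · exact hv.coeFn_toLp.trans hvi.coeFn_toLp.symm

/-- A point of `X` is determined by the functions `k`, `v`, `q`. -/
lemma X.ext_ae {z w : X} (hk : X.k z =ᵐ[volume] X.k w) (hv : X.v z =ᵐ[volume] X.v w)
    (hq : X.q z =ᵐ[volume] X.q w) : z = w := by
  have hd : X.dx z =ᵐ[volume] X.dx w :=
    IsWeakDeriv.unique (locallyIntegrable_of_memLp_two (memLp_dx z))
      (locallyIntegrable_of_memLp_two (memLp_dx w)) (isWeakDeriv_X z)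
      ((isWeakDeriv_X w).congr hk.symm (EventuallyEq.refl _ _))
  have e1 : kL z = kL w := Lp.ext hk
  have e2 : dxL z = dxL w := Lp.ext hd
  have e3 : vL z = vL w := Lp.ext hv
  have e4 : vinfL z = vinfL w := Lp.ext ((coe_vinfL z).symm.trans (hv.trans (coe_vinfL w)))
  have e5 : qL z = qL w := Lp.ext hq
  rw [← sub_eq_zero, ← norm_eq_zero, norm_X_eq]
  simp only [map_sub, e1, e2, e3, e4, e5, sub_self, norm_zero]
  simp

/-- Integration against an integrable function, as a continuous linear form on `L^∞`. -/
def integralL (d : ℝ → ℝ) (hd : Integrable d) : Linf →L[ℝ] ℝ :=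
  LinearMap.mkContinuous
    { toFun := fun f => ∫ x, d x * f x
      map_add' := fun f g => by
        have h1 : Integrable fun x => d x * f x := hd.mul_of_top_left (Lp.memLp f)
        have h2 : Integrable fun x => d x * g x := hd.mul_of_top_left (Lp.memLp g)
        rw [← integral_add h1 h2]
        refine integral_congr_ae ?_
        filter_upwards [Lp.coeFn_add f g] with x hx
        rw [hx, Pi.add_apply, mul_add]
      map_smul' := fun c f => by
        simp only [RingHom.id_apply, smul_eq_mul]
        rw [← integral_const_mul]
        refine integral_congr_ae ?_
        filter_upwards [Lp.coeFn_smul c f] with x hx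
        rw [hx, Pi.smul_apply, smul_eq_mul]; ring }
    (∫ x, |d x|) (fun f => by
      simp only [LinearMap.coe_mk, AddHom.coe_mk]
      refine (norm_integral_le_integral_norm _).trans ?_
      rw [← integral_mul_const]
      refine integral_mono_ae (hd.mul_of_top_left (Lp.memLp f)).norm (hd.abs.mul_const _) ?_
      filter_upwards [Linf_ae_le f] with x hx
      rw [norm_mul, Real.norm_eq_abs, Real.norm_eq_abs]
      gcongr)

lemma integralL_apply (d : ℝ → ℝ) (hd : Integrable d) (f : Linf) :
    integralL d hd f = ∫ x, d x * f x := rfl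

/-- Integration against a square integrable function, as a continuous linear form on `L²`. -/
def integralL2 (a : ℝ → ℝ) (ha : MemLp a 2 volume) : L2 →L[ℝ] ℝ := innerSL ℝ (ha.toLp a)

lemma integralL2_apply (a : ℝ → ℝ) (ha : MemLp a 2 volume) (f : L2) :
    integralL2 a ha f = ∫ x, a x * f x := by
  rw [integralL2, innerSL_apply_apply, L2.inner_def]
  refine integral_congr_ae ?_
  filter_upwards [ha.coeFn_toLp] with x hx
  rw [hx]; simp [mul_comm]

/-- `H1` is closed in `L² × L²`: each test function gives a closed condition. -/
instance : CompleteSpace H1 := by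
  have : IsClosed (H1 : Set (WithLp 2 (L2 × L2))) := by
    have h : (H1 : Set (WithLp 2 (L2 × L2))) = ⋂ (φ : ℝ → ℝ) (h1 : ContDiff ℝ ∞ φ)
        (h2 : HasCompactSupport φ), {p | ∫ x, p.fst x * deriv φ x = -∫ x, p.snd x * φ x} := by
      ext p; simp only [mem_iInter]; rfl
    rw [h]
    refine isClosed_iInter fun φ => isClosed_iInter fun h1 => isClosed_iInter fun h2 => ?_
    have m1 : MemLp (deriv φ) 2 volume :=
      (h1.continuous_deriv (by simp)).memLp_of_hasCompactSupport h2.deriv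
    have m2 : MemLp φ 2 volume := h1.continuous.memLp_of_hasCompactSupport h2
    have e : {p : WithLp 2 (L2 × L2) | ∫ x, p.fst x * deriv φ x = -∫ x, p.snd x * φ x}
        = {p | integralL2 _ m1 (WithLp.fstL 2 ℝ L2 L2 p)
          = -integralL2 _ m2 (WithLp.sndL 2 ℝ L2 L2 p)} := by
      ext p
      simp only [mem_ofPred_eq, integralL2_apply, mul_comm (deriv φ _), mul_comm (φ _)]
      rfl
    rw [e]
    exact isClosed_eq (by fun_prop) (by fun_prop)
  exact this.completeSpace_coe

/-- `L² ∩ L^∞` is closed in `L² × L^∞`: a.e. equality of the two components amounts to the equality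
of their integrals over the sets of finite measure. -/
instance : CompleteSpace L2Linf := by
  have : IsClosed (L2Linf : Set (WithLp 1 (L2 × Linf))) := by
    have ind2 : ∀ s : Set ℝ, MeasurableSet s → volume s < (∞ : ℝ≥0∞) →
        MemLp (s.indicator fun _ => (1 : ℝ)) 2 volume := fun s hs hμ =>
      memLp_indicator_const 2 hs 1 (Or.inr hμ.ne)
    have ind1 : ∀ s : Set ℝ, MeasurableSet s → volume s < (∞ : ℝ≥0∞) →
        Integrable (s.indicator fun _ => (1 : ℝ)) := fun s hs hμ =>
      (integrable_indicator_iff hs).2 (integrableOn_const hμ.ne)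
    have e1 : ∀ (s : Set ℝ) (f : ℝ → ℝ), MeasurableSet s →
        ∫ x, s.indicator (fun _ => (1 : ℝ)) x * f x = ∫ x in s, f x := by
      intro s f hs
      rw [← integral_indicator hs]
      congr 1; ext x
      by_cases hx : x ∈ s <;> simp [hx]
    have h : (L2Linf : Set (WithLp 1 (L2 × Linf))) = ⋂ (s : Set ℝ) (hs : MeasurableSet s)
        (hμ : volume s < (∞ : ℝ≥0∞)), {p | integralL2 _ (ind2 s hs hμ) (WithLp.fstL 1 ℝ L2 Linf p)
          = integralL _ (ind1 s hs hμ) (WithLp.sndL 1 ℝ L2 Linf p)} := by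
      ext p
      simp only [mem_iInter, mem_ofPred_eq, integralL2_apply, integralL_apply]
      constructor
      · intro hp s hs hμ
        refine integral_congr_ae ?_
        have hp' : (p.fst : ℝ → ℝ) =ᵐ[volume] p.snd := hp
        filter_upwards [hp'] with x hx
        change _ * p.fst x = _ * p.snd x
        rw [hx]
      · intro H
        refine ae_eq_of_forall_setIntegral_eq_of_sigmaFinite (f := p.fst) (g := p.snd)
          (fun s hs hμ => ?_) (fun s hs hμ => ?_) (fun s hs hμ => ?_)
        · have : IsFiniteMeasure (volume.restrict s) := ⟨by simpa using hμ⟩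
          exact ((Lp.memLp p.fst).restrict s).integrable (by norm_num)
        · have : IsFiniteMeasure (volume.restrict s) := ⟨by simpa using hμ⟩
          exact ((Lp.memLp p.snd).restrict s).integrable (by norm_num)
        · have := H s hs hμ
          rw [e1 _ _ hs, e1 _ _ hs] at this
          exact this
    rw [h]
    exact isClosed_iInter fun s => isClosed_iInter fun h1 => isClosed_iInter fun h2 =>
      isClosed_eq (by fun_prop) (by fun_prop)
  exact this.completeSpace_coe

/-! ### Convolution with an exponential kernel -/

/-- The convolution of `b` with the kernel `x ↦ e^{-a|x|}`. -/
def expConv (a : ℝ) (b : ℝ → ℝ) (ξ : ℝ) : ℝ := ∫ η, Real.exp (-(a * |ξ - η|)) * b η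

lemma integral_expKernel {a : ℝ} (ha : 0 < a) : ∫ x : ℝ, Real.exp (-(a * |x|)) = 2 / a := by
  rw [integral_comp_abs (f := fun x => Real.exp (-(a * x)))]
  have : ∫ x in Ioi (0 : ℝ), Real.exp (-(a * x)) = 1 / a := by
    have := integral_exp_mul_Ioi (a := -a) (by linarith) 0
    simp only [neg_mul] at this
    rw [this]; simp
  rw [this]; ring

lemma integrable_expKernel {a : ℝ} (ha : 0 < a) :
    Integrable fun x : ℝ => Real.exp (-(a * |x|)) :=
  Integrable.of_integral_ne_zero (by rw [integral_expKernel ha]; positivity)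

lemma integrable_expKernel_sub {a : ℝ} (ha : 0 < a) (ξ : ℝ) :
    Integrable fun η : ℝ => Real.exp (-(a * |ξ - η|)) :=
  (integrable_expKernel ha).comp_sub_left ξ

lemma integral_expKernel_sub {a : ℝ} (ha : 0 < a) (ξ : ℝ) :
    ∫ η : ℝ, Real.exp (-(a * |ξ - η|)) = 2 / a := by
  rw [integral_sub_left_eq_self (fun x => Real.exp (-(a * |x|))) volume ξ, integral_expKernel ha]

lemma integrable_expConv {a : ℝ} (ha : 0 < a) {b : ℝ → ℝ} (hb : MemLp b ∞ volume) (ξ : ℝ) :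
    Integrable fun η : ℝ => Real.exp (-(a * |ξ - η|)) * b η :=
  (integrable_expKernel_sub ha ξ).mul_of_top_left hb

lemma measurable_expConv (a : ℝ) {b : ℝ → ℝ} (hb : Measurable b) : Measurable (expConv a b) := by
  have h : StronglyMeasurable (Function.uncurry fun ξ η : ℝ => Real.exp (-(a * |ξ - η|)) * b η) := by
    apply Measurable.stronglyMeasurable
    unfold Function.uncurry
    fun_prop
  exact (h.integral_prod_right (ν := volume)).measurable

lemma expConv_nonneg (a : ℝ) {b : ℝ → ℝ} (hb : ∀ x, 0 ≤ b x) (ξ : ℝ) : 0 ≤ expConv a b ξ :=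
  integral_nonneg fun η => mul_nonneg (Real.exp_pos _).le (hb η)

lemma abs_expConv_le {a : ℝ} (ha : 0 < a) {b : ℝ → ℝ} (hb : MemLp b ∞ volume) (ξ : ℝ) :
    |expConv a b ξ| ≤ 2 / a * lpNorm b ∞ volume := by
  rw [← integral_expKernel_sub ha ξ, ← integral_mul_const]
  refine (abs_integral_le_integral_abs).trans ?_
  refine integral_mono_ae (integrable_expConv ha hb ξ).abs
    ((integrable_expKernel_sub ha ξ).mul_const _) ?_
  filter_upwards [ae_le_lpNorm_exponent_top hb] with x hx
  rw [abs_mul, abs_of_pos (Real.exp_pos _)]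
  gcongr
  exact hx

lemma memLp_top_expConv {a : ℝ} (ha : 0 < a) {b : ℝ → ℝ} (hb : MemLp b ∞ volume)
    (hm : Measurable b) : MemLp (expConv a b) ∞ volume :=
  memLp_top_of_bound (measurable_expConv a hm).aestronglyMeasurable _
    (ae_of_all _ fun ξ => abs_expConv_le ha hb ξ)

lemma lpNorm_top_le {f : ℝ → ℝ} {C : ℝ} (hC : 0 ≤ C) (h : ∀ᵐ x, |f x| ≤ C) :
    lpNorm f ∞ volume ≤ C := by
  by_cases hf : AEStronglyMeasurable f volume
  · rw [← toReal_eLpNorm hf, eLpNorm_exponent_top]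
    refine ENNReal.toReal_le_of_le_ofReal hC (eLpNormEssSup_le_of_ae_bound ?_)
    simpa only [Real.norm_eq_abs] using h
  · rw [lpNorm_of_not_aestronglyMeasurable hf]; exact hC

lemma lpNorm_top_expConv_le {a : ℝ} (ha : 0 < a) {b : ℝ → ℝ} (hb : MemLp b ∞ volume) :
    lpNorm (expConv a b) ∞ volume ≤ 2 / a * lpNorm b ∞ volume :=
  lpNorm_top_le (mul_nonneg (by positivity) lpNorm_nonneg)
    (ae_of_all _ fun ξ => abs_expConv_le ha hb ξ)

/-- Jensen's inequality for the finite measure `e^{-a|ξ-η|} dη`. -/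
lemma expConv_sq_le {a : ℝ} (ha : 0 < a) {b : ℝ → ℝ} (hb : MemLp b ∞ volume) (ξ : ℝ) :
    expConv a b ξ ^ 2 ≤ 2 / a * expConv a (fun x => b x ^ 2) ξ := by
  set c := a / 2 * expConv a b ξ with hc
  have hb2 : MemLp (fun x => b x ^ 2) ∞ volume := by
    have := hb.mul hb (r := ∞)
    simpa only [pow_two] using! this
  have h0 : 0 ≤ ∫ η, Real.exp (-(a * |ξ - η|)) * (b η - c) ^ 2 :=
    integral_nonneg fun η => mul_nonneg (Real.exp_pos _).le (sq_nonneg _)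
  have e : ∀ η, Real.exp (-(a * |ξ - η|)) * (b η - c) ^ 2
      = Real.exp (-(a * |ξ - η|)) * b η ^ 2 - 2 * c * (Real.exp (-(a * |ξ - η|)) * b η)
        + c ^ 2 * Real.exp (-(a * |ξ - η|)) := fun η => by ring
  have i1 := integrable_expConv ha hb2 ξ
  have i2 := (integrable_expConv ha hb ξ).const_mul (2 * c)
  have i3 := (integrable_expKernel_sub ha ξ).const_mul (c ^ 2)
  simp only [e] at h0
  have i12 : Integrable fun η => Real.exp (-(a * |ξ - η|)) * b η ^ 2
      - 2 * c * (Real.exp (-(a * |ξ - η|)) * b η) := i1.sub i2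
  rw [integral_add i12 i3, integral_sub i1 i2, integral_const_mul, integral_const_mul,
    integral_expKernel_sub ha] at h0
  change 0 ≤ expConv a (fun x => b x ^ 2) ξ - 2 * c * expConv a b ξ + c ^ 2 * (2 / a) at h0
  have e2 : expConv a b ξ = 2 / a * c := by rw [hc]; field_simp
  rw [e2] at h0 ⊢
  have h1 : 0 ≤ expConv a (fun x => b x ^ 2) ξ - 2 / a * c ^ 2 := by
    calc (0 : ℝ) ≤ _ := h0
      _ = _ := by ring
  have h2 : 0 ≤ 2 / a := by positivity
  nlinarith [mul_nonneg h2 h1]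

/-- Young's inequality `L¹ * L¹ ⊂ L¹`, with the exact mass `2 / a` of the kernel. -/
lemma integrable_expConv_of_integrable {a : ℝ} (ha : 0 < a) {b : ℝ → ℝ} (hb : Integrable b) :
    Integrable (expConv a b) ∧ ∫ ξ, expConv a b ξ = 2 / a * ∫ ξ, b ξ := by
  have e : expConv a b = convolution b (fun x => Real.exp (-(a * |x|)))
      (ContinuousLinearMap.mul ℝ ℝ) volume := by
    ext ξ
    simp only [expConv, convolution, ContinuousLinearMap.mul_apply', mul_comm]
  rw [e]
  refine ⟨hb.integrable_convolution _ (integrable_expKernel ha), ?_⟩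
  rw [integral_convolution _ hb (integrable_expKernel ha), integral_expKernel ha]
  simp [mul_comm]

/-- Young's inequality `L¹ * L² ⊂ L²` for the exponential kernel. -/
lemma memLp_two_expConv {a : ℝ} (ha : 0 < a) {b : ℝ → ℝ} (hb : MemLp b ∞ volume)
    (hb2 : MemLp b 2 volume) (hm : Measurable b) :
    MemLp (expConv a b) 2 volume ∧
      lpNorm (expConv a b) 2 volume ≤ 2 / a * lpNorm b 2 volume := by
  obtain ⟨i1, i2⟩ := integrable_expConv_of_integrable ha hb2.integrable_sq
  have hsq : Integrable fun ξ => expConv a b ξ ^ 2 := by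
    refine (i1.const_mul (2 / a)).mono' ((measurable_expConv a hm).pow_const 2).aestronglyMeasurable
      (ae_of_all _ fun ξ => ?_)
    rw [Real.norm_of_nonneg (sq_nonneg _)]
    exact expConv_sq_le ha hb ξ
  have hL : MemLp (expConv a b) 2 volume :=
    (memLp_two_iff_integrable_sq (measurable_expConv a hm).aestronglyMeasurable).2 hsq
  refine ⟨hL, ?_⟩
  have h1 : lpNorm (expConv a b) 2 volume ^ 2 ≤ (2 / a * lpNorm b 2 volume) ^ 2 := by
    rw [← integral_sq_eq hL, mul_pow, ← integral_sq_eq hb2]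
    calc _ ≤ ∫ ξ, 2 / a * expConv a (fun x => b x ^ 2) ξ :=
          integral_mono hsq (i1.const_mul _) fun ξ => expConv_sq_le ha hb ξ
      _ = _ := by rw [integral_const_mul, i2]; ring
  exact le_of_sq_le_sq h1 (mul_nonneg (by positivity) lpNorm_nonneg)

/-- A function dominated by the kernel times `b` has its partial integrals dominated by the
convolution, whatever the domain of integration. -/
lemma expConv_mono_of_ae {a : ℝ} (ha : 0 < a) {b f : ℝ → ℝ} (hb : MemLp b ∞ volume) {C : ℝ}
    (ξ : ℝ) (S : Set ℝ) (hf : ∀ᵐ η, |f η| ≤ C * (Real.exp (-(a * |ξ - η|)) * |b η|)) :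
    |∫ η in S, f η| ≤ C * expConv a (fun x => |b x|) ξ := by
  have hi := (integrable_expConv ha hb.abs ξ).const_mul C
  have h0 : 0 ≤ᵐ[volume] fun η => C * (Real.exp (-(a * |ξ - η|)) * |b η|) := by
    filter_upwards [hf] with η h using (abs_nonneg _).trans h
  calc |∫ η in S, f η| ≤ ∫ η in S, C * (Real.exp (-(a * |ξ - η|)) * |b η|) := by
        rw [← Real.norm_eq_abs]
        exact norm_integral_le_of_norm_le hi.integrableOn (ae_restrict_of_ae hf)
    _ ≤ ∫ η, C * (Real.exp (-(a * |ξ - η|)) * |b η|) := setIntegral_le_integral hi h0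
    _ = _ := by rw [integral_const_mul]; rfl

/-! ### The local coefficients -/

/-- The coefficient `e^{λt} g(e^{-λt} k)`. -/
def coefG (lam : ℝ) (g : ℝ → ℝ) (t k : ℝ) : ℝ :=
  Real.exp (lam * t) * g (Real.exp (-(lam * t)) * k)

/-- The coefficient `e^{-λt} f''(e^{-λt} k)`. -/
def coefF (lam : ℝ) (f : ℝ → ℝ) (t k : ℝ) : ℝ :=
  Real.exp (-(lam * t)) * iteratedDeriv 2 f (Real.exp (-(lam * t)) * k)

lemma density_eq (lam : ℝ) (f g : ℝ → ℝ) (t : ℝ) (k v q : ℝ → ℝ) (ξ : ℝ) :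
    density lam f g t k v q ξ = (coefG lam g t (k ξ) * Real.cos (v ξ / 2) ^ 2
      + 1 / 2 * (coefF lam f t (k ξ) * Real.sin (v ξ / 2) ^ 2)) * q ξ := by
  simp only [density, coefG, coefF]; ring

lemma rhsV_eq (lam : ℝ) (f g : ℝ → ℝ) (t : ℝ) (k v q : ℝ → ℝ) (ξ : ℝ) :
    rhsV lam f g t k v q ξ = 2 * ((coefG lam g t (k ξ) - Pt lam f g t k v q ξ)
      * Real.cos (v ξ / 2) ^ 2) - coefF lam f t (k ξ) * Real.sin (v ξ / 2) ^ 2 := by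
  simp only [rhsV, coefG, coefF]; ring

lemma rhsQ_eq (lam : ℝ) (f g : ℝ → ℝ) (t : ℝ) (k v q : ℝ → ℝ) (ξ : ℝ) :
    rhsQ lam f g t k v q ξ = q ξ * (1 / 2 * (coefF lam f t (k ξ) * Real.sin (v ξ))
      + Real.sin (v ξ) * (coefG lam g t (k ξ) - Pt lam f g t k v q ξ)) := by
  simp only [rhsQ, coefG, coefF]; ring

lemma exists_lipschitz_of_contDiff {g : ℝ → ℝ} (hg : ContDiff ℝ 1 g) (M : ℝ) :
    ∃ L : ℝ, 0 ≤ L ∧ ∀ x y, |x| ≤ M → |y| ≤ M → |g x - g y| ≤ L * |x - y| := by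
  obtain ⟨K, hK⟩ := hg.contDiffOn.exists_lipschitzOnWith one_ne_zero
    (convex_Icc (-M) M) isCompact_Icc
  exact ⟨K, K.2, fun x y hx hy => hK.dist_le_mul x (abs_le.1 hx) y (abs_le.1 hy)⟩

lemma abs_exp_sub_exp_le {x y R : ℝ} (hx : x ≤ R) (hy : y ≤ R) :
    |Real.exp x - Real.exp y| ≤ Real.exp R * |x - y| := by
  have key : ∀ a b : ℝ, a ≤ R → b ≤ a → Real.exp a - Real.exp b ≤ Real.exp R * (a - b) := by
    intro a b ha hba
    have h1 := Real.add_one_le_exp (b - a)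
    have h2 : Real.exp b = Real.exp a * Real.exp (b - a) := by rw [← Real.exp_add]; congr 1; ring
    have h3 : Real.exp a ≤ Real.exp R := Real.exp_le_exp.2 ha
    have h4 := Real.exp_pos a
    calc Real.exp a - Real.exp b = Real.exp a * (1 - Real.exp (b - a)) := by rw [h2]; ring
      _ ≤ Real.exp a * (a - b) := mul_le_mul_of_nonneg_left (by linarith) h4.le
      _ ≤ Real.exp R * (a - b) := mul_le_mul_of_nonneg_right h3 (by linarith)
  rcases le_total y x with h | h
  · rw [abs_of_nonneg (sub_nonneg.2 (Real.exp_le_exp.2 h)), abs_of_nonneg (sub_nonneg.2 h)]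
    exact key x y hx h
  · rw [abs_sub_comm, abs_sub_comm x, abs_of_nonneg (sub_nonneg.2 (Real.exp_le_exp.2 h)),
      abs_of_nonneg (sub_nonneg.2 h)]
    exact key y x hy h

/-- The rescaled variable `e^{-λt} k`. Its modulus of continuity in time is proportional to `|k|`, so
that it remains square integrable when `k` is. -/
lemma coef_scaled_bounds {lam T M t₁ t₂ k₁ k₂ : ℝ} (hlam : 0 < lam) (h1 : t₁ ∈ Icc 0 T)
    (h2 : t₂ ∈ Icc 0 T) (hk₁ : |k₁| ≤ M) :
    |Real.exp (-(lam * t₁)) * k₁| ≤ M ∧ |Real.exp (-(lam * t₁)) * k₁| ≤ |k₁| ∧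
    |Real.exp (-(lam * t₁)) * k₁ - Real.exp (-(lam * t₂)) * k₂|
      ≤ (lam + 1) * (|k₁ - k₂| + |t₁ - t₂| * |k₂|) ∧
    |Real.exp (-(lam * t₁)) - Real.exp (-(lam * t₂))| ≤ lam * |t₁ - t₂| := by
  have e1 : Real.exp (-(lam * t₁)) ≤ 1 := Real.exp_le_one_iff.2 (by nlinarith [h1.1])
  have e0 := Real.exp_pos (-(lam * t₁))
  have hd : |Real.exp (-(lam * t₁)) - Real.exp (-(lam * t₂))| ≤ lam * |t₁ - t₂| := by
    have := abs_exp_sub_exp_le (x := -(lam * t₁)) (y := -(lam * t₂)) (R := 0)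
      (by nlinarith [h1.1]) (by nlinarith [h2.1])
    rw [Real.exp_zero, one_mul, show -(lam * t₁) - -(lam * t₂) = -(lam * (t₁ - t₂)) by ring,
      abs_neg, abs_mul, abs_of_pos hlam] at this
    exact this
  have hb : |Real.exp (-(lam * t₁)) * k₁| ≤ |k₁| := by
    rw [abs_mul, abs_of_pos e0]
    nlinarith [abs_nonneg k₁]
  refine ⟨hb.trans hk₁, hb, ?_, hd⟩
  rw [show Real.exp (-(lam * t₁)) * k₁ - Real.exp (-(lam * t₂)) * k₂
    = Real.exp (-(lam * t₁)) * (k₁ - k₂)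
      + (Real.exp (-(lam * t₁)) - Real.exp (-(lam * t₂))) * k₂ by ring]
  refine (abs_add_le _ _).trans ?_
  rw [abs_mul, abs_mul, abs_of_pos e0]
  have a1 := abs_nonneg (k₁ - k₂)
  have a2 := abs_nonneg k₂
  have a3 := abs_nonneg (t₁ - t₂)
  have a4 : |Real.exp (-(lam * t₁)) - Real.exp (-(lam * t₂))| * |k₂|
    ≤ lam * |t₁ - t₂| * |k₂| := by gcongr
  nlinarith [mul_nonneg a3 a2, mul_nonneg hlam.le a1]

/-- Since `g 0 = 0`, both the size of `e^{λt} g(e^{-λt} k)` and its modulus of continuity in time are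
proportional to `|k|`, which makes them square integrable in `ξ`. -/
lemma exists_coefG_bound {lam : ℝ} (hlam : 0 < lam) {g : ℝ → ℝ} (hg : ContDiff ℝ ∞ g)
    (hg0 : g 0 = 0) (T M : ℝ) : ∃ C : ℝ, 0 ≤ C ∧ ∀ t₁ ∈ Icc 0 T, ∀ t₂ ∈ Icc 0 T, ∀ k₁ k₂ : ℝ,
      |k₁| ≤ M → |k₂| ≤ M → |coefG lam g t₂ k₂| ≤ C * |k₂| ∧
      |coefG lam g t₁ k₁ - coefG lam g t₂ k₂| ≤ C * (|k₁ - k₂| + |t₁ - t₂| * |k₂|) := by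
  obtain ⟨L, hL, hl⟩ := exists_lipschitz_of_contDiff (hg.of_le (by simp)) M
  have hE := Real.exp_pos (lam * T)
  refine ⟨Real.exp (lam * T) * L * (2 * lam + 1), by positivity, ?_⟩
  intro t₁ h1 t₂ h2 k₁ k₂ hk₁ hk₂
  obtain ⟨b1, b1', bd, -⟩ := coef_scaled_bounds (k₂ := k₂) hlam h1 h2 hk₁
  obtain ⟨b2, b2', -, -⟩ := coef_scaled_bounds (k₂ := k₁) hlam h2 h1 hk₂
  have hM : 0 ≤ M := (abs_nonneg _).trans hk₁
  have hg2 := hl _ 0 b2 (by simpa using hM)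
  rw [hg0, sub_zero, sub_zero] at hg2
  have hg2' : |g (Real.exp (-(lam * t₂)) * k₂)| ≤ L * |k₂| := hg2.trans (by gcongr)
  have hgd := hl _ _ b1 b2
  have e1 : Real.exp (lam * t₁) ≤ Real.exp (lam * T) :=
    Real.exp_le_exp.2 (by nlinarith [h1.2])
  have e2 : Real.exp (lam * t₂) ≤ Real.exp (lam * T) :=
    Real.exp_le_exp.2 (by nlinarith [h2.2])
  have a1 := abs_nonneg (k₁ - k₂)
  have a2 := abs_nonneg k₂
  have a3 := abs_nonneg (t₁ - t₂)
  constructor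
  · rw [coefG, abs_mul, abs_of_pos (Real.exp_pos _)]
    calc _ ≤ Real.exp (lam * T) * (L * |k₂|) := by gcongr
      _ = Real.exp (lam * T) * L * |k₂| * 1 := by ring
      _ ≤ Real.exp (lam * T) * L * |k₂| * (2 * lam + 1) := by gcongr; linarith
      _ = _ := by ring
  · have hed : |Real.exp (lam * t₁) - Real.exp (lam * t₂)|
        ≤ Real.exp (lam * T) * (lam * |t₁ - t₂|) := by
      have := abs_exp_sub_exp_le (x := lam * t₁) (y := lam * t₂) (R := lam * T)
        (by nlinarith [h1.2]) (by nlinarith [h2.2])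
      rwa [← mul_sub, abs_mul, abs_of_pos hlam] at this
    rw [coefG, coefG, show Real.exp (lam * t₁) * g (Real.exp (-(lam * t₁)) * k₁)
        - Real.exp (lam * t₂) * g (Real.exp (-(lam * t₂)) * k₂)
      = Real.exp (lam * t₁) * (g (Real.exp (-(lam * t₁)) * k₁)
          - g (Real.exp (-(lam * t₂)) * k₂))
        + (Real.exp (lam * t₁) - Real.exp (lam * t₂)) * g (Real.exp (-(lam * t₂)) * k₂) by ring]
    refine (abs_add_le _ _).trans ?_
    rw [abs_mul, abs_mul, abs_of_pos (Real.exp_pos _)]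
    calc _ ≤ Real.exp (lam * T) * (L * ((lam + 1) * (|k₁ - k₂| + |t₁ - t₂| * |k₂|)))
          + Real.exp (lam * T) * (lam * |t₁ - t₂|) * (L * |k₂|) := by
            gcongr
            exact hgd.trans (by gcongr)
      _ = Real.exp (lam * T) * L * ((lam + 1) * |k₁ - k₂| + (2 * lam + 1) * (|t₁ - t₂| * |k₂|)) := by
            ring
      _ ≤ Real.exp (lam * T) * L * ((2 * lam + 1) * |k₁ - k₂|
          + (2 * lam + 1) * (|t₁ - t₂| * |k₂|)) := by gcongr; linarith
      _ = _ := by ring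

lemma contDiff_iteratedDeriv_two {f : ℝ → ℝ} (hf : ContDiff ℝ ∞ f) :
    ContDiff ℝ ∞ (iteratedDeriv 2 f) := by
  rw [iteratedDeriv_succ, iteratedDeriv_one]
  have h1 : ContDiff ℝ ∞ (deriv f) := (contDiff_infty_iff_deriv.1 hf).2
  exact (contDiff_infty_iff_deriv.1 h1).2

/-- The coefficient `e^{-λt} f''(e^{-λt} k)` is only bounded; it always occurs next to a factor
`sin v` or `sin²(v/2)`, which supplies the square integrability. -/
lemma exists_coefF_bound {lam : ℝ} (hlam : 0 < lam) {f : ℝ → ℝ} (hf : ContDiff ℝ ∞ f)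
    (T M : ℝ) : ∃ C : ℝ, 0 ≤ C ∧ ∀ t₁ ∈ Icc 0 T, ∀ t₂ ∈ Icc 0 T, ∀ k₁ k₂ : ℝ,
      |k₁| ≤ M → |k₂| ≤ M → |coefF lam f t₂ k₂| ≤ C ∧
      |coefF lam f t₁ k₁ - coefF lam f t₂ k₂| ≤ C * (|k₁ - k₂| + |t₁ - t₂|) := by
  have hφ := contDiff_iteratedDeriv_two hf
  set φ := iteratedDeriv 2 f with hφd
  obtain ⟨L, hL, hl⟩ := exists_lipschitz_of_contDiff (hφ.of_le (by simp)) M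
  refine ⟨(|φ 0| + L * |M|) * (lam + 1) + L * (lam + 1) * (1 + |M|), by positivity, ?_⟩
  intro t₁ h1 t₂ h2 k₁ k₂ hk₁ hk₂
  obtain ⟨b1, b1', bd, -⟩ := coef_scaled_bounds (k₂ := k₂) hlam h1 h2 hk₁
  obtain ⟨b2, b2', -, be⟩ := coef_scaled_bounds (k₂ := k₁) hlam h2 h1 hk₂
  have hM : 0 ≤ M := (abs_nonneg _).trans hk₁
  have hg2 := hl _ 0 b2 (by simpa using hM)
  rw [sub_zero] at hg2
  have hb : |φ (Real.exp (-(lam * t₂)) * k₂)| ≤ |φ 0| + L * |M| := by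
    have h3 := abs_sub_abs_le_abs_sub (φ (Real.exp (-(lam * t₂)) * k₂)) (φ 0)
    have h4 : L * |Real.exp (-(lam * t₂)) * k₂| ≤ L * |M| :=
      mul_le_mul_of_nonneg_left (b2.trans (le_abs_self M)) hL
    linarith
  have e1 : Real.exp (-(lam * t₁)) ≤ 1 := Real.exp_le_one_iff.2 (by nlinarith [h1.1])
  have e2 : Real.exp (-(lam * t₂)) ≤ 1 := Real.exp_le_one_iff.2 (by nlinarith [h2.1])
  have a1 := abs_nonneg (k₁ - k₂)
  have a2 := abs_nonneg k₂
  have a3 := abs_nonneg (t₁ - t₂)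
  have a4 : 0 ≤ |φ 0| + L * |M| := by positivity
  have hgd := hl _ _ b1 b2
  constructor
  · rw [coefF, abs_mul, abs_of_pos (Real.exp_pos _)]
    calc _ ≤ 1 * (|φ 0| + L * |M|) := by gcongr
      _ = (|φ 0| + L * |M|) * (0 + 1) + 0 := by ring
      _ ≤ _ := by gcongr; positivity
  · rw [coefF, coefF, show Real.exp (-(lam * t₁)) * φ (Real.exp (-(lam * t₁)) * k₁)
        - Real.exp (-(lam * t₂)) * φ (Real.exp (-(lam * t₂)) * k₂)
      = Real.exp (-(lam * t₁)) * (φ (Real.exp (-(lam * t₁)) * k₁)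
          - φ (Real.exp (-(lam * t₂)) * k₂))
        + (Real.exp (-(lam * t₁)) - Real.exp (-(lam * t₂))) * φ (Real.exp (-(lam * t₂)) * k₂) by ring]
    refine (abs_add_le _ _).trans ?_
    rw [abs_mul, abs_mul, abs_of_pos (Real.exp_pos _)]
    rw [abs_sub_comm, abs_sub_comm t₂] at be
    calc _ ≤ 1 * (L * ((lam + 1) * (|k₁ - k₂| + |t₁ - t₂| * |M|)))
          + (lam * |t₁ - t₂|) * (|φ 0| + L * |M|) := by
            have h3 : |t₁ - t₂| * |k₂| ≤ |t₁ - t₂| * |M| :=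
              mul_le_mul_of_nonneg_left (hk₂.trans (le_abs_self M)) a3
            gcongr
            refine hgd.trans ?_
            gcongr
            refine bd.trans ?_
            gcongr
      _ = L * (lam + 1) * |k₁ - k₂| + (L * (lam + 1) * |M| + (|φ 0| + L * |M|) * lam) * |t₁ - t₂| := by
            ring
      _ ≤ ((|φ 0| + L * |M|) * (lam + 1) + L * (lam + 1) * (1 + |M|)) * |k₁ - k₂|
          + ((|φ 0| + L * |M|) * (lam + 1) + L * (lam + 1) * (1 + |M|)) * |t₁ - t₂| := by
            have : 0 ≤ L * (lam + 1) := by positivity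
            have : 0 ≤ L * (lam + 1) * |M| := by positivity
            have : 0 ≤ (|φ 0| + L * |M|) * lam := by positivity
            exact add_le_add (mul_le_mul_of_nonneg_right (by linarith) a1)
              (mul_le_mul_of_nonneg_right (by linarith) a3)
      _ = _ := by ring

lemma continuous_coefG (lam : ℝ) {g : ℝ → ℝ} (hg : ContDiff ℝ ∞ g) (t : ℝ) :
    Continuous (coefG lam g t) := by
  unfold coefG
  exact continuous_const.mul (hg.continuous.comp (by fun_prop))

lemma continuous_coefF (lam : ℝ) {f : ℝ → ℝ} (hf : ContDiff ℝ ∞ f) (t : ℝ) :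
    Continuous (coefF lam f t) := by
  unfold coefF
  exact continuous_const.mul ((contDiff_iteratedDeriv_two hf).continuous.comp (by fun_prop))

/-! ### Calculus of differences -/

/-- The pair `(x₁, x₂)` consists of numbers bounded by `C`, at distance at most `C δ`. -/
def BddPair (δ C x₁ x₂ : ℝ) : Prop := |x₁| ≤ C ∧ |x₂| ≤ C ∧ |x₁ - x₂| ≤ C * δ

/-- The pair `(x₁, x₂)` satisfies `|x₂| ≤ C b` and `|x₁ - x₂| ≤ C D`. -/
def SmallPair (b D C x₁ x₂ : ℝ) : Prop := 0 ≤ C ∧ |x₂| ≤ C * b ∧ |x₁ - x₂| ≤ C * D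

namespace BddPair

variable {δ C C' x₁ x₂ y₁ y₂ : ℝ}

lemma nonneg (h : BddPair δ C x₁ x₂) : 0 ≤ C := (abs_nonneg _).trans h.1

lemma mul (hδ : 0 ≤ δ) (h : BddPair δ C x₁ x₂) (h' : BddPair δ C' y₁ y₂) :
    BddPair δ (2 * (C * C')) (x₁ * y₁) (x₂ * y₂) := by
  have hC := h.nonneg
  have hC' := h'.nonneg
  obtain ⟨a1, a2, a3⟩ := h
  obtain ⟨b1, b2, b3⟩ := h'
  have hCC := mul_nonneg hC hC'
  refine ⟨?_, ?_, ?_⟩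
  · rw [abs_mul]
    have : |x₁| * |y₁| ≤ C * C' := by gcongr
    linarith
  · rw [abs_mul]
    have : |x₂| * |y₂| ≤ C * C' := by gcongr
    linarith
  · rw [show x₁ * y₁ - x₂ * y₂ = x₁ * (y₁ - y₂) + (x₁ - x₂) * y₂ by ring]
    refine (abs_add_le _ _).trans ?_
    rw [abs_mul, abs_mul]
    calc _ ≤ C * (C' * δ) + C * δ * C' := by gcongr
      _ = _ := by ring

lemma mul_small {b D : ℝ} (hδ : 0 ≤ δ) (hD : δ * b ≤ D) (h : BddPair δ C x₁ x₂)
    (h' : SmallPair b D C' y₁ y₂) : SmallPair b D (2 * (C * C')) (x₁ * y₁) (x₂ * y₂) := by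
  have hC := h.nonneg
  obtain ⟨a1, a2, a3⟩ := h
  obtain ⟨hC', b2, b3⟩ := h'
  have hCC := mul_nonneg hC hC'
  refine ⟨by positivity, ?_, ?_⟩
  · rw [abs_mul]
    have h1 : |x₂| * |y₂| ≤ C * (C' * b) := by gcongr
    have h2 : 0 ≤ C * (C' * b) := (mul_nonneg (abs_nonneg _) (abs_nonneg _)).trans h1
    calc _ ≤ C * (C' * b) := h1
      _ ≤ 2 * (C * C') * b := by linarith
  · rw [show x₁ * y₁ - x₂ * y₂ = x₁ * (y₁ - y₂) + (x₁ - x₂) * y₂ by ring]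
    refine (abs_add_le _ _).trans ?_
    rw [abs_mul, abs_mul]
    calc _ ≤ C * (C' * D) + C * δ * (C' * b) := by gcongr
      _ = C * C' * D + C * C' * (δ * b) := by ring
      _ ≤ C * C' * D + C * C' * D := by gcongr
      _ = _ := by ring

end BddPair

namespace SmallPair

variable {b D C C' x₁ x₂ y₁ y₂ : ℝ}

lemma add (h : SmallPair b D C x₁ x₂) (h' : SmallPair b D C' y₁ y₂) :
    SmallPair b D (C + C') (x₁ + y₁) (x₂ + y₂) := by
  obtain ⟨a1, a2, a3⟩ := h
  obtain ⟨b1, b2, b3⟩ := h'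
  refine ⟨by positivity, ?_, ?_⟩
  · exact (abs_add_le _ _).trans (by linarith)
  · rw [add_sub_add_comm]
    exact (abs_add_le _ _).trans (by linarith)

lemma const_mul (h : SmallPair b D C x₁ x₂) (c : ℝ) :
    SmallPair b D (|c| * C) (c * x₁) (c * x₂) := by
  obtain ⟨a1, a2, a3⟩ := h
  refine ⟨by positivity, ?_, ?_⟩
  · rw [abs_mul, mul_assoc]; gcongr
  · rw [← mul_sub, abs_mul, mul_assoc]; gcongr

lemma neg (h : SmallPair b D C x₁ x₂) : SmallPair b D C (-x₁) (-x₂) := by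
  obtain ⟨a1, a2, a3⟩ := h
  refine ⟨a1, by rwa [abs_neg], ?_⟩
  rw [show -x₁ - -x₂ = -(x₁ - x₂) by ring, abs_neg]; exact a3

lemma sub (h : SmallPair b D C x₁ x₂) (h' : SmallPair b D C' y₁ y₂) :
    SmallPair b D (C + C') (x₁ - y₁) (x₂ - y₂) := by
  rw [sub_eq_add_neg, sub_eq_add_neg]; exact h.add h'.neg

lemma mono {b' D' : ℝ} (h : SmallPair b D C x₁ x₂) (hb0 : 0 ≤ b) (hb : b ≤ b') (hD0 : 0 ≤ D)
    (hD : D ≤ D') (hC : C ≤ C') : SmallPair b' D' C' x₁ x₂ := by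
  obtain ⟨a1, a2, a3⟩ := h
  have hC' := a1.trans hC
  exact ⟨hC', a2.trans (mul_le_mul hC hb hb0 hC'), a3.trans (mul_le_mul hC hD hD0 hC')⟩

end SmallPair

/-! ### The nonlocal kernel -/

/-- Quantitative bounds on a triple `(k, v, q)`: `|k| ≤ M`, `m ≤ q ≤ M` and
`∫ sin²(v/2) q ≤ M`. No bound on the size of `v` enters. -/
structure Adm (M m : ℝ) (k v q : ℝ → ℝ) : Prop where
  measurable_k : Measurable k
  measurable_v : Measurable v
  measurable_q : Measurable q
  memLp_k : MemLp k 2 volume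
  memLp_v : MemLp v 2 volume
  memLp_v_top : MemLp v ∞ volume
  abs_k_le : ∀ᵐ ξ, |k ξ| ≤ M
  le_q : ∀ᵐ ξ, m ≤ q ξ
  q_le : ∀ᵐ ξ, q ξ ≤ M
  integral_le : ∫ ξ, Real.sin (v ξ / 2) ^ 2 * q ξ ≤ M

lemma abs_sin_half_sq_le (v : ℝ) : Real.sin (v / 2) ^ 2 ≤ |v| := by
  have h1 := Real.abs_sin_le_one (v / 2)
  have h2 : |Real.sin (v / 2)| ≤ |v / 2| := Real.abs_sin_le_abs
  rw [abs_div, abs_two] at h2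
  rw [← sq_abs]
  nlinarith [abs_nonneg (Real.sin (v / 2)), abs_nonneg v]

lemma sin_half_sq_le (v : ℝ) : Real.sin (v / 2) ^ 2 ≤ v ^ 2 := by
  have h2 : |Real.sin (v / 2)| ≤ |v / 2| := Real.abs_sin_le_abs
  rw [abs_div, abs_two] at h2
  rw [← sq_abs, ← sq_abs v]
  nlinarith [abs_nonneg (Real.sin (v / 2)), abs_nonneg v]

lemma cos_half_sq (v : ℝ) : Real.cos (v / 2) ^ 2 = (1 + Real.cos v) / 2 := by
  rw [Real.cos_sq, mul_div_cancel₀ v two_ne_zero]; ring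

lemma sin_half_sq (v : ℝ) : Real.sin (v / 2) ^ 2 = (1 - Real.cos v) / 2 := by
  rw [Real.sin_sq, cos_half_sq]; ring

lemma abs_cos_sub_cos_le (x y : ℝ) : |Real.cos x - Real.cos y| ≤ |x - y| := by
  have h := (Real.lipschitzWith_cos).dist_le_mul x y
  simpa [Real.dist_eq] using h

lemma abs_sin_sub_sin_le (x y : ℝ) : |Real.sin x - Real.sin y| ≤ |x - y| := by
  have h := (Real.lipschitzWith_sin).dist_le_mul x y
  simpa [Real.dist_eq] using h

lemma bddPair_cos {δ v₁ v₂ : ℝ} (h : |v₁ - v₂| ≤ δ) :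
    BddPair δ 1 (Real.cos (v₁ / 2) ^ 2) (Real.cos (v₂ / 2) ^ 2) := by
  refine ⟨?_, ?_, ?_⟩
  · rw [abs_of_nonneg (sq_nonneg _)]; exact Real.cos_sq_le_one _
  · rw [abs_of_nonneg (sq_nonneg _)]; exact Real.cos_sq_le_one _
  · rw [cos_half_sq, cos_half_sq, show (1 + Real.cos v₁) / 2 - (1 + Real.cos v₂) / 2
      = (Real.cos v₁ - Real.cos v₂) / 2 by ring, abs_div, abs_two]
    have := abs_cos_sub_cos_le v₁ v₂
    linarith [abs_nonneg (v₁ - v₂)]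

lemma bddPair_sin {δ v₁ v₂ : ℝ} (h : |v₁ - v₂| ≤ δ) :
    BddPair δ 1 (Real.sin v₁) (Real.sin v₂) :=
  ⟨Real.abs_sin_le_one _, Real.abs_sin_le_one _, by
    rw [one_mul]; exact (abs_sin_sub_sin_le _ _).trans h⟩

lemma smallPair_sin {b D v₁ v₂ : ℝ} (hb : |v₂| ≤ b) (hD : |v₁ - v₂| ≤ D) :
    SmallPair b D 1 (Real.sin v₁) (Real.sin v₂) :=
  ⟨zero_le_one, by rw [one_mul]; exact Real.abs_sin_le_abs.trans hb, by
    rw [one_mul]; exact (abs_sin_sub_sin_le _ _).trans hD⟩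

lemma smallPair_sin_sq {b D v₁ v₂ : ℝ} (hb : |v₂| ≤ b) (hD : |v₁ - v₂| ≤ D) :
    SmallPair b D 1 (Real.sin (v₁ / 2) ^ 2) (Real.sin (v₂ / 2) ^ 2) := by
  refine ⟨zero_le_one, ?_, ?_⟩
  · rw [abs_of_nonneg (sq_nonneg _), one_mul]; exact (abs_sin_half_sq_le _).trans hb
  · rw [sin_half_sq, sin_half_sq, show (1 - Real.cos v₁) / 2 - (1 - Real.cos v₂) / 2
      = -((Real.cos v₁ - Real.cos v₂) / 2) by ring, abs_neg, abs_div, abs_two]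
    have := abs_cos_sub_cos_le v₁ v₂
    linarith [abs_nonneg (v₁ - v₂)]

/-- The density of the change of variables, `cos²(v/2) q`. -/
def jac (v q : ℝ → ℝ) (s : ℝ) : ℝ := Real.cos (v s / 2) ^ 2 * q s

/-- The kernel `exp(-|∫_ξ^η cos²(v/2) q|)`. -/
def kern (v q : ℝ → ℝ) (ξ η : ℝ) : ℝ := Real.exp (-|∫ s in ξ..η, jac v q s|)

lemma integrand_eq (lam : ℝ) (f g : ℝ → ℝ) (t : ℝ) (k v q : ℝ → ℝ) (ξ η : ℝ) :
    integrand lam f g t k v q ξ η = kern v q ξ η * density lam f g t k v q η := rfl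

namespace Adm

variable {M m : ℝ} {k v q k₁ v₁ q₁ k₂ v₂ q₂ : ℝ → ℝ}

lemma abs_q_le (h : Adm M m k v q) (hm : 0 < m) : ∀ᵐ ξ, |q ξ| ≤ M := by
  filter_upwards [h.le_q, h.q_le] with ξ h1 h2
  rw [abs_of_pos (by linarith)]; exact h2

lemma memLp_k_top (h : Adm M m k v q) : MemLp k ∞ volume :=
  memLp_top_of_bound h.measurable_k.aestronglyMeasurable M h.abs_k_le

lemma nonneg (h : Adm M m k v q) : 0 ≤ M := by
  obtain ⟨ξ, hξ⟩ := h.abs_k_le.exists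
  exact (abs_nonneg _).trans hξ

lemma measurable_jac (h : Adm M m k v q) : Measurable (jac v q) := by
  have := h.measurable_v; have := h.measurable_q
  unfold jac; fun_prop

lemma abs_jac_le (h : Adm M m k v q) (hm : 0 < m) : ∀ᵐ ξ, |jac v q ξ| ≤ M := by
  filter_upwards [h.abs_q_le hm] with ξ hξ
  rw [jac, abs_mul, abs_of_nonneg (sq_nonneg _)]
  nlinarith [Real.cos_sq_le_one (v ξ / 2), abs_nonneg (q ξ), sq_nonneg (Real.cos (v ξ / 2))]

lemma jac_nonneg (h : Adm M m k v q) (hm : 0 < m) : ∀ᵐ ξ, 0 ≤ jac v q ξ := by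
  filter_upwards [h.le_q] with ξ hξ
  exact mul_nonneg (sq_nonneg _) (hm.le.trans hξ)

lemma locallyIntegrable_jac (h : Adm M m k v q) (hm : 0 < m) :
    LocallyIntegrable (jac v q) volume :=
  (memLp_top_of_bound h.measurable_jac.aestronglyMeasurable M
    (h.abs_jac_le hm)).locallyIntegrable le_top

lemma intervalIntegrable_jac (h : Adm M m k v q) (hm : 0 < m) (a b : ℝ) :
    IntervalIntegrable (jac v q) volume a b :=
  (IsPrim.of_integral (h.locallyIntegrable_jac hm) 0 0).intervalIntegrable a b

lemma integrable_sin_sq (h : Adm M m k v q) (hm : 0 < m) :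
    Integrable fun ξ => Real.sin (v ξ / 2) ^ 2 * q ξ := by
  have hv := h.measurable_v; have hq := h.measurable_q
  refine (h.memLp_v.integrable_sq.mul_const M).mono' (by fun_prop) ?_
  filter_upwards [h.abs_q_le hm] with ξ hξ
  rw [norm_mul, Real.norm_of_nonneg (sq_nonneg _), Real.norm_eq_abs]
  exact mul_le_mul (sin_half_sq_le _) hξ (abs_nonneg _) (sq_nonneg _)

/-- The lower bound `∫_ξ^η cos²(v/2) q ≥ m (η - ξ) - M`, because `cos² q ≥ m - sin² q`. -/
lemma sub_le_integral_jac (h : Adm M m k v q) (hm : 0 < m) {ξ η : ℝ} (hξη : ξ ≤ η) :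
    m * (η - ξ) - M ≤ ∫ s in ξ..η, jac v q s := by
  have hs := h.integrable_sin_sq hm
  have h1 : ∫ s in ξ..η, (m - Real.sin (v s / 2) ^ 2 * q s) ≤ ∫ s in ξ..η, jac v q s := by
    refine intervalIntegral.integral_mono_ae hξη (intervalIntegrable_const.sub
      hs.intervalIntegrable) (h.intervalIntegrable_jac hm ξ η) ?_
    filter_upwards [h.le_q] with s hs
    have := Real.sin_sq_add_cos_sq (v s / 2)
    have h2 : Real.cos (v s / 2) ^ 2 = 1 - Real.sin (v s / 2) ^ 2 := by linarith
    simp only [jac]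
    rw [h2, one_sub_mul]; linarith
  rw [intervalIntegral.integral_sub intervalIntegrable_const hs.intervalIntegrable,
    intervalIntegral.integral_const, smul_eq_mul] at h1
  have h2 : ∫ s in ξ..η, Real.sin (v s / 2) ^ 2 * q s ≤ M := by
    rw [intervalIntegral.integral_of_le hξη]
    refine (setIntegral_le_integral hs ?_).trans h.integral_le
    filter_upwards [h.le_q] with s hs
    exact mul_nonneg (sq_nonneg _) (hm.le.trans hs)
  linarith

lemma sub_le_abs_integral_jac (h : Adm M m k v q) (hm : 0 < m) (ξ η : ℝ) :
    m * |ξ - η| - M ≤ |∫ s in ξ..η, jac v q s| := by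
  rcases le_total ξ η with h1 | h1
  · rw [abs_sub_comm, abs_of_nonneg (sub_nonneg.2 h1)]
    exact (h.sub_le_integral_jac hm h1).trans (le_abs_self _)
  · rw [abs_of_nonneg (sub_nonneg.2 h1), intervalIntegral.integral_symm, abs_neg]
    exact (h.sub_le_integral_jac hm h1).trans (le_abs_self _)

/-- The kernel decays exponentially. -/
lemma kern_le (h : Adm M m k v q) (hm : 0 < m) (ξ η : ℝ) :
    kern v q ξ η ≤ Real.exp M * Real.exp (-(m * |ξ - η|)) := by
  rw [kern, ← Real.exp_add]
  refine Real.exp_le_exp.2 ?_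
  linarith [h.sub_le_abs_integral_jac hm ξ η]

lemma kern_pos (v q : ℝ → ℝ) (ξ η : ℝ) : 0 < kern v q ξ η := Real.exp_pos _

lemma expKernel_mono (hm : 0 < m) (x : ℝ) :
    Real.exp (-(m * |x|)) ≤ Real.exp (-(m / 2 * |x|)) :=
  Real.exp_le_exp.2 (by nlinarith [abs_nonneg x])

/-- The kernels of two triples close to each other differ by little. -/
lemma abs_kern_sub_le (h₁ : Adm M m k₁ v₁ q₁) (h₂ : Adm M m k₂ v₂ q₂) (hm : 0 < m) {δ : ℝ}
    (hδ : 0 ≤ δ) (hv : ∀ᵐ ξ, |v₁ ξ - v₂ ξ| ≤ δ) (hq : ∀ᵐ ξ, |q₁ ξ - q₂ ξ| ≤ δ) (ξ η : ℝ) :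
    |kern v₁ q₁ ξ η - kern v₂ q₂ ξ η|
      ≤ Real.exp M * (M + 1) * (2 / m) * δ * Real.exp (-(m / 2 * |ξ - η|)) := by
  have hM := h₁.nonneg
  have e1 := h₁.sub_le_abs_integral_jac hm ξ η
  have e2 := h₂.sub_le_abs_integral_jac hm ξ η
  have hd : |(∫ s in ξ..η, jac v₁ q₁ s) - ∫ s in ξ..η, jac v₂ q₂ s| ≤ (M + 1) * δ * |ξ - η| := by
    rw [← intervalIntegral.integral_sub (h₁.intervalIntegrable_jac hm ξ η)
      (h₂.intervalIntegrable_jac hm ξ η), ← Real.norm_eq_abs, abs_sub_comm]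
    refine intervalIntegral.norm_integral_le_of_norm_le_const_ae ?_
    filter_upwards [hv, hq, h₁.abs_q_le hm] with s a1 a2 a3 _
    obtain ⟨c1, c2, c3⟩ := bddPair_cos a1
    rw [jac, jac, Real.norm_eq_abs, show Real.cos (v₁ s / 2) ^ 2 * q₁ s
      - Real.cos (v₂ s / 2) ^ 2 * q₂ s = (Real.cos (v₁ s / 2) ^ 2 - Real.cos (v₂ s / 2) ^ 2) * q₁ s
        + Real.cos (v₂ s / 2) ^ 2 * (q₁ s - q₂ s) by ring]
    refine (abs_add_le _ _).trans ?_
    rw [abs_mul, abs_mul]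
    calc _ ≤ 1 * δ * M + 1 * δ := by gcongr
      _ = _ := by ring
  rw [kern, kern]
  refine (abs_exp_sub_exp_le (R := M - m * |ξ - η|) (by linarith) (by linarith)).trans ?_
  have hd' : |(-|∫ s in ξ..η, jac v₁ q₁ s|) - (-|∫ s in ξ..η, jac v₂ q₂ s|)|
      ≤ (M + 1) * δ * |ξ - η| := by
    rw [neg_sub_neg, abs_sub_comm]
    exact (abs_abs_sub_abs_le_abs_sub _ _).trans hd
  -- Half of the exponential decay absorbs the factor `|ξ - η|`.
  have hx : |ξ - η| ≤ 2 / m * Real.exp (m / 2 * |ξ - η|) := by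
    have := Real.add_one_le_exp (m / 2 * |ξ - η|)
    have h3 : |ξ - η| = 2 / m * (m / 2 * |ξ - η|) := by field_simp
    calc |ξ - η| = 2 / m * (m / 2 * |ξ - η|) := h3
      _ ≤ _ := by gcongr; linarith
  have hexp : Real.exp (M - m * |ξ - η|) * Real.exp (m / 2 * |ξ - η|)
      = Real.exp M * Real.exp (-(m / 2 * |ξ - η|)) := by
    rw [← Real.exp_add, ← Real.exp_add]; congr 1; ring
  calc _ ≤ Real.exp (M - m * |ξ - η|) * ((M + 1) * δ * |ξ - η|) := by
        gcongr
    _ ≤ Real.exp (M - m * |ξ - η|) * ((M + 1) * δ * (2 / m * Real.exp (m / 2 * |ξ - η|))) := by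
        gcongr
    _ = (M + 1) * δ * (2 / m) * (Real.exp (M - m * |ξ - η|) * Real.exp (m / 2 * |ξ - η|)) := by ring
    _ = _ := by rw [hexp]; ring

end Adm

/-! ### Bounds for the right-hand side -/

/-- The size `|k| + |v|`. -/
def size (k v : ℝ → ℝ) (ξ : ℝ) : ℝ := |k ξ| + |v ξ|

/-- The distance `|k₁ - k₂| + |v₁ - v₂| + δ (|k₂| + |v₂|)`. -/
def gap (δ : ℝ) (k₁ v₁ k₂ v₂ : ℝ → ℝ) (ξ : ℝ) : ℝ :=
  |k₁ ξ - k₂ ξ| + |v₁ ξ - v₂ ξ| + δ * size k₂ v₂ ξ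

/-- `b + e^{-a|·|} * b`. -/
def withConv (a : ℝ) (b : ℝ → ℝ) (ξ : ℝ) : ℝ := b ξ + expConv a b ξ

/-- Two triples and two times at distance at most `δ`. -/
structure Close (δ t₁ t₂ : ℝ) (k₁ v₁ q₁ k₂ v₂ q₂ : ℝ → ℝ) : Prop where
  time : |t₁ - t₂| ≤ δ
  k : ∀ᵐ ξ, |k₁ ξ - k₂ ξ| ≤ δ
  v : ∀ᵐ ξ, |v₁ ξ - v₂ ξ| ≤ δ
  q : ∀ᵐ ξ, |q₁ ξ - q₂ ξ| ≤ δ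

/-- The weak derivative of `-P̃_x`. -/
def rhsDx (lam : ℝ) (f g : ℝ → ℝ) (t : ℝ) (k v q : ℝ → ℝ) (ξ : ℝ) : ℝ :=
  density lam f g t k v q ξ - jac v q ξ * Pt lam f g t k v q ξ

lemma size_nonneg (k v : ℝ → ℝ) (ξ : ℝ) : 0 ≤ size k v ξ := by unfold size; positivity

lemma gap_nonneg {δ : ℝ} (hδ : 0 ≤ δ) (k₁ v₁ k₂ v₂ : ℝ → ℝ) (ξ : ℝ) :
    0 ≤ gap δ k₁ v₁ k₂ v₂ ξ := by
  have := size_nonneg k₂ v₂ ξ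
  unfold gap; positivity

namespace Adm

variable {M m : ℝ} {k v q k₁ v₁ q₁ k₂ v₂ q₂ : ℝ → ℝ}

lemma measurable_size (h : Adm M m k v q) : Measurable (size k v) := by
  have := h.measurable_v; have := h.measurable_k
  unfold size; fun_prop

lemma memLp_size (h : Adm M m k v q) : MemLp (size k v) 2 volume := h.memLp_k.abs.add h.memLp_v.abs

lemma memLp_size_top (h : Adm M m k v q) : MemLp (size k v) ∞ volume :=
  h.memLp_k_top.abs.add h.memLp_v_top.abs

lemma measurable_gap (h₁ : Adm M m k₁ v₁ q₁) (h₂ : Adm M m k₂ v₂ q₂) (δ : ℝ) :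
    Measurable (gap δ k₁ v₁ k₂ v₂) := by
  have := h₁.measurable_v; have := h₁.measurable_k
  have := h₂.measurable_v; have := h₂.measurable_k; have := h₂.measurable_size
  unfold gap; fun_prop

lemma memLp_gap (h₁ : Adm M m k₁ v₁ q₁) (h₂ : Adm M m k₂ v₂ q₂) (δ : ℝ) :
    MemLp (gap δ k₁ v₁ k₂ v₂) 2 volume :=
  ((h₁.memLp_k.sub h₂.memLp_k).abs.add (h₁.memLp_v.sub h₂.memLp_v).abs).add
    (h₂.memLp_size.const_mul δ)

lemma memLp_gap_top (h₁ : Adm M m k₁ v₁ q₁) (h₂ : Adm M m k₂ v₂ q₂) (δ : ℝ) :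
    MemLp (gap δ k₁ v₁ k₂ v₂) ∞ volume :=
  ((h₁.memLp_k_top.sub h₂.memLp_k_top).abs.add (h₁.memLp_v_top.sub h₂.memLp_v_top).abs).add
    (h₂.memLp_size_top.const_mul δ)

end Adm

variable {lam : ℝ} {f g : ℝ → ℝ}

/-- Pointwise bounds of the local coefficients. -/
lemma exists_coef_pairs (hlam : 0 < lam) (hf : ContDiff ℝ ∞ f) (hg : ContDiff ℝ ∞ g)
    (hg0 : g 0 = 0) (T M : ℝ) : ∃ C : ℝ, 0 ≤ C ∧ ∀ t₁ ∈ Icc 0 T, ∀ t₂ ∈ Icc 0 T,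
      ∀ δ b D x₁ x₂ : ℝ, |x₁| ≤ M → |x₂| ≤ M → |t₁ - t₂| ≤ δ → |x₁ - x₂| ≤ δ → |x₂| ≤ b →
        |x₁ - x₂| + δ * |x₂| ≤ D →
        SmallPair b D C (coefG lam g t₁ x₁) (coefG lam g t₂ x₂) ∧
        BddPair δ C (coefF lam f t₁ x₁) (coefF lam f t₂ x₂) := by
  obtain ⟨C1, hC1, H1⟩ := exists_coefG_bound hlam hg hg0 T M
  obtain ⟨C2, hC2, H2⟩ := exists_coefF_bound hlam hf T M
  refine ⟨C1 + 2 * C2, by positivity, ?_⟩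
  intro t₁ h1 t₂ h2 δ b D x₁ x₂ hx₁ hx₂ ht hxx hb hD
  obtain ⟨g1, g2⟩ := H1 t₁ h1 t₂ h2 x₁ x₂ hx₁ hx₂
  obtain ⟨f1, f2⟩ := H2 t₁ h1 t₂ h2 x₁ x₂ hx₁ hx₂
  obtain ⟨f3, -⟩ := H2 t₂ h2 t₁ h1 x₂ x₁ hx₂ hx₁
  have hδ : 0 ≤ δ := (abs_nonneg _).trans ht
  have hD' : |x₁ - x₂| + |t₁ - t₂| * |x₂| ≤ D := le_trans (by gcongr) hD
  have hD0 : 0 ≤ D := le_trans (by positivity) hD'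
  have hb0 : 0 ≤ b := (abs_nonneg _).trans hb
  refine ⟨⟨by positivity, g1.trans ?_, g2.trans ?_⟩, ⟨by linarith, by linarith, f2.trans ?_⟩⟩
  · exact mul_le_mul (by linarith) hb (abs_nonneg _) (by positivity)
  · exact mul_le_mul (by linarith) hD' (by positivity) (by positivity)
  · calc C2 * (|x₁ - x₂| + |t₁ - t₂|) ≤ C2 * (δ + δ) := by gcongr
      _ = 2 * C2 * δ := by ring
      _ ≤ (C1 + 2 * C2) * δ := by gcongr; linarith

/-! ### Lipschitz estimates for the right-hand side -/

lemma measurable_density (hf : ContDiff ℝ ∞ f) (hg : ContDiff ℝ ∞ g) (t : ℝ) {k v q : ℝ → ℝ}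
    (hk : Measurable k) (hv : Measurable v) (hq : Measurable q) :
    Measurable (density lam f g t k v q) := by
  have h1 := (continuous_coefG lam hg t).measurable.comp hk
  have h2 := (continuous_coefF lam hf t).measurable.comp hk
  have : density lam f g t k v q = fun ξ => ((coefG lam g t ∘ k) ξ * Real.cos (v ξ / 2) ^ 2
      + 1 / 2 * ((coefF lam f t ∘ k) ξ * Real.sin (v ξ / 2) ^ 2)) * q ξ :=
    funext fun ξ => density_eq lam f g t k v q ξ
  rw [this]; fun_prop

lemma measurable_kern {v q : ℝ → ℝ} (hl : LocallyIntegrable (jac v q) volume) (ξ : ℝ) :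
    Measurable (kern v q ξ) := by
  have h := (IsPrim.of_integral hl 0 ξ).continuous
  have : kern v q ξ = fun η => Real.exp (-|0 + ∫ s in ξ..η, jac v q s|) := by
    ext η; simp [kern]
  rw [this]
  exact (Real.continuous_exp.comp h.abs.neg).measurable

section Pairs

variable {T M m : ℝ}

/-- Pointwise bounds of the density. -/
lemma exists_density_pair (hlam : 0 < lam) (hf : ContDiff ℝ ∞ f) (hg : ContDiff ℝ ∞ g)
    (hg0 : g 0 = 0) (T M : ℝ) {m : ℝ} (hm : 0 < m) : ∃ C : ℝ, 0 ≤ C ∧ ∀ t₁ ∈ Icc 0 T, ∀ t₂ ∈ Icc 0 T,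
      ∀ (δ : ℝ) (k₁ v₁ q₁ k₂ v₂ q₂ : ℝ → ℝ), Adm M m k₁ v₁ q₁ → Adm M m k₂ v₂ q₂ →
      Close δ t₁ t₂ k₁ v₁ q₁ k₂ v₂ q₂ → ∀ᵐ ξ,
        SmallPair (size k₂ v₂ ξ) (gap δ k₁ v₁ k₂ v₂ ξ) C (coefG lam g t₁ (k₁ ξ))
          (coefG lam g t₂ (k₂ ξ)) ∧
        BddPair δ C (coefF lam f t₁ (k₁ ξ)) (coefF lam f t₂ (k₂ ξ)) ∧
        BddPair δ (M + 1) (q₁ ξ) (q₂ ξ) ∧ BddPair δ C (jac v₁ q₁ ξ) (jac v₂ q₂ ξ) ∧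
        |v₂ ξ| ≤ size k₂ v₂ ξ ∧ |v₁ ξ - v₂ ξ| ≤ gap δ k₁ v₁ k₂ v₂ ξ ∧ |v₁ ξ - v₂ ξ| ≤ δ ∧
        SmallPair (size k₂ v₂ ξ) (gap δ k₁ v₁ k₂ v₂ ξ) C (density lam f g t₁ k₁ v₁ q₁ ξ)
          (density lam f g t₂ k₂ v₂ q₂ ξ) := by
  obtain ⟨C1, hC1, H1⟩ := exists_coef_pairs hlam hf hg hg0 T M
  refine ⟨max (max C1 (2 * (1 * (M + 1)))) (2 * ((M + 1) * (2 * (1 * C1) + |1 / 2| * (2 * (C1 * 1))))),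
    hC1.trans ((le_max_left _ _).trans (le_max_left _ _)), ?_⟩
  set C := max (max C1 (2 * (1 * (M + 1))))
    (2 * ((M + 1) * (2 * (1 * C1) + |1 / 2| * (2 * (C1 * 1))))) with hC
  have hC1C : C1 ≤ C := (le_max_left _ _).trans (le_max_left _ _)
  have hMC : 2 * (1 * (M + 1)) ≤ C := (le_max_right _ _).trans (le_max_left _ _)
  have hdC : (2 * ((M + 1) * (2 * (1 * C1) + |1 / 2| * (2 * (C1 * 1))))) ≤ C := le_max_right _ _
  intro t₁ h1 t₂ h2 δ k₁ v₁ q₁ k₂ v₂ q₂ A1 A2 hc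
  have hδ : 0 ≤ δ := (abs_nonneg _).trans hc.time
  have hM := A1.nonneg
  filter_upwards [A1.abs_k_le, A2.abs_k_le, hc.k, hc.v, hc.q, A1.abs_q_le hm, A2.abs_q_le hm]
    with ξ a1 a2 a3 a4 a5 a6 a7
  have hsz : |k₂ ξ| ≤ size k₂ v₂ ξ := le_add_of_nonneg_right (abs_nonneg _)
  have hvz : |v₂ ξ| ≤ size k₂ v₂ ξ := le_add_of_nonneg_left (abs_nonneg _)
  have hδs : 0 ≤ δ * size k₂ v₂ ξ := mul_nonneg hδ (size_nonneg _ _ _)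
  have hgk : |k₁ ξ - k₂ ξ| + δ * |k₂ ξ| ≤ gap δ k₁ v₁ k₂ v₂ ξ := by
    have : δ * |k₂ ξ| ≤ δ * size k₂ v₂ ξ := by gcongr
    have := abs_nonneg (v₁ ξ - v₂ ξ)
    unfold gap; linarith
  have hgv : |v₁ ξ - v₂ ξ| ≤ gap δ k₁ v₁ k₂ v₂ ξ := by
    have := abs_nonneg (k₁ ξ - k₂ ξ)
    unfold gap; linarith
  have hsD : δ * size k₂ v₂ ξ ≤ gap δ k₁ v₁ k₂ v₂ ξ := by
    unfold gap; linarith [abs_nonneg (k₁ ξ - k₂ ξ), abs_nonneg (v₁ ξ - v₂ ξ)]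
  obtain ⟨pG, pF⟩ := H1 t₁ h1 t₂ h2 δ (size k₂ v₂ ξ) (gap δ k₁ v₁ k₂ v₂ ξ) _ _ a1 a2 hc.time a3
    hsz hgk
  have hs0 := size_nonneg k₂ v₂ ξ
  have hg0 := gap_nonneg hδ k₁ v₁ k₂ v₂ ξ
  have pq : BddPair δ (M + 1) (q₁ ξ) (q₂ ξ) := ⟨by linarith, by linarith, a5.trans (by nlinarith)⟩
  have pc := bddPair_cos a4
  have ps := smallPair_sin_sq hvz hgv
  have pj := pc.mul hδ pq
  have pd := pq.mul_small hδ hsD ((pc.mul_small hδ hsD pG).add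
    ((pF.mul_small hδ hsD ps).const_mul (1 / 2)))
  refine ⟨pG.mono hs0 le_rfl hg0 le_rfl hC1C, ⟨pF.1.trans hC1C, pF.2.1.trans hC1C,
    pF.2.2.trans (by gcongr)⟩, pq, ⟨pj.1.trans hMC, pj.2.1.trans hMC, pj.2.2.trans (by gcongr)⟩,
    hvz, hgv, a4, ?_⟩
  have e : ∀ t k v q, density lam f g t k v q ξ = q ξ * (Real.cos (v ξ / 2) ^ 2 * coefG lam g t (k ξ)
      + 1 / 2 * (coefF lam f t (k ξ) * Real.sin (v ξ / 2) ^ 2)) := fun t k v q => by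
    rw [density_eq]; ring
  rw [e, e]
  exact pd.mono hs0 le_rfl hg0 le_rfl hdC

/-- The density is square integrable and bounded. -/
lemma Adm.density_bound (hlam : 0 < lam) (hf : ContDiff ℝ ∞ f) (hg : ContDiff ℝ ∞ g)
    (hg0 : g 0 = 0) (hm : 0 < m) {t : ℝ} (ht : 0 ≤ t) {k v q : ℝ → ℝ} (h : Adm M m k v q) :
    MemLp (density lam f g t k v q) 2 volume ∧ MemLp (density lam f g t k v q) ∞ volume := by
  obtain ⟨C, hC, H⟩ := exists_density_pair hlam hf hg hg0 t M hm
  have h1 := H t ⟨ht, le_rfl⟩ t ⟨ht, le_rfl⟩ 0 k v q k v q h h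
    ⟨by simp, by simp, by simp, by simp⟩
  have hm' := (measurable_density (lam := lam) hf hg t h.measurable_k h.measurable_v
    h.measurable_q).aestronglyMeasurable (μ := volume)
  have hb : ∀ᵐ ξ, ‖density lam f g t k v q ξ‖ ≤ C * ‖size k v ξ‖ := by
    filter_upwards [h1] with ξ hξ
    obtain ⟨-, -, -, -, -, -, -, p⟩ := hξ
    rw [Real.norm_eq_abs, Real.norm_of_nonneg (size_nonneg _ _ _)]
    exact p.2.1
  exact ⟨h.memLp_size.of_le_mul hm' hb, h.memLp_size_top.of_le_mul hm' hb⟩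

lemma Adm.integrable_integrand (hlam : 0 < lam) (hf : ContDiff ℝ ∞ f) (hg : ContDiff ℝ ∞ g)
    (hg0 : g 0 = 0) (hm : 0 < m) {t : ℝ} (ht : 0 ≤ t) {k v q : ℝ → ℝ} (h : Adm M m k v q)
    (ξ : ℝ) : Integrable (integrand lam f g t k v q ξ) := by
  have hd := (h.density_bound hlam hf hg hg0 hm ht).2
  have hK : Integrable (kern v q ξ) := by
    refine ((integrable_expKernel_sub hm ξ).const_mul (Real.exp M)).mono'
      (measurable_kern (h.locallyIntegrable_jac hm) ξ).aestronglyMeasurable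
      (ae_of_all _ fun η => ?_)
    rw [Real.norm_of_nonneg (Adm.kern_pos _ _ _ _).le]
    exact h.kern_le hm ξ η
  exact hK.mul_of_top_left hd

/-- The partial integrals of the integrand, and their differences, are controlled by the
convolution of `size` and `gap` with an exponential kernel. -/
lemma exists_setIntegral_pair (hlam : 0 < lam) (hf : ContDiff ℝ ∞ f) (hg : ContDiff ℝ ∞ g)
    (hg0 : g 0 = 0) (T M : ℝ) {m : ℝ} (hm : 0 < m) : ∃ C : ℝ, 0 ≤ C ∧ ∀ t₁ ∈ Icc 0 T, ∀ t₂ ∈ Icc 0 T,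
      ∀ (δ : ℝ) (k₁ v₁ q₁ k₂ v₂ q₂ : ℝ → ℝ), Adm M m k₁ v₁ q₁ → Adm M m k₂ v₂ q₂ →
      Close δ t₁ t₂ k₁ v₁ q₁ k₂ v₂ q₂ → ∀ (S : Set ℝ) (ξ : ℝ),
        SmallPair (expConv (m / 2) (size k₂ v₂) ξ) (expConv (m / 2) (gap δ k₁ v₁ k₂ v₂) ξ) C
          (∫ η in S, integrand lam f g t₁ k₁ v₁ q₁ ξ η)
          (∫ η in S, integrand lam f g t₂ k₂ v₂ q₂ ξ η) := by
  obtain ⟨C, hC, H⟩ := exists_density_pair hlam hf hg hg0 T M hm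
  set C' := Real.exp M * (|M| + 1) * (2 / m) + Real.exp M with hC'
  have hCp : 0 < C' := by positivity
  refine ⟨2 * (C' * C), by positivity, ?_⟩
  intro t₁ h1 t₂ h2 δ k₁ v₁ q₁ k₂ v₂ q₂ A1 A2 hc S ξ
  have hδ : 0 ≤ δ := (abs_nonneg _).trans hc.time
  have hM := A1.nonneg
  have hm2 : 0 < m / 2 := by positivity
  have key : ∀ᵐ η, SmallPair (Real.exp (-(m / 2 * |ξ - η|)) * |size k₂ v₂ η|)
      (Real.exp (-(m / 2 * |ξ - η|)) * |gap δ k₁ v₁ k₂ v₂ η|) (2 * (C' * C))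
      (integrand lam f g t₁ k₁ v₁ q₁ ξ η) (integrand lam f g t₂ k₂ v₂ q₂ ξ η) := by
    filter_upwards [H t₁ h1 t₂ h2 δ k₁ v₁ q₁ k₂ v₂ q₂ A1 A2 hc] with η hη
    obtain ⟨-, -, -, -, -, -, -, p⟩ := hη
    set E := Real.exp (-(m / 2 * |ξ - η|)) with hE
    have hE0 : 0 < E := Real.exp_pos _
    -- Divided by `E`, the two kernels are bounded and at distance `O(δ)`.
    have kb : ∀ {k v q : ℝ → ℝ}, Adm M m k v q → |E⁻¹ * kern v q ξ η| ≤ C' := by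
      intro k v q A
      rw [abs_of_pos (mul_pos (inv_pos.2 hE0) (Adm.kern_pos _ _ _ _)), inv_mul_le_iff₀ hE0]
      calc kern v q ξ η ≤ Real.exp M * Real.exp (-(m * |ξ - η|)) := A.kern_le hm ξ η
        _ ≤ Real.exp M * E := by gcongr; exact Adm.expKernel_mono hm _
        _ = E * Real.exp M := mul_comm _ _
        _ ≤ E * C' := by
          gcongr
          rw [hC']
          have : 0 ≤ Real.exp M * (|M| + 1) * (2 / m) := by positivity
          linarith
    have pk : BddPair δ C' (E⁻¹ * kern v₁ q₁ ξ η) (E⁻¹ * kern v₂ q₂ ξ η) := by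
      refine ⟨kb A1, kb A2, ?_⟩
      rw [← mul_sub, abs_mul, abs_of_pos (inv_pos.2 hE0), inv_mul_le_iff₀ hE0]
      calc _ ≤ _ := A1.abs_kern_sub_le A2 hm hδ hc.v hc.q ξ η
        _ = E * ((Real.exp M * (|M| + 1) * (2 / m)) * δ) := by rw [abs_of_nonneg hM]; ring
        _ ≤ E * (C' * δ) := by
          gcongr
          rw [hC']
          linarith [Real.exp_pos M]
    have hsD : δ * size k₂ v₂ η ≤ gap δ k₁ v₁ k₂ v₂ η := by
      unfold gap; linarith [abs_nonneg (k₁ η - k₂ η), abs_nonneg (v₁ η - v₂ η)]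
    have := pk.mul_small hδ hsD p
    rw [abs_of_nonneg (size_nonneg _ _ _), abs_of_nonneg (gap_nonneg hδ _ _ _ _ _)]
    obtain ⟨b1, b2, b3⟩ := this
    have eI : ∀ t k v q, integrand lam f g t k v q ξ η
        = E * (E⁻¹ * kern v q ξ η * density lam f g t k v q η) := fun t k v q => by
      rw [integrand_eq]; field_simp
    refine ⟨b1, ?_, ?_⟩
    · rw [eI, abs_mul, abs_of_pos hE0]
      calc _ ≤ E * (2 * (C' * C) * size k₂ v₂ η) := by gcongr
        _ = _ := by ring
    · rw [eI, eI, ← mul_sub, abs_mul, abs_of_pos hE0]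
      calc _ ≤ E * (2 * (C' * C) * gap δ k₁ v₁ k₂ v₂ η) := by gcongr
        _ = _ := by ring
  have i1 := A1.integrable_integrand hlam hf hg hg0 hm h1.1 ξ
  have i2 := A2.integrable_integrand hlam hf hg hg0 hm h2.1 ξ
  have es : (fun x => |size k₂ v₂ x|) = size k₂ v₂ :=
    funext fun x => abs_of_nonneg (size_nonneg _ _ _)
  have eg : (fun x => |gap δ k₁ v₁ k₂ v₂ x|) = gap δ k₁ v₁ k₂ v₂ :=
    funext fun x => abs_of_nonneg (gap_nonneg hδ _ _ _ _ _)
  refine ⟨by positivity, ?_, ?_⟩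
  · have := expConv_mono_of_ae hm2 A2.memLp_size_top ξ S (key.mono fun η h => h.2.1)
    rwa [es] at this
  · rw [← integral_sub i1.integrableOn i2.integrableOn]
    have := expConv_mono_of_ae hm2 (A1.memLp_gap_top A2 δ) ξ S (key.mono fun η h => h.2.2)
    rwa [eg] at this

/-- All components of the right-hand side, and their differences, are controlled pointwise by
functions of `L² ∩ L^∞`. -/
lemma exists_rhs_pair (hlam : 0 < lam) (hf : ContDiff ℝ ∞ f) (hg : ContDiff ℝ ∞ g)
    (hg0 : g 0 = 0) (T M : ℝ) {m : ℝ} (hm : 0 < m) : ∃ C : ℝ, 0 ≤ C ∧ ∀ t₁ ∈ Icc 0 T, ∀ t₂ ∈ Icc 0 T,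
      ∀ (δ : ℝ) (k₁ v₁ q₁ k₂ v₂ q₂ : ℝ → ℝ), Adm M m k₁ v₁ q₁ → Adm M m k₂ v₂ q₂ →
      Close δ t₁ t₂ k₁ v₁ q₁ k₂ v₂ q₂ → ∀ᵐ ξ,
        SmallPair (withConv (m / 2) (size k₂ v₂) ξ) (withConv (m / 2) (gap δ k₁ v₁ k₂ v₂) ξ) C
          (Pt lam f g t₁ k₁ v₁ q₁ ξ) (Pt lam f g t₂ k₂ v₂ q₂ ξ) ∧
        SmallPair (withConv (m / 2) (size k₂ v₂) ξ) (withConv (m / 2) (gap δ k₁ v₁ k₂ v₂) ξ) C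
          (rhsK lam f g t₁ k₁ v₁ q₁ ξ) (rhsK lam f g t₂ k₂ v₂ q₂ ξ) ∧
        SmallPair (withConv (m / 2) (size k₂ v₂) ξ) (withConv (m / 2) (gap δ k₁ v₁ k₂ v₂) ξ) C
          (rhsDx lam f g t₁ k₁ v₁ q₁ ξ) (rhsDx lam f g t₂ k₂ v₂ q₂ ξ) ∧
        SmallPair (withConv (m / 2) (size k₂ v₂) ξ) (withConv (m / 2) (gap δ k₁ v₁ k₂ v₂) ξ) C
          (rhsV lam f g t₁ k₁ v₁ q₁ ξ) (rhsV lam f g t₂ k₂ v₂ q₂ ξ) ∧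
        SmallPair (withConv (m / 2) (size k₂ v₂) ξ) (withConv (m / 2) (gap δ k₁ v₁ k₂ v₂) ξ) C
          (rhsQ lam f g t₁ k₁ v₁ q₁ ξ) (rhsQ lam f g t₂ k₂ v₂ q₂ ξ) := by
  obtain ⟨C1, hC1, H1⟩ := exists_density_pair hlam hf hg hg0 T M hm
  obtain ⟨C2, hC2, H2⟩ := exists_setIntegral_pair hlam hf hg hg0 T M hm
  -- the constants produced by the product and sum rules
  set cP := |1 / 2| * C2 with hcP
  set cK := |1 / 2| * (C2 + C2) with hcK
  set cD := C1 + 2 * (C1 * cP) with hcD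
  set cV := |2| * (2 * (1 * (C1 + cP))) + 2 * (C1 * 1) with hcV
  set cQ := 2 * ((M + 1) * (|1 / 2| * (2 * (C1 * 1)) + 2 * (1 * (C1 + cP)))) with hcQ
  set C := max (max cP cK) (max cD (max cV cQ)) with hC
  have lP : cP ≤ C := (le_max_left _ _).trans (le_max_left _ _)
  have lK : cK ≤ C := (le_max_right _ _).trans (le_max_left _ _)
  have lD : cD ≤ C := (le_max_left _ _).trans (le_max_right _ _)
  have lV : cV ≤ C := (le_max_left _ _).trans ((le_max_right _ _).trans (le_max_right _ _))
  have lQ : cQ ≤ C := (le_max_right _ _).trans ((le_max_right _ _).trans (le_max_right _ _))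
  refine ⟨C, le_trans (by positivity) lP, ?_⟩
  intro t₁ h1 t₂ h2 δ k₁ v₁ q₁ k₂ v₂ q₂ A1 A2 hc
  have hδ : 0 ≤ δ := (abs_nonneg _).trans hc.time
  have hm2 : 0 < m / 2 := by positivity
  filter_upwards [H1 t₁ h1 t₂ h2 δ k₁ v₁ q₁ k₂ v₂ q₂ A1 A2 hc] with ξ hξ
  obtain ⟨pG, pF, pq, pj, hvz, hgv, hvd, pd⟩ := hξ
  have I := H2 t₁ h1 t₂ h2 δ k₁ v₁ q₁ k₂ v₂ q₂ A1 A2 hc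
  set b := size k₂ v₂ ξ
  set D := gap δ k₁ v₁ k₂ v₂ ξ with hD
  set b' := withConv (m / 2) (size k₂ v₂) ξ with hb'
  set D' := withConv (m / 2) (gap δ k₁ v₁ k₂ v₂) ξ with hD'
  have b0 : 0 ≤ b := size_nonneg _ _ _
  have D0 : 0 ≤ D := gap_nonneg hδ _ _ _ _ _
  have cb0 := expConv_nonneg (m / 2) (size_nonneg k₂ v₂) ξ
  have cD0 := expConv_nonneg (m / 2) (gap_nonneg hδ k₁ v₁ k₂ v₂) ξ
  have bb : b ≤ b' := le_add_of_nonneg_right cb0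
  have DD : D ≤ D' := le_add_of_nonneg_right cD0
  have cbb : expConv (m / 2) (size k₂ v₂) ξ ≤ b' := le_add_of_nonneg_left b0
  have cDD : expConv (m / 2) (gap δ k₁ v₁ k₂ v₂) ξ ≤ D' := le_add_of_nonneg_left D0
  have b0' := b0.trans bb
  have D0' := D0.trans DD
  have hsD : δ * b' ≤ D' := by
    have e1 : ∀ η, δ * size k₂ v₂ η ≤ gap δ k₁ v₁ k₂ v₂ η := fun η => by
      unfold gap; linarith [abs_nonneg (k₁ η - k₂ η), abs_nonneg (v₁ η - v₂ η)]
    have e2 : δ * expConv (m / 2) (size k₂ v₂) ξ ≤ expConv (m / 2) (gap δ k₁ v₁ k₂ v₂) ξ := by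
      rw [expConv, ← integral_const_mul]
      refine integral_mono ((integrable_expConv hm2 A2.memLp_size_top ξ).const_mul δ)
        (integrable_expConv hm2 (A1.memLp_gap_top A2 δ) ξ) fun η => ?_
      have := Real.exp_pos (-(m / 2 * |ξ - η|))
      calc _ = Real.exp (-(m / 2 * |ξ - η|)) * (δ * size k₂ v₂ η) := by ring
        _ ≤ _ := by gcongr; exact e1 η
    rw [hb', hD', withConv, withConv, mul_add]
    exact add_le_add (e1 ξ) e2
  have iU := (I univ ξ).mono cb0 cbb cD0 cDD le_rfl
  have iI := (I (Ioi ξ) ξ).mono cb0 cbb cD0 cDD le_rfl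
  have iJ := (I (Iic ξ) ξ).mono cb0 cbb cD0 cDD le_rfl
  simp only [Measure.restrict_univ] at iU
  have pG' := pG.mono b0 bb D0 DD le_rfl
  have pd' := pd.mono b0 bb D0 DD le_rfl
  have pP : SmallPair b' D' cP (Pt lam f g t₁ k₁ v₁ q₁ ξ) (Pt lam f g t₂ k₂ v₂ q₂ ξ) :=
    iU.const_mul (1 / 2)
  have pK : SmallPair b' D' cK (rhsK lam f g t₁ k₁ v₁ q₁ ξ) (rhsK lam f g t₂ k₂ v₂ q₂ ξ) :=
    ((iI.sub iJ).const_mul (1 / 2)).neg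
  have pD : SmallPair b' D' cD (rhsDx lam f g t₁ k₁ v₁ q₁ ξ) (rhsDx lam f g t₂ k₂ v₂ q₂ ξ) :=
    pd'.sub (pj.mul_small hδ hsD pP)
  have ps := smallPair_sin_sq (hvz.trans bb) (hgv.trans DD)
  have pc := bddPair_cos hvd
  have psn := smallPair_sin (hvz.trans bb) (hgv.trans DD)
  have psb := bddPair_sin hvd
  refine ⟨pP.mono b0' le_rfl D0' le_rfl lP, pK.mono b0' le_rfl D0' le_rfl lK,
    pD.mono b0' le_rfl D0' le_rfl lD, ?_, ?_⟩
  · rw [rhsV_eq, rhsV_eq, mul_comm (_ - Pt lam f g t₁ k₁ v₁ q₁ ξ),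
      mul_comm (_ - Pt lam f g t₂ k₂ v₂ q₂ ξ)]
    exact (((pc.mul_small hδ hsD (pG'.sub pP)).const_mul 2).sub
      (pF.mul_small hδ hsD ps)).mono b0' le_rfl D0' le_rfl lV
  · rw [rhsQ_eq, rhsQ_eq]
    exact (pq.mul_small hδ hsD (((pF.mul_small hδ hsD psn).const_mul (1 / 2)).add
      (psb.mul_small hδ hsD (pG'.sub pP)))).mono b0' le_rfl D0' le_rfl lQ

end Pairs

variable {M m T : ℝ}

/-! ### Regularity of the nonlocal terms -/

namespace Adm

variable {k v q : ℝ → ℝ}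

lemma isPrim_jac (h : Adm M m k v q) (hm : 0 < m) :
    IsPrim (fun ξ => ∫ s in (0 : ℝ)..ξ, jac v q s) (jac v q) := by
  simpa using IsPrim.of_integral (h.locallyIntegrable_jac hm) 0 0

/-- To the right of `ξ` the kernel is a product of a function of `ξ` and a function of `η`. -/
lemma kern_of_le (h : Adm M m k v q) (hm : 0 < m) {ξ η : ℝ} (hξη : ξ ≤ η) :
    kern v q ξ η = Real.exp (∫ s in (0 : ℝ)..ξ, jac v q s)
      * Real.exp (-∫ s in (0 : ℝ)..η, jac v q s) := by
  have h0 : 0 ≤ ∫ s in ξ..η, jac v q s :=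
    intervalIntegral.integral_nonneg_of_ae hξη (h.jac_nonneg hm)
  have h1 := (h.isPrim_jac hm).eq ξ η
  rw [kern, abs_of_nonneg h0, ← Real.exp_add, ← h1]
  congr 1; ring

/-- To the left of `ξ` the kernel is a product of a function of `ξ` and a function of `η`. -/
lemma kern_of_ge (h : Adm M m k v q) (hm : 0 < m) {ξ η : ℝ} (hξη : η ≤ ξ) :
    kern v q ξ η = Real.exp (-∫ s in (0 : ℝ)..ξ, jac v q s)
      * Real.exp (∫ s in (0 : ℝ)..η, jac v q s) := by
  have h0 : 0 ≤ ∫ s in η..ξ, jac v q s :=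
    intervalIntegral.integral_nonneg_of_ae hξη (h.jac_nonneg hm)
  have h1 := (h.isPrim_jac hm).eq η ξ
  rw [kern, intervalIntegral.integral_symm, abs_neg, abs_of_nonneg h0, ← Real.exp_add, ← h1]
  congr 1; ring

/-- The part of the nonlocal term coming from the right solves `I' = cos²(v/2) q I - h`. -/
lemma isPrim_setIntegral_Ioi (hlam : 0 < lam) (hf : ContDiff ℝ ∞ f) (hg : ContDiff ℝ ∞ g)
    (hg0 : g 0 = 0) (hm : 0 < m) {t : ℝ} (ht : 0 ≤ t) (h : Adm M m k v q) :
    IsPrim (fun ξ => ∫ η in Ioi ξ, integrand lam f g t k v q ξ η)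
      (fun ξ => jac v q ξ * (∫ η in Ioi ξ, integrand lam f g t k v q ξ η)
        - density lam f g t k v q ξ) := by
  set Y : ℝ → ℝ := fun ξ => ∫ s in (0 : ℝ)..ξ, jac v q s with hY
  have pY : IsPrim Y (jac v q) := h.isPrim_jac hm
  set B : ℝ → ℝ := fun ξ => ∫ η in Ioi ξ, Real.exp (-Y η) * density lam f g t k v q η with hB
  have eK : ∀ ξ, ∀ η ∈ Ioi ξ, integrand lam f g t k v q ξ η
      = Real.exp (Y ξ) * (Real.exp (-Y η) * density lam f g t k v q η) := fun ξ η hη => by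
    rw [integrand_eq, h.kern_of_le hm (le_of_lt hη), mul_assoc]
  have hI : ∀ ξ, IntegrableOn (fun η => Real.exp (-Y η) * density lam f g t k v q η) (Ioi ξ) := by
    intro ξ
    have h1 := ((h.integrable_integrand hlam hf hg hg0 hm ht ξ).integrableOn (s := Ioi ξ)).congr_fun
      (eK ξ) measurableSet_Ioi
    have h2 := h1.const_mul (Real.exp (-Y ξ))
    refine h2.congr (ae_of_all _ fun η => ?_)
    simp only
    rw [← mul_assoc, ← Real.exp_add, neg_add_cancel, Real.exp_zero, one_mul]
  have pB : IsPrim B fun η => -(Real.exp (-Y η) * density lam f g t k v q η) := by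
    refine ⟨?_, fun a b => ?_⟩
    · have h1 : LocallyIntegrable (density lam f g t k v q) volume :=
        (h.density_bound hlam hf hg hg0 hm ht).2.locallyIntegrable le_top
      have h2 : Continuous fun η => Real.exp (-Y η) := Real.continuous_exp.comp pY.continuous.neg
      have := (h1.continuous_smul h2).neg
      simpa only [smul_eq_mul] using! this
    · rw [intervalIntegral.integral_neg, hB,
        ← intervalIntegral.integral_Ioi_sub_Ioi' (hI a) (hI b)]
      ring
  have pE := pY.comp (Φ := Real.exp) (φ := Real.exp) Real.hasDerivAt_exp Real.continuous_exp
  have e : (fun ξ => ∫ η in Ioi ξ, integrand lam f g t k v q ξ η)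
      = fun ξ => Real.exp (Y ξ) * B ξ := by
    ext ξ
    rw [setIntegral_congr_fun measurableSet_Ioi (eK ξ), integral_const_mul]
  rw [e]
  refine (pE.mul pB).congr_deriv (ae_of_all _ fun ξ => ?_)
  have e2 : ∫ η in Ioi ξ, integrand lam f g t k v q ξ η = Real.exp (Y ξ) * B ξ := congrFun e ξ
  simp only
  rw [e2, mul_neg, ← mul_assoc (Real.exp (Y ξ)) (Real.exp (-Y ξ)), ← Real.exp_add,
    add_neg_cancel, Real.exp_zero]
  ring

/-- The part of the nonlocal term coming from the left solves `I' = -cos²(v/2) q I + h`. -/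
lemma isPrim_setIntegral_Iic (hlam : 0 < lam) (hf : ContDiff ℝ ∞ f) (hg : ContDiff ℝ ∞ g)
    (hg0 : g 0 = 0) (hm : 0 < m) {t : ℝ} (ht : 0 ≤ t) (h : Adm M m k v q) :
    IsPrim (fun ξ => ∫ η in Iic ξ, integrand lam f g t k v q ξ η)
      (fun ξ => -(jac v q ξ * ∫ η in Iic ξ, integrand lam f g t k v q ξ η)
        + density lam f g t k v q ξ) := by
  set Y : ℝ → ℝ := fun ξ => ∫ s in (0 : ℝ)..ξ, jac v q s with hY
  have pY : IsPrim Y (jac v q) := h.isPrim_jac hm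
  set B : ℝ → ℝ := fun ξ => ∫ η in Iic ξ, Real.exp (Y η) * density lam f g t k v q η with hB
  have eK : ∀ ξ, ∀ η ∈ Iic ξ, integrand lam f g t k v q ξ η
      = Real.exp (-Y ξ) * (Real.exp (Y η) * density lam f g t k v q η) := fun ξ η hη => by
    rw [integrand_eq, h.kern_of_ge hm hη, mul_assoc]
  have hI : ∀ ξ, IntegrableOn (fun η => Real.exp (Y η) * density lam f g t k v q η) (Iic ξ) := by
    intro ξ
    have h1 := ((h.integrable_integrand hlam hf hg hg0 hm ht ξ).integrableOn (s := Iic ξ)).congr_fun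
      (eK ξ) measurableSet_Iic
    have h2 := h1.const_mul (Real.exp (Y ξ))
    refine h2.congr (ae_of_all _ fun η => ?_)
    simp only
    rw [← mul_assoc, ← Real.exp_add, add_neg_cancel, Real.exp_zero, one_mul]
  have pB : IsPrim B fun η => Real.exp (Y η) * density lam f g t k v q η := by
    refine ⟨?_, fun a b => ?_⟩
    · have h1 : LocallyIntegrable (density lam f g t k v q) volume :=
        (h.density_bound hlam hf hg hg0 hm ht).2.locallyIntegrable le_top
      have h2 : Continuous fun η => Real.exp (Y η) := Real.continuous_exp.comp pY.continuous
      have := h1.continuous_smul h2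
      simpa only [smul_eq_mul] using! this
    · exact intervalIntegral.integral_Iic_sub_Iic (hI a) (hI b)
  have pE := pY.comp (Φ := fun y => Real.exp (-y)) (φ := fun y => -Real.exp (-y))
    (fun y => by simpa using (hasDerivAt_neg y).exp) (by fun_prop)
  have e : (fun ξ => ∫ η in Iic ξ, integrand lam f g t k v q ξ η)
      = fun ξ => Real.exp (-Y ξ) * B ξ := by
    ext ξ
    rw [setIntegral_congr_fun measurableSet_Iic (eK ξ), integral_const_mul]
  rw [e]
  refine (pE.mul pB).congr_deriv (ae_of_all _ fun ξ => ?_)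
  have e2 : ∫ η in Iic ξ, integrand lam f g t k v q ξ η = Real.exp (-Y ξ) * B ξ := congrFun e ξ
  simp only
  rw [e2, ← mul_assoc (Real.exp (-Y ξ)) (Real.exp (Y ξ)), ← Real.exp_add,
    neg_add_cancel, Real.exp_zero]
  ring

lemma Pt_eq (hlam : 0 < lam) (hf : ContDiff ℝ ∞ f) (hg : ContDiff ℝ ∞ g)
    (hg0 : g 0 = 0) (hm : 0 < m) {t : ℝ} (ht : 0 ≤ t) (h : Adm M m k v q) (ξ : ℝ) :
    Pt lam f g t k v q ξ = 1 / 2 * (∫ η in Ioi ξ, integrand lam f g t k v q ξ η)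
      + 1 / 2 * ∫ η in Iic ξ, integrand lam f g t k v q ξ η := by
  have hi := h.integrable_integrand hlam hf hg hg0 hm ht ξ
  rw [Pt, ← mul_add, add_comm (∫ η in Ioi ξ, _),
    intervalIntegral.integral_Iic_add_Ioi hi.integrableOn hi.integrableOn]

/-- `P̃_ξ = cos²(v/2) q P̃_x`. -/
lemma isPrim_Pt (hlam : 0 < lam) (hf : ContDiff ℝ ∞ f) (hg : ContDiff ℝ ∞ g)
    (hg0 : g 0 = 0) (hm : 0 < m) {t : ℝ} (ht : 0 ≤ t) (h : Adm M m k v q) :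
    IsPrim (Pt lam f g t k v q) (fun ξ => jac v q ξ * Px lam f g t k v q ξ) := by
  have h1 := (h.isPrim_setIntegral_Ioi hlam hf hg hg0 hm ht).const_mul (1 / 2)
  have h2 := (h.isPrim_setIntegral_Iic hlam hf hg hg0 hm ht).const_mul (1 / 2)
  rw [funext (h.Pt_eq hlam hf hg hg0 hm ht)]
  refine (h1.add h2).congr_deriv (ae_of_all _ fun ξ => ?_)
  simp only [Px]; ring

/-- `(-P̃_x)_ξ = h - cos²(v/2) q P̃`. -/
lemma isPrim_rhsK (hlam : 0 < lam) (hf : ContDiff ℝ ∞ f) (hg : ContDiff ℝ ∞ g)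
    (hg0 : g 0 = 0) (hm : 0 < m) {t : ℝ} (ht : 0 ≤ t) (h : Adm M m k v q) :
    IsPrim (rhsK lam f g t k v q) (rhsDx lam f g t k v q) := by
  have h1 := (h.isPrim_setIntegral_Ioi hlam hf hg hg0 hm ht).const_mul (-(1 / 2))
  have h2 := (h.isPrim_setIntegral_Iic hlam hf hg hg0 hm ht).const_mul (1 / 2)
  have e : rhsK lam f g t k v q = fun ξ => -(1 / 2) * (∫ η in Ioi ξ, integrand lam f g t k v q ξ η)
      + 1 / 2 * ∫ η in Iic ξ, integrand lam f g t k v q ξ η := by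
    ext ξ; simp only [rhsK, Px]; ring
  rw [e]
  refine (h1.add h2).congr_deriv (ae_of_all _ fun ξ => ?_)
  simp only [rhsDx]
  rw [h.Pt_eq hlam hf hg hg0 hm ht]; ring

end Adm

/-! ### The vector field -/

/-- `Adm` for a point of `X`. -/
abbrev AdmX (M m : ℝ) (z : X) : Prop := Adm M m (X.k z) (X.v z) (X.q z)

lemma admX_of_bounds {z : X} (hk : ∀ᵐ ξ, |X.k z ξ| ≤ M) (hq : ∀ᵐ ξ, m ≤ X.q z ξ)
    (hq' : ∀ᵐ ξ, X.q z ξ ≤ M) (hs : ∫ ξ, Real.sin (X.v z ξ / 2) ^ 2 * X.q z ξ ≤ M) :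
    AdmX M m z :=
  ⟨measurable_k z, measurable_v z, measurable_q z, memLp_k z, memLp_v z, memLp_v_top z, hk, hq,
    hq', hs⟩

/-- A ball of `X` on which `q` is bounded below is admissible. -/
lemma admX_of_norm_le (hm : 0 < m) {z : X} {N : ℝ} (hz : ‖z‖ ≤ N) (hq : ∀ᵐ ξ, m ≤ X.q z ξ) :
    AdmX (2 * N + N ^ 3) m z := by
  have hN : 0 ≤ N := (norm_nonneg z).trans hz
  have hN3 : 0 ≤ N ^ 3 := by positivity
  refine admX_of_bounds ?_ hq ?_ ?_
  · filter_upwards [ae_abs_k_le z] with ξ h; linarith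
  · filter_upwards [ae_abs_q_le z] with ξ h
    have := le_abs_self (X.q z ξ); linarith
  · have h1 : ∫ ξ, Real.sin (X.v z ξ / 2) ^ 2 * X.q z ξ ≤ ∫ ξ, N * X.v z ξ ^ 2 := by
      refine integral_mono_of_nonneg ?_ ((memLp_v z).integrable_sq.const_mul N) ?_
      · filter_upwards [hq] with ξ h using mul_nonneg (sq_nonneg _) (hm.le.trans h)
      · filter_upwards [ae_abs_q_le z] with ξ h
        have h2 := sin_half_sq_le (X.v z ξ)
        have h3 := le_abs_self (X.q z ξ)
        have h4 := sq_nonneg (Real.sin (X.v z ξ / 2))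
        nlinarith
    rw [integral_const_mul, integral_sq_eq (memLp_v z)] at h1
    have h2 := (lpNorm_v_le z).trans hz
    have h3 : lpNorm (X.v z) 2 volume ^ 2 ≤ N ^ 2 := pow_le_pow_left₀ lpNorm_nonneg h2 2
    nlinarith

/-- The right-hand side of the system as a vector field on `X`; it is given the value `0` where
the right-hand side does not define a point of `X`. -/
def field (lam : ℝ) (f g : ℝ → ℝ) (t : ℝ) (z : X) : X :=
  open Classical in
  if h : ∃ z' : X, X.k z' =ᵐ[volume] rhsK lam f g t (X.k z) (X.v z) (X.q z) ∧
    X.v z' =ᵐ[volume] rhsV lam f g t (X.k z) (X.v z) (X.q z) ∧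
    X.q z' =ᵐ[volume] rhsQ lam f g t (X.k z) (X.v z) (X.q z) then h.choose else 0

/-- `z'` is the right-hand side of the system at the time `t` and the point `z`. -/
def IsRhs (lam : ℝ) (f g : ℝ → ℝ) (t : ℝ) (z z' : X) : Prop :=
  X.k z' =ᵐ[volume] rhsK lam f g t (X.k z) (X.v z) (X.q z) ∧
  X.v z' =ᵐ[volume] rhsV lam f g t (X.k z) (X.v z) (X.q z) ∧
  X.q z' =ᵐ[volume] rhsQ lam f g t (X.k z) (X.v z) (X.q z)

/-- A point of `X` is determined by its components almost everywhere. -/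
lemma IsRhs.eq_field {t : ℝ} {z z' : X} (h : IsRhs lam f g t z z') : z' = field lam f g t z := by
  have hex : ∃ z' : X, X.k z' =ᵐ[volume] rhsK lam f g t (X.k z) (X.v z) (X.q z) ∧
    X.v z' =ᵐ[volume] rhsV lam f g t (X.k z) (X.v z) (X.q z) ∧
    X.q z' =ᵐ[volume] rhsQ lam f g t (X.k z) (X.v z) (X.q z) := ⟨z', h⟩
  have h2 := hex.choose_spec
  rw [field, dif_pos hex]
  exact X.ext_ae (h.1.trans h2.1.symm) (h.2.1.trans h2.2.1.symm) (h.2.2.trans h2.2.2.symm)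

/-- The convolution does not increase the norms by more than a factor. -/
lemma withConv_bound {a : ℝ} (ha : 0 < a) {b : ℝ → ℝ} (hm : Measurable b)
    (h2 : MemLp b 2 volume) (hi : MemLp b ∞ volume) :
    MemLp (withConv a b) 2 volume ∧ MemLp (withConv a b) ∞ volume ∧
    lpNorm (withConv a b) 2 volume ≤ (1 + 2 / a) * lpNorm b 2 volume ∧
    lpNorm (withConv a b) ∞ volume ≤ (1 + 2 / a) * lpNorm b ∞ volume := by
  obtain ⟨c1, c2⟩ := memLp_two_expConv ha hi h2 hm
  have c3 := memLp_top_expConv ha hi hm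
  refine ⟨h2.add c1, hi.add c3, ?_, ?_⟩
  · have := lpNorm_add_le h2 (g := expConv a b) (by norm_num)
    exact this.trans (by linarith)
  · have := lpNorm_add_le hi (g := expConv a b) (by norm_num)
    exact this.trans (by linarith [lpNorm_top_expConv_le ha hi])

lemma ae_size_le (z : X) : ∀ᵐ ξ, size (X.k z) (X.v z) ξ ≤ 3 * ‖z‖ := by
  filter_upwards [ae_abs_k_le z, ae_abs_v_le z] with ξ h1 h2
  unfold size; linarith

lemma lpNorm_size_le (z : X) : lpNorm (size (X.k z) (X.v z)) 2 volume ≤ 2 * ‖z‖ ∧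
    lpNorm (size (X.k z) (X.v z)) ∞ volume ≤ 3 * ‖z‖ := by
  constructor
  · have := lpNorm_add_le (memLp_k z).abs (g := fun ξ => |X.v z ξ|) (by norm_num)
    rw [lpNorm_fun_abs (memLp_v z).1] at this
    have h3 : lpNorm |X.k z| 2 volume = lpNorm (X.k z) 2 volume := lpNorm_abs (memLp_k z).1 2
    have h4 : size (X.k z) (X.v z) = |X.k z| + fun ξ => |X.v z ξ| := rfl
    rw [h4]
    refine this.trans ?_
    rw [h3]
    linarith [lpNorm_k_le z, lpNorm_v_le z]
  · refine lpNorm_top_le (by positivity) ?_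
    filter_upwards [ae_size_le z] with ξ h
    rwa [abs_of_nonneg (size_nonneg _ _ _)]

lemma close_X {t₁ t₂ δ : ℝ} (z₁ z₂ : X) (hδ : 2 * ‖z₁ - z₂‖ + |t₁ - t₂| ≤ δ) :
    Close δ t₁ t₂ (X.k z₁) (X.v z₁) (X.q z₁) (X.k z₂) (X.v z₂) (X.q z₂) := by
  have h0 := norm_nonneg (z₁ - z₂)
  have h1 := abs_nonneg (t₁ - t₂)
  refine ⟨by linarith, ?_, ?_, ?_⟩
  · filter_upwards [ae_abs_k_le (z₁ - z₂), X.k_sub z₁ z₂] with ξ a b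
    rw [← b]; linarith
  · filter_upwards [ae_abs_v_le (z₁ - z₂), X.v_sub z₁ z₂] with ξ a b
    rw [← b]; linarith
  · filter_upwards [ae_abs_q_le (z₁ - z₂), X.q_sub z₁ z₂] with ξ a b
    rw [← b]; linarith

lemma lpNorm_gap_le {t₁ t₂ δ : ℝ} {z₁ z₂ : X} (hA₁ : AdmX M m z₁) (hA₂ : AdmX M m z₂)
    (hδ : 2 * ‖z₁ - z₂‖ + |t₁ - t₂| ≤ δ) :
    lpNorm (gap δ (X.k z₁) (X.v z₁) (X.k z₂) (X.v z₂)) 2 volume ≤ 2 * δ * (1 + ‖z₂‖) ∧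
    lpNorm (gap δ (X.k z₁) (X.v z₁) (X.k z₂) (X.v z₂)) ∞ volume ≤ 3 * δ * (1 + ‖z₂‖) := by
  have h0 := norm_nonneg (z₁ - z₂)
  have h1 := abs_nonneg (t₁ - t₂)
  have hδ0 : 0 ≤ δ := by linarith
  have hz := norm_nonneg z₂
  constructor
  · have e : gap δ (X.k z₁) (X.v z₁) (X.k z₂) (X.v z₂) =ᵐ[volume]
        (size (X.k (z₁ - z₂)) (X.v (z₁ - z₂)) + δ • size (X.k z₂) (X.v z₂) : ℝ → ℝ) := by
      filter_upwards [X.k_sub z₁ z₂, X.v_sub z₁ z₂] with ξ a b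
      simp only [gap, size, Pi.add_apply, Pi.smul_apply, smul_eq_mul]
      rw [a, b]
    have m1 := hA₁.memLp_gap hA₂ δ
    have m2 : MemLp (size (X.k (z₁ - z₂)) (X.v (z₁ - z₂))) 2 volume :=
      (memLp_k _).abs.add (memLp_v _).abs
    have m3 := hA₂.memLp_size
    have e2 : lpNorm (gap δ (X.k z₁) (X.v z₁) (X.k z₂) (X.v z₂)) 2 volume
        = lpNorm (size (X.k (z₁ - z₂)) (X.v (z₁ - z₂)) + δ • size (X.k z₂) (X.v z₂) : ℝ → ℝ)
          2 volume := by
      rw [← toReal_eLpNorm m1.1, ← toReal_eLpNorm (m2.add (m3.const_smul δ)).1, eLpNorm_congr_ae e]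
    rw [e2]
    refine (lpNorm_add_le m2 (by norm_num)).trans ?_
    rw [lpNorm_const_smul, coe_nnnorm, Real.norm_of_nonneg hδ0]
    have a1 := (lpNorm_size_le (z₁ - z₂)).1
    have a2 : δ * lpNorm (size (X.k z₂) (X.v z₂)) 2 volume ≤ δ * (2 * ‖z₂‖) :=
      mul_le_mul_of_nonneg_left (lpNorm_size_le z₂).1 hδ0
    linarith
  · refine lpNorm_top_le (by positivity) ?_
    have hc := close_X z₁ z₂ hδ
    filter_upwards [hc.k, hc.v, ae_size_le z₂] with ξ a b c
    rw [abs_of_nonneg (gap_nonneg hδ0 _ _ _ _ _), gap]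
    have : δ * size (X.k z₂) (X.v z₂) ξ ≤ δ * (3 * ‖z₂‖) := by gcongr
    linarith

section Field

variable (hlam : 0 < lam) (hf : ContDiff ℝ ∞ f) (hg : ContDiff ℝ ∞ g) (hg0 : g 0 = 0)

include hlam hf hg hg0

lemma exists_isRhs (hm : 0 < m) {t : ℝ} (ht : 0 ≤ t) {z : X} (h : AdmX M m z) :
    ∃ z' : X, IsRhs lam f g t z z' := by
  obtain ⟨C, hC, H⟩ := exists_rhs_pair hlam hf hg hg0 t M hm
  have hb := H t ⟨ht, le_rfl⟩ t ⟨ht, le_rfl⟩ 0 _ _ _ _ _ _ h h ⟨by simp, by simp, by simp, by simp⟩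
  obtain ⟨w2, wi, -, -⟩ := withConv_bound (half_pos hm) h.measurable_size h.memLp_size
    h.memLp_size_top
  have pK := h.isPrim_rhsK hlam hf hg hg0 hm ht
  have pP := h.isPrim_Pt hlam hf hg hg0 hm ht
  have mk := h.measurable_k
  have mv := h.measurable_v
  have mq := h.measurable_q
  have mP := pP.continuous.measurable
  have mG := (continuous_coefG lam hg t).measurable.comp mk
  have mF := (continuous_coefF lam hf t).measurable.comp mk
  have mD := measurable_density (lam := lam) hf hg t mk mv mq
  have mJ := h.measurable_jac
  have mDx : Measurable (rhsDx lam f g t (X.k z) (X.v z) (X.q z)) := mD.sub (mJ.mul mP)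
  have mV : Measurable (rhsV lam f g t (X.k z) (X.v z) (X.q z)) := by
    rw [funext (rhsV_eq lam f g t (X.k z) (X.v z) (X.q z))]
    change Measurable fun ξ => 2 * (((coefG lam g t ∘ X.k z) ξ - Pt lam f g t _ _ _ ξ)
      * Real.cos (X.v z ξ / 2) ^ 2) - (coefF lam f t ∘ X.k z) ξ * Real.sin (X.v z ξ / 2) ^ 2
    fun_prop
  have mQ : Measurable (rhsQ lam f g t (X.k z) (X.v z) (X.q z)) := by
    rw [funext (rhsQ_eq lam f g t (X.k z) (X.v z) (X.q z))]
    change Measurable fun ξ => X.q z ξ * (1 / 2 * ((coefF lam f t ∘ X.k z) ξ * Real.sin (X.v z ξ))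
      + Real.sin (X.v z ξ) * ((coefG lam g t ∘ X.k z) ξ - Pt lam f g t _ _ _ ξ))
    fun_prop
  have key : ∀ {R : ℝ → ℝ}, Measurable R →
      (∀ᵐ ξ, |R ξ| ≤ C * withConv (m / 2) (size (X.k z) (X.v z)) ξ) →
      MemLp R 2 volume ∧ MemLp R ∞ volume := by
    intro R hR hb
    have hb' : ∀ᵐ ξ, ‖R ξ‖ ≤ C * ‖withConv (m / 2) (size (X.k z) (X.v z)) ξ‖ := by
      filter_upwards [hb] with ξ h
      rw [Real.norm_eq_abs]
      exact h.trans (by gcongr; exact le_abs_self _)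
    exact ⟨w2.of_le_mul hR.aestronglyMeasurable hb', wi.of_le_mul hR.aestronglyMeasurable hb'⟩
  obtain ⟨z', e1, -, e3, e4⟩ := exists_X
    (key pK.continuous.measurable (hb.mono fun ξ h => h.2.1.2.1)).1
    (key mDx (hb.mono fun ξ h => h.2.2.1.2.1)).1 pK.isWeakDeriv
    (key mV (hb.mono fun ξ h => h.2.2.2.1.2.1)).1 (key mV (hb.mono fun ξ h => h.2.2.2.1.2.1)).2
    (key mQ (hb.mono fun ξ h => h.2.2.2.2.2.1)).2
  exact ⟨z', e1, e3, e4⟩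

/-- At admissible points the default value of `field` is not used. -/
lemma field_isRhs (hm : 0 < m) {t : ℝ} (ht : 0 ≤ t) {z : X} (h : AdmX M m z) :
    IsRhs lam f g t z (field lam f g t z) := by
  obtain ⟨z', hz'⟩ := exists_isRhs hlam hf hg hg0 hm ht h
  rw [← hz'.eq_field]; exact hz'

lemma dx_field (hm : 0 < m) {t : ℝ} (ht : 0 ≤ t) {z : X} (h : AdmX M m z) :
    X.dx (field lam f g t z) =ᵐ[volume] rhsDx lam f g t (X.k z) (X.v z) (X.q z) := by
  have pK := h.isPrim_rhsK hlam hf hg hg0 hm ht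
  have h1 := field_isRhs hlam hf hg hg0 hm ht h
  exact IsWeakDeriv.unique (locallyIntegrable_of_memLp_two (memLp_dx _)) pK.loc
    (isWeakDeriv_X _) (pK.isWeakDeriv.congr h1.1.symm (EventuallyEq.refl _ _))

/-- The vector field is Lipschitz in time and space on admissible sets, and of linear growth. -/
lemma exists_field_bound (T M : ℝ) (hm : 0 < m) : ∃ C : ℝ, 0 ≤ C ∧
    ∀ t₁ ∈ Icc 0 T, ∀ t₂ ∈ Icc 0 T, ∀ z₁ z₂ : X, AdmX M m z₁ → AdmX M m z₂ →
      ‖field lam f g t₂ z₂‖ ≤ C * ‖z₂‖ ∧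
      ‖field lam f g t₁ z₁ - field lam f g t₂ z₂‖
        ≤ C * (1 + ‖z₂‖) * (2 * ‖z₁ - z₂‖ + |t₁ - t₂|) := by
  obtain ⟨C, hC, H⟩ := exists_rhs_pair hlam hf hg hg0 T M hm
  have hm2 := half_pos hm
  refine ⟨C * ((1 + 2 / (m / 2)) * 12), by positivity, ?_⟩
  intro t₁ h1 t₂ h2 z₁ z₂ A1 A2
  set δ := 2 * ‖z₁ - z₂‖ + |t₁ - t₂| with hδ
  have hc := close_X z₁ z₂ hδ.ge
  have hδ0 : 0 ≤ δ := by positivity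
  have hb := H t₁ h1 t₂ h2 δ _ _ _ _ _ _ A1 A2 hc
  obtain ⟨r1, r2, r3⟩ := field_isRhs hlam hf hg hg0 hm h1.1 A1
  obtain ⟨s1, s2, s3⟩ := field_isRhs hlam hf hg hg0 hm h2.1 A2
  have r4 := dx_field hlam hf hg hg0 hm h1.1 A1
  have s4 := dx_field hlam hf hg hg0 hm h2.1 A2
  constructor
  · obtain ⟨w2, wi, n2, ni⟩ := withConv_bound hm2 A2.measurable_size A2.memLp_size
      A2.memLp_size_top
    have key : ∀ {R S : ℝ → ℝ}, S =ᵐ[volume] R →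
        (∀ᵐ ξ, |R ξ| ≤ C * withConv (m / 2) (size (X.k z₂) (X.v z₂)) ξ) →
        ∀ᵐ ξ, |S ξ| ≤ C * |withConv (m / 2) (size (X.k z₂) (X.v z₂)) ξ| := by
      intro R S h1 h2
      filter_upwards [h1, h2] with ξ a b
      rw [a]
      exact b.trans (mul_le_mul_of_nonneg_left (le_abs_self _) hC)
    have := norm_X_le w2 wi (key s1 (hb.mono fun ξ h => h.2.1.2.1))
      (key s4 (hb.mono fun ξ h => h.2.2.1.2.1)) (key s2 (hb.mono fun ξ h => h.2.2.2.1.2.1))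
      (key s3 (hb.mono fun ξ h => h.2.2.2.2.2.1))
    refine this.trans ?_
    obtain ⟨l2, li⟩ := lpNorm_size_le z₂
    calc _ ≤ C * (3 * ((1 + 2 / (m / 2)) * (2 * ‖z₂‖)) + 2 * ((1 + 2 / (m / 2)) * (3 * ‖z₂‖))) := by
          gcongr
          · exact n2.trans (by gcongr)
          · exact ni.trans (by gcongr)
      _ = _ := by ring
  · obtain ⟨w2, wi, n2, ni⟩ := withConv_bound hm2 (A1.measurable_gap A2 δ) (A1.memLp_gap A2 δ)
      (A1.memLp_gap_top A2 δ)
    have key : ∀ {R₁ R₂ S₁ S₂ S : ℝ → ℝ}, S₁ =ᵐ[volume] R₁ → S₂ =ᵐ[volume] R₂ →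
        S =ᵐ[volume] (fun ξ => S₁ ξ - S₂ ξ) →
        (∀ᵐ ξ, |R₁ ξ - R₂ ξ| ≤ C * withConv (m / 2)
          (gap δ (X.k z₁) (X.v z₁) (X.k z₂) (X.v z₂)) ξ) →
        ∀ᵐ ξ, |S ξ| ≤ C * |withConv (m / 2)
          (gap δ (X.k z₁) (X.v z₁) (X.k z₂) (X.v z₂)) ξ| := by
      intro R₁ R₂ S₁ S₂ S h1 h2 h3 h4
      filter_upwards [h1, h2, h3, h4] with ξ a b c d
      rw [c, a, b]
      exact d.trans (mul_le_mul_of_nonneg_left (le_abs_self _) hC)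
    have := norm_X_le w2 wi (key r1 s1 (X.k_sub _ _) (hb.mono fun ξ h => h.2.1.2.2))
      (key r4 s4 (X.dx_sub _ _) (hb.mono fun ξ h => h.2.2.1.2.2))
      (key r2 s2 (X.v_sub _ _) (hb.mono fun ξ h => h.2.2.2.1.2.2))
      (key r3 s3 (X.q_sub _ _) (hb.mono fun ξ h => h.2.2.2.2.2.2))
    refine this.trans ?_
    obtain ⟨l2, li⟩ := lpNorm_gap_le A1 A2 hδ.ge
    calc _ ≤ C * (3 * ((1 + 2 / (m / 2)) * (2 * δ * (1 + ‖z₂‖)))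
          + 2 * ((1 + 2 / (m / 2)) * (3 * δ * (1 + ‖z₂‖)))) := by
          gcongr
          · exact n2.trans (by gcongr)
          · exact ni.trans (by gcongr)
      _ = _ := by ring

end Field

/-! ### The initial datum -/

section InitialDatum

variable (u : H1)

lemma measurable_H1_dx : Measurable (H1.dx u) := (Lp.stronglyMeasurable _).measurable

lemma memLp_H1_dx : MemLp (H1.dx u) 2 volume := Lp.memLp _

lemma memLp_H1_fn : MemLp (H1.fn u) 2 volume := Lp.memLp _

lemma le_ybar_iff (a ξ : ℝ) : a ≤ ybar u ξ ↔ ∫ x in (0 : ℝ)..a, (1 + H1.dx u x ^ 2) ≤ ξ := by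
  have hs := ybar_spec u ξ
  have hsub : ∀ a b : ℝ, (∫ x in (0 : ℝ)..b, (1 + H1.dx u x ^ 2))
      - ∫ x in (0 : ℝ)..a, (1 + H1.dx u x ^ 2) = ∫ x in a..b, (1 + H1.dx u x ^ 2) := fun a b =>
    intervalIntegral.integral_interval_sub_left (intervalIntegrable_energy u 0 b)
      (intervalIntegrable_energy u 0 a)
  constructor
  · intro h
    have h1 := sub_le_integral_energy u h
    have h2 := hsub a (ybar u ξ)
    linarith
  · intro h
    by_contra! h3
    have h1 := sub_le_integral_energy u h3.le
    have h2 := hsub (ybar u ξ) a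
    linarith

lemma ybar_le_iff (a ξ : ℝ) : ybar u ξ ≤ a ↔ ξ ≤ ∫ x in (0 : ℝ)..a, (1 + H1.dx u x ^ 2) := by
  constructor
  · intro h
    rcases h.eq_or_lt with h | h
    · rw [← h, ybar_spec]
    · by_contra! h1
      exact absurd ((le_ybar_iff u a ξ).2 h1.le) (not_le.2 h)
  · intro h
    rcases h.eq_or_lt with h | h
    · exact ((existsUnique_ybar u ξ).unique h.symm (ybar_spec u ξ)).ge
    · by_contra! h1
      exact absurd ((le_ybar_iff u a ξ).1 h1.le) (not_le.2 h)

lemma ybar_preimage_Ioo (a b : ℝ) : ybar u ⁻¹' Ioo a b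
    = Ioo (∫ x in (0 : ℝ)..a, (1 + H1.dx u x ^ 2)) (∫ x in (0 : ℝ)..b, (1 + H1.dx u x ^ 2)) := by
  ext ξ
  simp only [mem_preimage, mem_Ioo, ← not_le, le_ybar_iff, ybar_le_iff]

lemma strictMono_ybar : StrictMono (ybar u) := by
  intro a b h
  rw [← not_le, ybar_le_iff, ybar_spec]
  exact not_le.2 h

lemma measurable_ybar : Measurable (ybar u) := (strictMono_ybar u).monotone.measurable

lemma measurable_ofReal_energy : Measurable fun x => ENNReal.ofReal (1 + H1.dx u x ^ 2) :=
  (measurable_const.add ((measurable_H1_dx u).pow_const 2)).ennreal_ofReal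

/-- The change of variables `dξ = (1 + ū_x²) dx`. -/
lemma map_ybar : Measure.map (ybar u) volume
    = volume.withDensity fun x => ENNReal.ofReal (1 + H1.dx u x ^ 2) := by
  have e1 : ∀ a b : ℝ, Measure.map (ybar u) volume (Ioo a b)
      = ENNReal.ofReal (∫ x in a..b, (1 + H1.dx u x ^ 2)) := by
    intro a b
    rw [Measure.map_apply (measurable_ybar u) measurableSet_Ioo, ybar_preimage_Ioo,
      Real.volume_Ioo, intervalIntegral.integral_interval_sub_left
      (intervalIntegrable_energy u 0 b) (intervalIntegrable_energy u 0 a)]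
  have : IsLocallyFiniteMeasure (Measure.map (ybar u) volume) := by
    refine ⟨fun x => ⟨Ioo (x - 1) (x + 1), Ioo_mem_nhds (by linarith) (by linarith), ?_⟩⟩
    rw [e1]; exact ENNReal.ofReal_lt_top
  refine Real.measure_ext_Ioo_rat fun a b => ?_
  rw [e1, withDensity_apply _ measurableSet_Ioo]
  rcases le_or_gt (a : ℝ) b with h | h
  · rw [intervalIntegral.integral_of_le h, ofReal_integral_eq_lintegral_ofReal
      ((intervalIntegrable_iff_integrableOn_Ioc_of_le h).1 (intervalIntegrable_energy u a b))
      (ae_of_all _ fun x => by positivity), setLIntegral_congr Ioo_ae_eq_Ioc.symm]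
  · rw [Ioo_eq_empty (not_lt.2 h.le), setLIntegral_empty, ENNReal.ofReal_eq_zero,
      intervalIntegral.integral_symm]
    have := sub_le_integral_energy u h.le
    linarith

lemma quasiMeasurePreserving_ybar : Measure.QuasiMeasurePreserving (ybar u) volume volume :=
  ⟨measurable_ybar u, by rw [map_ybar]; exact withDensity_absolutelyContinuous _ _⟩

/-- The change of variables over an interval. -/
lemma integral_comp_ybar {p : ℝ → ℝ} (hp : Measurable p) {a b : ℝ} (hab : a ≤ b) :
    ∫ ξ in a..b, p (ybar u ξ) = ∫ x in ybar u a..ybar u b, (1 + H1.dx u x ^ 2) * p x := by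
  have hmono := strictMono_ybar u
  have e : Ioc a b = ybar u ⁻¹' Ioc (ybar u a) (ybar u b) := by
    ext ξ; simp [hmono.lt_iff_lt, hmono.le_iff_le]
  rw [intervalIntegral.integral_of_le hab, intervalIntegral.integral_of_le (hmono.monotone hab), e,
    ← setIntegral_map measurableSet_Ioc hp.aestronglyMeasurable (measurable_ybar u).aemeasurable,
    map_ybar, restrict_withDensity measurableSet_Ioc,
    integral_withDensity_eq_integral_toReal_smul (measurable_ofReal_energy u)
      (ae_of_all _ fun _ => ENNReal.ofReal_lt_top)]
  refine integral_congr_ae (ae_of_all _ fun x => ?_)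
  simp only
  rw [ENNReal.toReal_ofReal (by positivity), smul_eq_mul]

lemma memLp_two_comp_ybar {p : ℝ → ℝ} (hp : Measurable p)
    (hi : Integrable fun x => (1 + H1.dx u x ^ 2) * p x ^ 2) :
    MemLp (fun ξ => p (ybar u ξ)) 2 volume := by
  have hm : AEStronglyMeasurable (fun ξ => p (ybar u ξ)) volume :=
    (hp.comp (measurable_ybar u)).aestronglyMeasurable
  rw [memLp_two_iff_integrable_sq hm]
  have h : Integrable (fun x => p x ^ 2) (Measure.map (ybar u) volume) := by
    rw [map_ybar, integrable_withDensity_iff_integrable_smul' (measurable_ofReal_energy u)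
      (ae_of_all _ fun _ => ENNReal.ofReal_lt_top)]
    refine hi.congr (ae_of_all _ fun x => ?_)
    simp only
    rw [ENNReal.toReal_ofReal (by positivity), smul_eq_mul]
  exact h.comp_measurable (measurable_ybar u)

lemma abs_arctan_le (x : ℝ) : |Real.arctan x| ≤ |x| := by
  have h : ∀ y : ℝ, 0 ≤ y → |Real.arctan y| ≤ y := by
    intro y hy
    rw [abs_of_nonneg (Real.arctan_nonneg.2 hy)]
    have h1 := Real.le_tan (Real.arctan_nonneg.2 hy) (Real.arctan_lt_pi_div_two y)
    rwa [Real.tan_arctan] at h1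
  rcases le_total 0 x with hx | hx
  · exact (h x hx).trans (le_abs_self x)
  · have := h (-x) (by linarith)
    rw [Real.arctan_neg, abs_neg] at this
    exact this.trans (neg_le_abs x)

lemma half_sin_two_arctan (x : ℝ) :
    1 / 2 * Real.sin (2 * Real.arctan x) = x / (1 + x ^ 2) := by
  have h0 : 0 < 1 + x ^ 2 := by positivity
  rw [Real.sin_two_mul, Real.sin_arctan, Real.cos_arctan]
  have h1 : Real.sqrt (1 + x ^ 2) * Real.sqrt (1 + x ^ 2) = 1 + x ^ 2 := Real.mul_self_sqrt h0.le
  have h2 : Real.sqrt (1 + x ^ 2) ≠ 0 := (Real.sqrt_pos.2 h0).ne'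
  field_simp
  rw [sq √(1 + x ^ 2), h1]

/-- The initial data define a point of `X`, and it satisfies the relation
`k_ξ = ½ sin v · q`. -/
lemma exists_initial : ∃ z : X, X.k z =ᵐ[volume] (fun ξ => H1.fn u (ybar u ξ)) ∧
    X.v z =ᵐ[volume] (fun ξ => 2 * Real.arctan (H1.dx u (ybar u ξ))) ∧
    X.q z =ᵐ[volume] (fun _ => 1) ∧
    X.dx z =ᵐ[volume] fun ξ => 1 / 2 * Real.sin (X.v z ξ) * X.q z ξ := by
  set w := H1.dx u with hw
  have mw : Measurable w := measurable_H1_dx u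
  have w2 : MemLp w 2 volume := memLp_H1_dx u
  have u2 : MemLp (H1.fn u) 2 volume := memLp_H1_fn u
  have hweak : IsWeakDeriv (H1.fn u) w := u.2
  obtain ⟨u', pu, eu⟩ := IsWeakDeriv.exists_isPrim (locallyIntegrable_of_memLp_two u2)
    (locallyIntegrable_of_memLp_two w2) hweak
  have u2' : MemLp u' 2 volume := (memLp_congr_ae eu).1 u2
  have iw : Integrable fun x => w x ^ 2 := w2.integrable_sq
  have hbd := pu.sq_le_integral u2' (e := fun x => |2 * (u' x * w x)|)
    (((u2'.integrable_mul w2).const_mul 2).abs) (ae_of_all _ fun x => le_rfl)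
  set B := ∫ x, |2 * (u' x * w x)| with hB
  have hk : MemLp (fun ξ => u' (ybar u ξ)) 2 volume := by
    refine memLp_two_comp_ybar u pu.continuous.measurable ?_
    refine (u2'.integrable_sq.add (iw.const_mul B)).mono'
      (((measurable_const.add (mw.pow_const 2)).mul
        (pu.continuous.measurable.pow_const 2)).aestronglyMeasurable) (ae_of_all _ fun x => ?_)
    -- `(1 + w²) u'² ≤ u'² + B w²`, as `B` bounds `u'²`.
    have h1 := mul_le_mul_of_nonneg_right (hbd x) (sq_nonneg (w x))
    rw [Real.norm_of_nonneg (by positivity)]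
    simp only [Pi.add_apply]
    linarith
  have md : Measurable fun x => w x / (1 + w x ^ 2) :=
    mw.div (measurable_const.add (mw.pow_const 2))
  have hd : MemLp (fun ξ => w (ybar u ξ) / (1 + w (ybar u ξ) ^ 2)) 2 volume := by
    refine memLp_two_comp_ybar u (p := fun x => w x / (1 + w x ^ 2)) md ?_
    refine iw.mono' (((measurable_const.add (mw.pow_const 2)).mul
      (md.pow_const 2)).aestronglyMeasurable) (ae_of_all _ fun x => ?_)
    rw [Real.norm_of_nonneg (by positivity), div_pow, ← hw]
    have h0 : 0 < 1 + w x ^ 2 := by positivity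
    have e : (1 + w x ^ 2) * (w x ^ 2 / (1 + w x ^ 2) ^ 2) = w x ^ 2 / (1 + w x ^ 2) := by
      field_simp
    rw [e, div_le_iff₀ h0]
    nlinarith [sq_nonneg (w x), sq_nonneg (w x ^ 2)]
  have hP : IsPrim (fun ξ => u' (ybar u ξ)) fun ξ => w (ybar u ξ) / (1 + w (ybar u ξ) ^ 2) := by
    have key : ∀ a b : ℝ, a ≤ b → u' (ybar u b) - u' (ybar u a)
        = ∫ ξ in a..b, w (ybar u ξ) / (1 + w (ybar u ξ) ^ 2) := by
      intro a b hab
      rw [integral_comp_ybar u (p := fun x => w x / (1 + w x ^ 2)) md hab, pu.eq]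
      refine intervalIntegral.integral_congr fun x _ => ?_
      have h0 : (1 + w x ^ 2) ≠ 0 := by positivity
      simp only [← hw]
      field_simp
    refine ⟨locallyIntegrable_of_memLp_two hd, fun a b => ?_⟩
    rcases le_total a b with h | h
    · exact key a b h
    · rw [intervalIntegral.integral_symm, ← key b a h]; ring
  have mv : Measurable fun x => 2 * Real.arctan (w x) := by fun_prop
  have hv : MemLp (fun ξ => 2 * Real.arctan (w (ybar u ξ))) 2 volume := by
    refine memLp_two_comp_ybar u (p := fun x => 2 * Real.arctan (w x)) mv ?_
    -- `(1 + w²) (2 arctan w)² ≤ 20 w²`, from `|arctan w| ≤ |w|` and `|arctan w| ≤ 2`.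
    refine (iw.const_mul 20).mono' (((measurable_const.add (mw.pow_const 2)).mul
      (mv.pow_const 2)).aestronglyMeasurable) (ae_of_all _ fun x => ?_)
    rw [Real.norm_of_nonneg (by positivity), ← hw]
    have h1 : Real.arctan (w x) ^ 2 ≤ w x ^ 2 := sq_le_sq.2 (abs_arctan_le _)
    have h2 : |Real.arctan (w x)| ≤ 2 := by
      rw [abs_le]
      have := Real.arctan_lt_pi_div_two (w x)
      have := Real.neg_pi_div_two_lt_arctan (w x)
      have := Real.pi_lt_four
      constructor <;> linarith
    have h3 : Real.arctan (w x) ^ 2 ≤ 4 := by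
      have := sq_le_sq.2 (h2.trans (le_abs_self 2)); linarith
    nlinarith [mul_le_mul_of_nonneg_left h3 (sq_nonneg (w x))]
  have hvi : MemLp (fun ξ => 2 * Real.arctan (w (ybar u ξ))) ∞ volume := by
    refine memLp_top_of_bound (mv.comp (measurable_ybar u)).aestronglyMeasurable Real.pi
      (ae_of_all _ fun ξ => ?_)
    have := Real.arctan_lt_pi_div_two (w (ybar u ξ))
    have := Real.neg_pi_div_two_lt_arctan (w (ybar u ξ))
    rw [Real.norm_eq_abs, abs_le]
    constructor <;> linarith
  obtain ⟨z, e1, e2, e3, e4⟩ := exists_X hk hd hP.isWeakDeriv hv hvi (memLp_top_const (1 : ℝ))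
  refine ⟨z, ?_, e3, e4, ?_⟩
  · have h := (quasiMeasurePreserving_ybar u).ae eu
    filter_upwards [e1, h] with ξ h1 h2
    rw [h1, h2]
  · filter_upwards [e2, e3, e4] with ξ h2 h3 h4
    rw [h2, h3, h4, mul_one, half_sin_two_arctan]

end InitialDatum

/-! ### Derivatives of integral functionals -/

/-- A functional `z ↦ ∫ a(z) q` is differentiable as soon as `a(z)` has a second order expansion
in `k` and `v` with square integrable coefficients. -/
lemma hasFDerivAt_integral_mul_q {a : X → ℝ → ℝ} {z : X} {a1 a2 : ℝ → ℝ} {C : ℝ} (hC : 0 ≤ C)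
    (h0 : Integrable (a z)) (h1 : MemLp a1 2 volume) (h2 : MemLp a2 2 volume)
    (hm : ∀ z', AEStronglyMeasurable (a z') volume)
    (hr : ∀ z', ‖z' - z‖ ≤ 1 → ∀ᵐ ξ, |a z' ξ - a z ξ
      - (a1 ξ * X.k (z' - z) ξ + a2 ξ * X.v (z' - z) ξ)|
        ≤ C * (X.k (z' - z) ξ ^ 2 + X.v (z' - z) ξ ^ 2)) :
    ∃ L : X →L[ℝ] ℝ, HasFDerivAt (fun z' => ∫ ξ, a z' ξ * X.q z' ξ) L z ∧
      ∀ δ, Integrable (fun ξ => a1 ξ * X.q z ξ * X.k δ ξ + a2 ξ * X.q z ξ * X.v δ ξ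
          + a z ξ * X.q δ ξ) ∧
        L δ = ∫ ξ, (a1 ξ * X.q z ξ * X.k δ ξ + a2 ξ * X.q z ξ * X.v δ ξ + a z ξ * X.q δ ξ) := by
  have mq := memLp_q z
  have b1 : MemLp (fun ξ => a1 ξ * X.q z ξ) 2 volume := mq.mul' (r := 2) h1
  have b2 : MemLp (fun ξ => a2 ξ * X.q z ξ) 2 volume := mq.mul' (r := 2) h2
  have i1 : ∀ δ, Integrable fun ξ => a1 ξ * X.q z ξ * X.k δ ξ := fun δ =>
    b1.integrable_mul (memLp_k δ)
  have i2 : ∀ δ, Integrable fun ξ => a2 ξ * X.q z ξ * X.v δ ξ := fun δ =>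
    b2.integrable_mul (memLp_v δ)
  have i3 : ∀ {b : ℝ → ℝ} (_ : Integrable b) (δ), Integrable fun ξ => b ξ * X.q δ ξ :=
    fun hb δ => hb.mul_of_top_left (memLp_q δ)
  have hI : ∀ δ, Integrable (fun ξ => a1 ξ * X.q z ξ * X.k δ ξ + a2 ξ * X.q z ξ * X.v δ ξ
          + a z ξ * X.q δ ξ) := fun δ => ((i1 δ).add (i2 δ)).add (i3 h0 δ)
  set L : X →L[ℝ] ℝ := (integralL2 _ b1).comp kL + (integralL2 _ b2).comp vL
    + (integralL _ h0).comp qL with hL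
  have eL : ∀ δ, L δ = ∫ ξ, (a1 ξ * X.q z ξ * X.k δ ξ + a2 ξ * X.q z ξ * X.v δ ξ
      + a z ξ * X.q δ ξ) := by
    intro δ
    have i12 : Integrable fun ξ => a1 ξ * X.q z ξ * X.k δ ξ + a2 ξ * X.q z ξ * X.v δ ξ :=
      (i1 δ).add (i2 δ)
    rw [integral_add i12 (i3 h0 δ), integral_add (i1 δ) (i2 δ)]
    simp only [hL, add_apply, ContinuousLinearMap.comp_apply,
      integralL2_apply, integralL_apply]
    rfl
  refine ⟨L, ?_, fun δ => ⟨hI δ, eL δ⟩⟩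
  set B : ℝ := 2 * (C * ‖z‖ + C + 1) + (∫ ξ, a1 ξ ^ 2) + ∫ ξ, a2 ξ ^ 2 with hB
  have key : ∀ z', ‖z' - z‖ ≤ 1 →
      |(∫ ξ, a z' ξ * X.q z' ξ) - (∫ ξ, a z ξ * X.q z ξ) - L (z' - z)| ≤ B * ‖z' - z‖ ^ 2 := by
    intro z' hz'
    set δ := z' - z with hδ
    have r := hr z' hz'
    have n0 := norm_nonneg δ
    have kx : Integrable fun ξ => X.k δ ξ ^ 2 := (memLp_k δ).integrable_sq
    have vx : Integrable fun ξ => X.v δ ξ ^ 2 := (memLp_v δ).integrable_sq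
    have l1 : Integrable fun ξ => a1 ξ * X.k δ ξ := h1.integrable_mul (memLp_k δ)
    have l2 : Integrable fun ξ => a2 ξ * X.v δ ξ := h2.integrable_mul (memLp_v δ)
    have ha' : Integrable (a z') := by
      have h3 : Integrable fun ξ => a z' ξ - a z ξ - (a1 ξ * X.k δ ξ + a2 ξ * X.v δ ξ) :=
        ((kx.add vx).const_mul C).mono'
          (((hm z').sub h0.1).sub (l1.add l2).1) r
      have h4 := (h3.add h0).add (l1.add l2)
      refine h4.congr (ae_of_all _ fun ξ => ?_)
      simp only [Pi.add_apply]; ring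
    have ia : Integrable fun ξ => a z' ξ * X.q z' ξ - a z ξ * X.q z ξ :=
      (i3 ha' z').sub (i3 h0 z)
    rw [← integral_sub (i3 ha' z') (i3 h0 z), eL, ← integral_sub ia (hI δ)]
    have hb : Integrable fun ξ => (C * ‖z‖ + C + 1) * (X.k δ ξ ^ 2 + X.v δ ξ ^ 2)
        + ‖δ‖ ^ 2 * (a1 ξ ^ 2 + a2 ξ ^ 2) :=
      ((kx.add vx).const_mul _).add ((h1.integrable_sq.add h2.integrable_sq).const_mul _)
    rw [← Real.norm_eq_abs]
    refine (norm_integral_le_of_norm_le hb ?_).trans ?_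
    · filter_upwards [r, ae_abs_q_le z, ae_abs_q_le δ, X.q_sub z' z] with ξ c1 c2 c3 c4
      set x := X.k δ ξ
      set y := X.v δ ξ
      set p := X.q δ ξ
      have c4' : X.q z' ξ = X.q z ξ + p := by
        have : p = X.q z' ξ - X.q z ξ := c4
        linarith
      rw [c4', Real.norm_eq_abs]
      set R := a z' ξ - a z ξ - (a1 ξ * x + a2 ξ * y) with hR
      have e : a z' ξ * (X.q z ξ + p) - a z ξ * X.q z ξ
          - (a1 ξ * X.q z ξ * x + a2 ξ * X.q z ξ * y + a z ξ * p)
          = R * X.q z ξ + (R + a1 ξ * x + a2 ξ * y) * p := by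
        rw [hR]; ring
      rw [e]
      have s0 : 0 ≤ x ^ 2 + y ^ 2 := by positivity
      have t1 : |R * X.q z ξ| ≤ C * (x ^ 2 + y ^ 2) * ‖z‖ := by
        rw [abs_mul]; exact mul_le_mul c1 c2 (abs_nonneg _) (by positivity)
      have t2 : |R * p| ≤ C * (x ^ 2 + y ^ 2) * 1 := by
        rw [abs_mul]; exact mul_le_mul c1 (c3.trans hz') (abs_nonneg _) (by positivity)
      -- The cross terms are integrable only after the product `|b| |w|` of square integrable
      -- functions has been split, and the weight `‖δ‖` keeps both halves of second order.
      have t3 : ∀ b w : ℝ, |b * w * p| ≤ ‖δ‖ ^ 2 * b ^ 2 + w ^ 2 := by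
        intro b w
        have h5 : |b * w * p| ≤ |b| * |w| * ‖δ‖ := by
          rw [abs_mul, abs_mul]; gcongr
        have h6 := sq_nonneg (‖δ‖ * |b| - |w|)
        have h7 := sq_abs b
        have h8 := sq_abs w
        nlinarith [mul_nonneg (mul_nonneg (abs_nonneg b) (abs_nonneg w)) n0]
      have e2 : R * X.q z ξ + (R + a1 ξ * x + a2 ξ * y) * p
          = R * X.q z ξ + R * p + a1 ξ * x * p + a2 ξ * y * p := by ring
      rw [e2]
      have u1 := abs_add_le (R * X.q z ξ + R * p + a1 ξ * x * p) (a2 ξ * y * p)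
      have u2 := abs_add_le (R * X.q z ξ + R * p) (a1 ξ * x * p)
      have u3 := abs_add_le (R * X.q z ξ) (R * p)
      have v1 := t3 (a1 ξ) x
      have v2 := t3 (a2 ξ) y
      linarith
    · have s1 : Integrable fun ξ => X.k δ ξ ^ 2 + X.v δ ξ ^ 2 := kx.add vx
      have s2 : Integrable fun ξ => a1 ξ ^ 2 + a2 ξ ^ 2 := h1.integrable_sq.add h2.integrable_sq
      rw [integral_add (s1.const_mul _) (s2.const_mul _), integral_const_mul,
        integral_const_mul, integral_add kx vx, integral_add h1.integrable_sq h2.integrable_sq,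
        integral_sq_eq (memLp_k δ), integral_sq_eq (memLp_v δ)]
      have w1 : lpNorm (X.k δ) 2 volume ^ 2 ≤ ‖δ‖ ^ 2 :=
        pow_le_pow_left₀ lpNorm_nonneg (lpNorm_k_le δ) 2
      have w2 : lpNorm (X.v δ) 2 volume ^ 2 ≤ ‖δ‖ ^ 2 :=
        pow_le_pow_left₀ lpNorm_nonneg (lpNorm_v_le δ) 2
      have w3 : 0 ≤ C * ‖z‖ + C + 1 := by positivity
      have w4 := mul_le_mul_of_nonneg_left (add_le_add w1 w2) w3
      rw [hB]; linarith
  rw [hasFDerivAt_iff_isLittleO]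
  refine Asymptotics.IsBigO.trans_isLittleO (g := fun z' => ‖z' - z‖ ^ 2) ?_
    (Asymptotics.isLittleO_pow_sub_sub z one_lt_two)
  refine Asymptotics.IsBigO.of_bound B ?_
  filter_upwards [Metric.closedBall_mem_nhds z one_pos] with z' hz'
  rw [Metric.mem_closedBall, dist_eq_norm] at hz'
  rw [Real.norm_of_nonneg (by positivity : (0 : ℝ) ≤ ‖z' - z‖ ^ 2)]
  exact key z' hz'

/-- The integral over the line of the derivative of an integrable function vanishes. -/
lemma IsPrim.integral_eq_zero {u w : ℝ → ℝ} (h : IsPrim u w) (hu : Integrable u)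
    (hw : Integrable w) : ∫ x, w x = 0 := by
  have t1 : Tendsto u atTop (𝓝 (u 0 + ∫ x in Ioi (0 : ℝ), w x)) := by
    have := (intervalIntegral_tendsto_integral_Ioi 0 hw.integrableOn tendsto_id).const_add (u 0)
    exact this.congr fun x => (h.eq_add 0 x).symm
  have t2 : Tendsto u atBot (𝓝 (u 0 - ∫ x in Iic (0 : ℝ), w x)) := by
    have := (intervalIntegral_tendsto_integral_Iic 0 hw.integrableOn tendsto_id).const_sub (u 0)
    refine this.congr fun x => ?_
    have := h.eq x 0
    simp only [id]; linarith
  have z1 := (hu.integrableAtFilter atTop).eq_zero_of_tendsto (fun s hs => by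
    obtain ⟨b, hb⟩ := mem_atTop_sets.1 hs
    exact top_unique ((Real.volume_Ici (a := b)).symm.trans_le (measure_mono hb))) t1
  have z2 := (hu.integrableAtFilter atBot).eq_zero_of_tendsto (fun s hs => by
    obtain ⟨b, hb⟩ := mem_atBot_sets.1 hs
    exact top_unique ((Real.volume_Iic (a := b)).symm.trans_le (measure_mono hb))) t2
  have := intervalIntegral.integral_Iic_add_Ioi (b := (0 : ℝ)) hw.integrableOn hw.integrableOn
  linarith

lemma abs_cos_taylor (v y : ℝ) : |Real.cos (v + y) - Real.cos v + y * Real.sin v| ≤ y ^ 2 := by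
  have hd : ∀ s : ℝ, HasDerivAt (fun s => Real.cos (v + s) + s * Real.sin v)
      (-Real.sin (v + s) + Real.sin v) s := by
    intro s
    have h1 := ((hasDerivAt_id s).const_add v).cos
    have h2 := (hasDerivAt_id s).mul_const (Real.sin v)
    simpa using! h1.add h2
  have := (convex_uIcc 0 y).norm_image_sub_le_of_norm_hasDerivWithin_le (C := |y|)
    (fun s _ => (hd s).hasDerivWithinAt) (fun s hs => by
      rw [Real.norm_eq_abs, show -Real.sin (v + s) + Real.sin v
        = -(Real.sin (v + s) - Real.sin v) by ring, abs_neg]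
      refine (abs_sin_sub_sin_le _ _).trans ?_
      have h3 := abs_sub_left_of_mem_uIcc hs
      simpa using h3) left_mem_uIcc right_mem_uIcc
  rw [Real.norm_eq_abs, Real.norm_eq_abs] at this
  simp only [add_zero, zero_mul, sub_zero] at this
  rw [show |y| * |y| = y ^ 2 by rw [← sq, sq_abs]] at this
  rwa [show Real.cos (v + y) - Real.cos v + y * Real.sin v
    = Real.cos (v + y) + y * Real.sin v - Real.cos v by ring]

lemma abs_sin_taylor (v y : ℝ) : |Real.sin (v + y) - Real.sin v - y * Real.cos v| ≤ y ^ 2 := by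
  have := abs_cos_taylor (v - Real.pi / 2) y
  rw [Real.cos_sub_pi_div_two, Real.sin_sub_pi_div_two,
    show v - Real.pi / 2 + y = v + y - Real.pi / 2 by ring, Real.cos_sub_pi_div_two] at this
  rwa [mul_neg, ← sub_eq_add_neg] at this

/-! ### Conservation laws -/

/-- The relation `k_ξ = ½ sin v · q`, which the flow preserves. -/
def Compat (z : X) : Prop :=
  X.dx z =ᵐ[volume] fun ξ => 1 / 2 * Real.sin (X.v z ξ) * X.q z ξ

/-- The integral over `S` of the defect `k_ξ - ½ sin v · q`. -/
def defect (S : Set ℝ) (z : X) : ℝ :=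
  (∫ ξ, S.indicator (fun _ => (1 : ℝ)) ξ * X.dx z ξ)
    - ∫ ξ, S.indicator (fun _ => (1 : ℝ)) ξ * (1 / 2 * Real.sin (X.v z ξ)) * X.q z ξ

/-- The energy `∫ (k² cos²(v/2) + sin²(v/2)) q`. -/
def energy (z : X) : ℝ :=
  ∫ ξ, (X.k z ξ ^ 2 * (1 + Real.cos (X.v z ξ)) + (1 - Real.cos (X.v z ξ))) / 2 * X.q z ξ

/-- The time derivatives of `k_ξ` and of `½ sin v · q` along the system coincide; `G`, `F` and `P`
stand for the two local coefficients and `P̃`. -/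
lemma defect_rate (G F P v q : ℝ) :
    (G * Real.cos (v / 2) ^ 2 + 1 / 2 * (F * Real.sin (v / 2) ^ 2)) * q
      - Real.cos (v / 2) ^ 2 * q * P
    = 1 / 2 * Real.cos v * q * (2 * ((G - P) * Real.cos (v / 2) ^ 2) - F * Real.sin (v / 2) ^ 2)
      + 1 / 2 * Real.sin v * (q * (1 / 2 * (F * Real.sin v) + Real.sin v * (G - P))) := by
  rw [cos_half_sq, sin_half_sq]
  have h := Real.sin_sq_add_cos_sq v
  linear_combination (-(q * (G - P) / 2) - q * F / 4) * h

/-- The time derivative of the energy density is `-2 (P̃ k)_ξ + (k² F + 2 G) k_ξ`, an exact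
derivative in `ξ`, once `k_ξ = ½ sin v · q` and `P̃_ξ = cos²(v/2) q P̃_x` are inserted. -/
lemma energy_rate (G F P Px k v q : ℝ) :
    k * (1 + Real.cos v) * q * (-Px)
      + (1 - k ^ 2) * Real.sin v / 2 * q
        * (2 * ((G - P) * Real.cos (v / 2) ^ 2) - F * Real.sin (v / 2) ^ 2)
      + (k ^ 2 * (1 + Real.cos v) + (1 - Real.cos v)) / 2
        * (q * (1 / 2 * (F * Real.sin v) + Real.sin v * (G - P)))
    = -2 * (1 / 2 * Real.sin v * q * P + k * (Real.cos (v / 2) ^ 2 * q * Px))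
      + (k ^ 2 * F + 2 * G) * (1 / 2 * Real.sin v * q) := by
  rw [cos_half_sq, sin_half_sq]
  ring

lemma measurable_indicator_one {S : Set ℝ} (hS : MeasurableSet S) :
    Measurable (S.indicator fun _ => (1 : ℝ)) := measurable_const.indicator hS

lemma abs_indicator_one_le (S : Set ℝ) (ξ : ℝ) : |S.indicator (fun _ => (1 : ℝ)) ξ| ≤ 1 := by
  by_cases h : ξ ∈ S <;> simp [h]

lemma memLp_indicator_one {S : Set ℝ} (hS : MeasurableSet S) (hμ : volume S ≠ (∞ : ℝ≥0∞))
    (p : ℝ≥0∞) : MemLp (S.indicator fun _ => (1 : ℝ)) p volume :=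
  memLp_indicator_const p hS 1 (Or.inr hμ)

section

variable (hlam : 0 < lam) (hf : ContDiff ℝ ∞ f) (hg : ContDiff ℝ ∞ g) (hg0 : g 0 = 0)

include hlam hf hg hg0

/-- The defect is stationary under the flow. -/
lemma exists_hasFDerivAt_defect (hm : 0 < m) {t : ℝ} (ht : 0 ≤ t) {z : X} (h : AdmX M m z)
    {S : Set ℝ} (hS : MeasurableSet S) (hμ : volume S ≠ (∞ : ℝ≥0∞)) :
    ∃ L : X →L[ℝ] ℝ, HasFDerivAt (defect S) L z ∧ L (field lam f g t z) = 0 := by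
  set χ : ℝ → ℝ := S.indicator fun _ => (1 : ℝ) with hχ
  have mχ : Measurable χ := measurable_indicator_one hS
  have χ2 : MemLp χ 2 volume := memLp_indicator_one hS hμ 2
  have χ1 : MemLp χ 1 volume := memLp_indicator_one hS hμ 1
  have h0 : Integrable fun ξ => χ ξ * (1 / 2 * Real.sin (X.v z ξ)) := by
    refine (memLp_one_iff_integrable.1 χ1).norm.mono'
      (by have := measurable_v z; fun_prop) (ae_of_all _ fun ξ => ?_)
    rw [norm_mul]
    have h3 : ‖1 / 2 * Real.sin (X.v z ξ)‖ ≤ 1 := by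
      rw [Real.norm_eq_abs, abs_mul, abs_of_pos one_half_pos]
      linarith [Real.abs_sin_le_one (X.v z ξ)]
    exact mul_le_of_le_one_right (norm_nonneg _) h3
  have h2 : MemLp (fun ξ => χ ξ * (1 / 2 * Real.cos (X.v z ξ))) 2 volume := by
    refine χ2.mono (by have := measurable_v z; fun_prop) (ae_of_all _ fun ξ => ?_)
    rw [norm_mul]
    have h3 : ‖1 / 2 * Real.cos (X.v z ξ)‖ ≤ 1 := by
      rw [Real.norm_eq_abs, abs_mul, abs_of_pos one_half_pos]
      linarith [Real.abs_cos_le_one (X.v z ξ)]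
    exact mul_le_of_le_one_right (norm_nonneg _) h3
  obtain ⟨L, hL, eL⟩ := hasFDerivAt_integral_mul_q
    (a := fun z ξ => χ ξ * (1 / 2 * Real.sin (X.v z ξ))) (z := z) (a1 := fun _ => 0)
    (a2 := fun ξ => χ ξ * (1 / 2 * Real.cos (X.v z ξ))) one_pos.le h0 MemLp.zero h2
    (fun z' => by have := measurable_v z'; fun_prop) (fun z' _ => by
      filter_upwards [X.v_sub z' z] with ξ e
      have e1 : X.v z' ξ = X.v z ξ + X.v (z' - z) ξ := by rw [e]; ring
      rw [e1]
      set y := X.v (z' - z) ξ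
      have h4 := abs_sin_taylor (X.v z ξ) y
      rw [show χ ξ * (1 / 2 * Real.sin (X.v z ξ + y)) - χ ξ * (1 / 2 * Real.sin (X.v z ξ))
        - (0 * X.k (z' - z) ξ + χ ξ * (1 / 2 * Real.cos (X.v z ξ)) * y)
        = χ ξ * (1 / 2 * (Real.sin (X.v z ξ + y) - Real.sin (X.v z ξ)
          - y * Real.cos (X.v z ξ))) by ring, abs_mul, abs_mul, abs_of_pos (one_half_pos : (0 : ℝ) < 1 / 2)]
      have h5 := abs_indicator_one_le S ξ
      have h6 := mul_le_mul h5 h4 (abs_nonneg _) one_pos.le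
      nlinarith [sq_nonneg (X.k (z' - z) ξ), sq_nonneg y])
  refine ⟨(integralL2 χ χ2).comp dxL - L, ?_, ?_⟩
  · have h5 := ((integralL2 χ χ2).comp dxL).hasFDerivAt (x := z)
    have h6 := HasFDerivAt.fun_sub (𝕜 := ℝ) (E := X) (F := ℝ) h5 hL
    simp only [ContinuousLinearMap.comp_apply, integralL2_apply] at h6
    exact h6
  · obtain ⟨i1, e1⟩ := eL (field lam f g t z)
    obtain ⟨r1, r2, r3⟩ := field_isRhs hlam hf hg hg0 hm ht h
    have r4 := dx_field hlam hf hg hg0 hm ht h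
    rw [sub_apply, e1, ContinuousLinearMap.comp_apply, integralL2_apply, sub_eq_zero]
    refine integral_congr_ae ?_
    filter_upwards [r2, r3, r4] with ξ s2 s3 s4
    change χ ξ * X.dx (field lam f g t z) ξ = _
    rw [s2, s3, s4, rhsDx, rhsV_eq, rhsQ_eq, density_eq, jac,
      defect_rate (coefG lam g t (X.k z ξ)) (coefF lam f t (X.k z ξ))]
    ring

omit hf hg hg0 hlam in
lemma integrable_energy_density (z : X) : Integrable fun ξ =>
    (X.k z ξ ^ 2 * (1 + Real.cos (X.v z ξ)) + (1 - Real.cos (X.v z ξ))) / 2 := by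
  have mk := measurable_k z
  have mv := measurable_v z
  refine ((memLp_k z).integrable_sq.add (memLp_v z).integrable_sq).mono' (by fun_prop)
    (ae_of_all _ fun ξ => ?_)
  have h1 := Real.cos_le_one (X.v z ξ)
  have h2 := Real.neg_one_le_cos (X.v z ξ)
  have h3 := sin_half_sq_le (X.v z ξ)
  rw [sin_half_sq] at h3
  have h4 := sq_nonneg (X.k z ξ)
  have h5 : 0 ≤ X.k z ξ ^ 2 * (1 + Real.cos (X.v z ξ)) := mul_nonneg h4 (by linarith)
  rw [Real.norm_of_nonneg (by linarith)]
  simp only [Pi.add_apply]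
  nlinarith

omit hf hg hg0 hlam in
lemma exists_hasFDerivAt_energy (z : X) :
    ∃ L : X →L[ℝ] ℝ, HasFDerivAt energy L z ∧ ∀ δ, 
      Integrable (fun ξ => X.k z ξ * (1 + Real.cos (X.v z ξ)) * X.q z ξ * X.k δ ξ
        + (1 - X.k z ξ ^ 2) * Real.sin (X.v z ξ) / 2 * X.q z ξ * X.v δ ξ
        + (X.k z ξ ^ 2 * (1 + Real.cos (X.v z ξ)) + (1 - Real.cos (X.v z ξ))) / 2 * X.q δ ξ) ∧
      L δ = ∫ ξ, (X.k z ξ * (1 + Real.cos (X.v z ξ)) * X.q z ξ * X.k δ ξ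
        + (1 - X.k z ξ ^ 2) * Real.sin (X.v z ξ) / 2 * X.q z ξ * X.v δ ξ
        + (X.k z ξ ^ 2 * (1 + Real.cos (X.v z ξ)) + (1 - Real.cos (X.v z ξ))) / 2 * X.q δ ξ) := by
  have mk := measurable_k z
  have mv := measurable_v z
  set K : ℝ := 2 * ‖z‖ with hK
  have hK0 : 0 ≤ K := by positivity
  have h1 : MemLp (fun ξ => X.k z ξ * (1 + Real.cos (X.v z ξ))) 2 volume := by
    refine (memLp_k z).of_le_mul (c := 2) (by fun_prop) (ae_of_all _ fun ξ => ?_)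
    rw [norm_mul, mul_comm 2]
    have h3 : ‖1 + Real.cos (X.v z ξ)‖ ≤ 2 := by
      rw [Real.norm_eq_abs, abs_le]
      constructor <;> linarith [Real.cos_le_one (X.v z ξ), Real.neg_one_le_cos (X.v z ξ)]
    gcongr
  have h2 : MemLp (fun ξ => (1 - X.k z ξ ^ 2) * Real.sin (X.v z ξ) / 2) 2 volume := by
    refine (memLp_v z).of_le_mul (c := 1 + K ^ 2) (by fun_prop) ?_
    filter_upwards [ae_abs_k_le z] with ξ hk
    rw [norm_div, norm_mul, Real.norm_eq_abs, Real.norm_eq_abs, Real.norm_eq_abs, Real.norm_eq_abs,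
      abs_two]
    have h3 : |Real.sin (X.v z ξ)| ≤ |X.v z ξ| := Real.abs_sin_le_abs
    have h4 : X.k z ξ ^ 2 ≤ K ^ 2 := sq_le_sq' (by linarith [neg_abs_le (X.k z ξ)])
      ((le_abs_self _).trans hk)
    have h5 : |1 - X.k z ξ ^ 2| ≤ 1 + K ^ 2 := by
      rw [abs_le]; constructor <;> nlinarith [sq_nonneg (X.k z ξ)]
    have h6 := mul_le_mul h5 h3 (abs_nonneg _) (by positivity)
    have h7 : 0 ≤ |1 - X.k z ξ ^ 2| * |Real.sin (X.v z ξ)| := by positivity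
    linarith
  refine hasFDerivAt_integral_mul_q (a := fun z ξ =>
    (X.k z ξ ^ 2 * (1 + Real.cos (X.v z ξ)) + (1 - Real.cos (X.v z ξ))) / 2)
    (C := K ^ 2 + K + 2) (by positivity)
    (integrable_energy_density z) h1 h2 (fun z' => by
      have := measurable_k z'; have := measurable_v z'; fun_prop) ?_
  intro z' _
  filter_upwards [X.k_sub z' z, X.v_sub z' z, ae_abs_k_le z] with ξ e1 e2 hk
  have e1' : X.k z' ξ = X.k z ξ + X.k (z' - z) ξ := by rw [e1]; ring
  have e2' : X.v z' ξ = X.v z ξ + X.v (z' - z) ξ := by rw [e2]; ring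
  rw [e1', e2']
  set k := X.k z ξ
  set v := X.v z ξ
  set x := X.k (z' - z) ξ
  set y := X.v (z' - z) ξ
  have t1 := abs_cos_taylor v y
  have t2 : |Real.cos (v + y) - Real.cos v| ≤ |y| := by
    have := abs_cos_sub_cos_le (v + y) v; simpa using this
  have t3 : |1 + Real.cos (v + y)| ≤ 2 := by
    rw [abs_le]
    constructor <;> linarith [Real.cos_le_one (v + y), Real.neg_one_le_cos (v + y)]
  set c := Real.cos (v + y) - Real.cos v + y * Real.sin v with hc
  have h4 : k ^ 2 ≤ K ^ 2 := sq_le_sq' (by linarith [neg_abs_le k]) ((le_abs_self _).trans hk)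
  have e3 : ((k + x) ^ 2 * (1 + Real.cos (v + y)) + (1 - Real.cos (v + y))) / 2
      - (k ^ 2 * (1 + Real.cos v) + (1 - Real.cos v)) / 2
      - (k * (1 + Real.cos v) * x + (1 - k ^ 2) * Real.sin v / 2 * y)
      = k ^ 2 / 2 * c + k * (x * (Real.cos (v + y) - Real.cos v))
        + x ^ 2 / 2 * (1 + Real.cos (v + y)) + -(1 / 2) * c := by
    rw [hc]; ring
  rw [e3]
  have u1 : |k ^ 2 / 2 * c| ≤ K ^ 2 / 2 * y ^ 2 := by
    rw [abs_mul, abs_of_nonneg (by positivity : 0 ≤ k ^ 2 / 2)]; gcongr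
  have u2 : |k * (x * (Real.cos (v + y) - Real.cos v))| ≤ K * ((x ^ 2 + y ^ 2) / 2) := by
    rw [abs_mul]
    refine mul_le_mul hk ?_ (abs_nonneg _) hK0
    rw [abs_mul]
    have h7 := mul_le_mul_of_nonneg_left t2 (abs_nonneg x)
    nlinarith [sq_nonneg (|x| - |y|), sq_abs x, sq_abs y]
  have u3 : |x ^ 2 / 2 * (1 + Real.cos (v + y))| ≤ x ^ 2 / 2 * 2 := by
    rw [abs_mul, abs_of_nonneg (by positivity : 0 ≤ x ^ 2 / 2)]; gcongr
  have u4 : |-(1 / 2) * c| ≤ 1 / 2 * y ^ 2 := by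
    rw [abs_mul, abs_neg, abs_of_pos one_half_pos]; gcongr
  have w1 := abs_add_le (k ^ 2 / 2 * c + k * (x * (Real.cos (v + y) - Real.cos v))
        + x ^ 2 / 2 * (1 + Real.cos (v + y))) (-(1 / 2) * c)
  have w2 := abs_add_le (k ^ 2 / 2 * c + k * (x * (Real.cos (v + y) - Real.cos v)))
        (x ^ 2 / 2 * (1 + Real.cos (v + y)))
  have w3 := abs_add_le (k ^ 2 / 2 * c) (k * (x * (Real.cos (v + y) - Real.cos v)))
  nlinarith [mul_nonneg (sq_nonneg K) (sq_nonneg x), mul_nonneg (sq_nonneg K) (sq_nonneg y),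
    mul_nonneg hK0 (sq_nonneg x), mul_nonneg hK0 (sq_nonneg y), sq_nonneg x, sq_nonneg y]

lemma Adm.memLp_Pt {k v q : ℝ → ℝ} (hm : 0 < m) {t : ℝ} (ht : 0 ≤ t) (h : Adm M m k v q) :
    MemLp (Pt lam f g t k v q) 2 volume := by
  obtain ⟨C, hC, H⟩ := exists_rhs_pair hlam hf hg hg0 t M hm
  have hb := H t ⟨ht, le_rfl⟩ t ⟨ht, le_rfl⟩ 0 _ _ _ _ _ _ h h ⟨by simp, by simp, by simp, by simp⟩
  obtain ⟨w2, -, -, -⟩ := withConv_bound (half_pos hm) h.measurable_size h.memLp_size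
    h.memLp_size_top
  refine w2.of_le_mul (c := C)
    (h.isPrim_Pt hlam hf hg hg0 hm ht).continuous.aestronglyMeasurable ?_
  filter_upwards [hb] with ξ hξ
  exact hξ.1.2.1.trans (mul_le_mul_of_nonneg_left (le_abs_self _) hC)

/-- The energy is stationary under the flow: its rate of change is the integral of the derivative
of `-2 k P̃ + ∫₀ᵏ (y² F(y) + 2 G(y)) dy`. -/
lemma energy_stationary (hm : 0 < m) {t : ℝ} (ht : 0 ≤ t) {z : X} (h : AdmX M m z)
    (hc : Compat z) : ∃ L : X →L[ℝ] ℝ, HasFDerivAt energy L z ∧ L (field lam f g t z) = 0 := by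
  obtain ⟨L, hL, eL⟩ := exists_hasFDerivAt_energy z
  refine ⟨L, hL, ?_⟩
  obtain ⟨i1, e1⟩ := eL (field lam f g t z)
  obtain ⟨r1, r2, r3⟩ := field_isRhs hlam hf hg hg0 hm ht h
  obtain ⟨k', pk, ek⟩ := IsWeakDeriv.exists_isPrim (locallyIntegrable_of_memLp_two (memLp_k z))
    (locallyIntegrable_of_memLp_two (memLp_dx z)) (isWeakDeriv_X z)
  have k2 : MemLp k' 2 volume := (memLp_congr_ae ek).1 (memLp_k z)
  have pP := h.isPrim_Pt hlam hf hg hg0 hm ht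
  have P2 := Adm.memLp_Pt hlam hf hg hg0 hm ht h
  set P := Pt lam f g t (X.k z) (X.v z) (X.q z) with hP
  set φ : ℝ → ℝ := fun y => y ^ 2 * coefF lam f t y + 2 * coefG lam g t y with hφ
  have cφ : Continuous φ := by
    have := continuous_coefF lam hf t
    have := continuous_coefG lam hg t
    fun_prop
  set Φ : ℝ → ℝ := fun y => ∫ s in (0 : ℝ)..y, φ s with hΦ
  have dΦ : ∀ y, HasDerivAt Φ (φ y) y := fun y => cφ.integral_hasStrictDerivAt 0 y |>.hasDerivAt
  obtain ⟨C1, hC1, HG⟩ := exists_coefG_bound hlam hg hg0 t M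
  obtain ⟨C2, hC2, HF⟩ := exists_coefF_bound hlam hf t M
  have tt : t ∈ Icc 0 t := ⟨ht, le_rfl⟩
  have bΦ : ∀ y, |y| ≤ M → |Φ y| ≤ (M * C2 + 2 * C1) * y ^ 2 := by
    intro y hy
    have hM : 0 ≤ M := (abs_nonneg y).trans hy
    have := intervalIntegral.norm_integral_le_of_norm_le_const (f := φ) (a := 0) (b := y)
      (C := (M * C2 + 2 * C1) * |y|) (fun s hs => by
        have hs1 : |s| ≤ |y| := by
          have := abs_sub_left_of_mem_uIcc (uIoc_subset_uIcc hs); simpa using this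
        have hs2 := hs1.trans hy
        have b1 := (HG t tt t tt s s hs2 hs2).1
        have b2 := (HF t tt t tt s s hs2 hs2).1
        rw [Real.norm_eq_abs]
        calc |φ s| ≤ |s ^ 2 * coefF lam f t s| + |2 * coefG lam g t s| := abs_add_le _ _
          _ = |s| * |s| * |coefF lam f t s| + 2 * |coefG lam g t s| := by
              rw [abs_mul, abs_mul, abs_two, abs_pow, sq]
          _ ≤ |s| * M * C2 + 2 * (C1 * |s|) := by gcongr
          _ = (M * C2 + 2 * C1) * |s| := by ring
          _ ≤ _ := by gcongr)
    rw [sub_zero, Real.norm_eq_abs, mul_assoc, ← sq, sq_abs] at this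
    exact this
  have pΨ := ((pk.mul pP).const_mul (-2)).add (pk.comp dΦ cφ)
  have iΨ : Integrable fun x => -2 * (k' x * P x) + Φ (k' x) := by
    refine ((k2.integrable_mul P2).const_mul (-2)).add ?_
    refine (k2.integrable_sq.const_mul (M * C2 + 2 * C1)).mono'
      ((continuous_iff_continuousAt.2 fun y => (dΦ y).continuousAt).comp
        pk.continuous).aestronglyMeasurable ?_
    filter_upwards [ek, h.abs_k_le] with ξ a b
    rw [a] at b
    exact bΦ _ b
  have ed : (fun ξ => X.k z ξ * (1 + Real.cos (X.v z ξ)) * X.q z ξ * X.k (field lam f g t z) ξ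
        + (1 - X.k z ξ ^ 2) * Real.sin (X.v z ξ) / 2 * X.q z ξ * X.v (field lam f g t z) ξ
        + (X.k z ξ ^ 2 * (1 + Real.cos (X.v z ξ)) + (1 - Real.cos (X.v z ξ))) / 2
          * X.q (field lam f g t z) ξ) =ᵐ[volume]
      fun x => -2 * (X.dx z x * P x + k' x * (jac (X.v z) (X.q z) x
        * Px lam f g t (X.k z) (X.v z) (X.q z) x)) + φ (k' x) * X.dx z x := by
    filter_upwards [r1, r2, r3, ek, hc] with ξ s1 s2 s3 s4 s5
    rw [s1, s2, s3, ← s4, s5, rhsV_eq, rhsQ_eq, rhsK, energy_rate, jac]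
  rw [e1, integral_congr_ae ed]
  exact pΨ.integral_eq_zero iΨ (i1.congr ed)

end

/-! ### A priori bounds -/

/-- The relation holds when the defect vanishes on all sets of finite measure; this makes it a family
of scalar conservation laws. -/
lemma compat_iff (z : X) : Compat z ↔ ∀ S : Set ℝ, MeasurableSet S → volume S ≠ (∞ : ℝ≥0∞) →
    defect S z = 0 := by
  have hs : MemLp (fun ξ => 1 / 2 * Real.sin (X.v z ξ) * X.q z ξ) ∞ volume := by
    refine (memLp_q z).mono (by
      have := measurable_v z; have := measurable_q z; fun_prop) (ae_of_all _ fun ξ => ?_)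
    rw [norm_mul]
    refine mul_le_of_le_one_left (norm_nonneg _) ?_
    rw [Real.norm_eq_abs, abs_mul, abs_of_pos (one_half_pos : (0 : ℝ) < 1 / 2)]
    linarith [Real.abs_sin_le_one (X.v z ξ)]
  have fin : ∀ S : Set ℝ, volume S < (∞ : ℝ≥0∞) → IsFiniteMeasure (volume.restrict S) :=
    fun S h => ⟨by simpa using h⟩
  have i1 : ∀ S : Set ℝ, MeasurableSet S → volume S < (∞ : ℝ≥0∞) →
      IntegrableOn (X.dx z) S := fun S _ h => by
    have := fin S h
    exact ((memLp_dx z).restrict S).integrable (by norm_num)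
  have i2 : ∀ S : Set ℝ, MeasurableSet S → volume S < (∞ : ℝ≥0∞) →
      IntegrableOn (fun ξ => 1 / 2 * Real.sin (X.v z ξ) * X.q z ξ) S := fun S _ h => by
    have := fin S h
    exact (hs.restrict S).integrable (by simp)
  have e : ∀ S : Set ℝ, MeasurableSet S → defect S z = (∫ ξ in S, X.dx z ξ)
      - ∫ ξ in S, 1 / 2 * Real.sin (X.v z ξ) * X.q z ξ := by
    intro S hS
    rw [defect, ← integral_indicator hS, ← integral_indicator hS]
    congr 1 <;>
    · refine integral_congr_ae (ae_of_all _ fun ξ => ?_)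
      by_cases hξ : ξ ∈ S <;> simp [hξ]
  constructor
  · intro h S hS _
    rw [e S hS, sub_eq_zero]
    exact setIntegral_congr_ae hS (h.mono fun ξ hξ _ => hξ)
  · intro h
    refine ae_eq_of_forall_setIntegral_eq_of_sigmaFinite i1 i2 fun S hS hμ => ?_
    rw [← sub_eq_zero, ← e S hS]
    exact h S hS hμ.ne

/-- A curve in the region where `q` is bounded below by a positive constant, solving the
differential equation on `[0, T]`. -/
structure IsCurve (lam : ℝ) (f g : ℝ → ℝ) (T : ℝ) (α : ℝ → X) : Prop where
  deriv : ∀ t ∈ Icc 0 T, HasDerivWithinAt α (field lam f g t (α t)) (Icc 0 T) t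
  pos : ∀ t ∈ Icc 0 T, ∃ m, 0 < m ∧ ∀ᵐ ξ, m ≤ X.q (α t) ξ

namespace IsCurve

variable {α : ℝ → X}

lemma exists_admX (h : IsCurve lam f g T α) {t : ℝ} (ht : t ∈ Icc 0 T) :
    ∃ M m, 0 < m ∧ AdmX M m (α t) := by
  obtain ⟨m, hm, hq⟩ := h.pos t ht
  exact ⟨_, m, hm, admX_of_norm_le hm le_rfl hq⟩

lemma continuousOn (h : IsCurve lam f g T α) : ContinuousOn α (Icc 0 T) :=
  fun t ht => HasDerivWithinAt.continuousWithinAt (F := X) (h.deriv t ht)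

lemma deriv_right (h : IsCurve lam f g T α) {t : ℝ} (ht : t ∈ Ico 0 T) :
    HasDerivWithinAt α (field lam f g t (α t)) (Ici t) t :=
  HasDerivWithinAt.mono_of_mem_nhdsWithin (F := X) (h.deriv t (Ico_subset_Icc_self ht))
    (Icc_mem_nhdsGE_of_mem ht)

/-- A functional whose derivative annihilates the vector field is constant along a curve. -/
lemma eq_of_stationary (h : IsCurve lam f g T α) {Φ : X → ℝ}
    (hΦ : ∀ t ∈ Icc 0 T, ∃ L : X →L[ℝ] ℝ, HasFDerivAt Φ L (α t) ∧ L (field lam f g t (α t)) = 0)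
    {t : ℝ} (ht : t ∈ Icc 0 T) : Φ (α t) = Φ (α 0) := by
  refine constant_of_has_deriv_right_zero (f := Φ ∘ α) ?_ ?_ t ht
  · intro s hs
    obtain ⟨L, hL, -⟩ := hΦ s hs
    exact hL.continuousAt.comp_continuousWithinAt (h.continuousOn s hs)
  · intro s hs
    obtain ⟨L, hL, h0⟩ := hΦ s (Ico_subset_Icc_self hs)
    have := HasFDerivAt.comp_hasDerivWithinAt (F := X) (E := ℝ) s hL (h.deriv_right hs)
    rwa [h0] at this

end IsCurve

/-- The density of `(k²)_ξ = k sin v · q` is at most the energy density. -/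
lemma abs_mul_sin_le (k v : ℝ) :
    |k * Real.sin v| ≤ (k ^ 2 * (1 + Real.cos v) + (1 - Real.cos v)) / 2 := by
  have h1 := Real.cos_le_one v
  have h2 := Real.neg_one_le_cos v
  have h3 := Real.sin_sq_add_cos_sq v
  have h4 : 0 ≤ k ^ 2 * (1 + Real.cos v) := mul_nonneg (sq_nonneg _) (by linarith)
  refine abs_le_of_sq_le_sq ?_ (by linarith)
  have h5 := sq_nonneg (k ^ 2 * (1 + Real.cos v) - (1 - Real.cos v))
  have h6 : Real.sin v ^ 2 = (1 + Real.cos v) * (1 - Real.cos v) := by linarith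
  rw [mul_pow, h6]
  nlinarith

/-- Under the relation `k_ξ = ½ sin v · q` the energy controls `k` uniformly. -/
lemma Compat.sq_le_energy {z : X} (hc : Compat z) (hq : ∀ᵐ ξ, 0 ≤ X.q z ξ) :
    ∀ᵐ ξ, X.k z ξ ^ 2 ≤ energy z := by
  obtain ⟨k', pk, ek⟩ := IsWeakDeriv.exists_isPrim (locallyIntegrable_of_memLp_two (memLp_k z))
    (locallyIntegrable_of_memLp_two (memLp_dx z)) (isWeakDeriv_X z)
  have h := pk.sq_le_integral ((memLp_congr_ae ek).1 (memLp_k z))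
    ((integrable_energy_density z).mul_of_top_left (memLp_q z)) (by
      filter_upwards [hc, hq, ek] with ξ a b c
      rw [a, ← c, show 2 * (X.k z ξ * (1 / 2 * Real.sin (X.v z ξ) * X.q z ξ))
        = X.k z ξ * Real.sin (X.v z ξ) * X.q z ξ by ring, abs_mul, abs_of_nonneg b]
      exact mul_le_mul_of_nonneg_right (abs_mul_sin_le _ _) b)
  filter_upwards [ek] with ξ a
  rw [a]; exact h ξ

lemma integral_sin_sq_le_energy {z : X} (hq : ∀ᵐ ξ, 0 ≤ X.q z ξ) :
    ∫ ξ, Real.sin (X.v z ξ / 2) ^ 2 * X.q z ξ ≤ energy z := by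
  refine integral_mono_of_nonneg ?_
    ((integrable_energy_density z).mul_of_top_left (memLp_q z)) ?_
  · filter_upwards [hq] with ξ h using mul_nonneg (sq_nonneg _) h
  · filter_upwards [hq] with ξ h
    refine mul_le_mul_of_nonneg_right ?_ h
    rw [sin_half_sq]
    have : 0 ≤ X.k z ξ ^ 2 * (1 + Real.cos (X.v z ξ)) :=
      mul_nonneg (sq_nonneg _) (by linarith [Real.neg_one_le_cos (X.v z ξ)])
    linarith

namespace Adm

variable {k v q : ℝ → ℝ}

lemma integrable_kern_mul_jac (h : Adm M m k v q) (hm : 0 < m) (ξ : ℝ) :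
    Integrable fun η => kern v q ξ η * jac v q η := by
  refine ((integrable_expKernel_sub hm ξ).const_mul (Real.exp M * M)).mono'
    ((measurable_kern (h.locallyIntegrable_jac hm) ξ).mul
      h.measurable_jac).aestronglyMeasurable ?_
  filter_upwards [h.abs_jac_le hm] with η hη
  rw [norm_mul, Real.norm_of_nonneg (kern_pos v q ξ η).le, Real.norm_eq_abs]
  have := mul_le_mul (h.kern_le hm ξ η) hη (abs_nonneg _) (by positivity)
  linarith

/-- The kernel has mass at most `2` against `cos²(v/2) q`, whatever the bounds on `v` and `q`. -/
lemma integral_kern_mul_jac_le (h : Adm M m k v q) (hm : 0 < m) (ξ : ℝ) :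
    ∫ η, kern v q ξ η * jac v q η ≤ 2 := by
  have hi := h.integrable_kern_mul_jac hm ξ
  set Y : ℝ → ℝ := fun ξ => ∫ s in (0 : ℝ)..ξ, jac v q s with hY
  have pY : IsPrim Y (jac v q) := h.isPrim_jac hm
  have p1 := pY.comp (Φ := Real.exp) (φ := Real.exp) Real.hasDerivAt_exp Real.continuous_exp
  have p2 := pY.comp (Φ := fun y => Real.exp (-y)) (φ := fun y => -Real.exp (-y))
    (fun y => by simpa using (hasDerivAt_neg y).exp) (by fun_prop)
  have r : ∫ η in Ioi ξ, kern v q ξ η * jac v q η ≤ 1 := by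
    refine le_of_tendsto (intervalIntegral_tendsto_integral_Ioi ξ hi.integrableOn tendsto_id) ?_
    filter_upwards [eventually_ge_atTop ξ] with b hb
    have e : ∫ η in ξ..b, kern v q ξ η * jac v q η
        = ∫ η in ξ..b, -Real.exp (Y ξ) * (-Real.exp (-Y η) * jac v q η) := by
      refine intervalIntegral.integral_congr fun η hη => ?_
      rw [uIcc_of_le hb] at hη
      rw [h.kern_of_le hm hη.1]; ring
    simp only [id]
    rw [e, intervalIntegral.integral_const_mul, ← p2.eq, neg_mul, mul_sub,
      ← Real.exp_add (Y ξ) (-Y ξ), add_neg_cancel, Real.exp_zero]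
    have := mul_pos (Real.exp_pos (Y ξ)) (Real.exp_pos (-Y b))
    linarith
  have l : ∫ η in Iic ξ, kern v q ξ η * jac v q η ≤ 1 := by
    refine le_of_tendsto (intervalIntegral_tendsto_integral_Iic ξ hi.integrableOn tendsto_id) ?_
    filter_upwards [eventually_le_atBot ξ] with b hb
    have e : ∫ η in b..ξ, kern v q ξ η * jac v q η
        = ∫ η in b..ξ, Real.exp (-Y ξ) * (Real.exp (Y η) * jac v q η) := by
      refine intervalIntegral.integral_congr fun η hη => ?_
      rw [uIcc_of_le hb] at hη
      rw [h.kern_of_ge hm hη.2]; ring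
    simp only [id]
    rw [e, intervalIntegral.integral_const_mul, ← p1.eq, mul_sub,
      ← Real.exp_add (-Y ξ) (Y ξ), neg_add_cancel, Real.exp_zero]
    have := mul_pos (Real.exp_pos (-Y ξ)) (Real.exp_pos (Y b))
    linarith
  rw [← intervalIntegral.integral_Iic_add_Ioi (b := ξ) hi.integrableOn hi.integrableOn]
  linarith

/-- A bound on `P̃` which does not involve the bounds `M` and `m` of `Adm`: the kernel is integrated
against `cos²(v/2) q`, where its mass is at most `2`, and is bounded by `1` against `sin²(v/2) q`. -/
lemma abs_Pt_le (hm : 0 < m) {t : ℝ} (h : Adm M m k v q) {K E C₁ C₂ : ℝ} (hC₂ : 0 ≤ C₂)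
    (hE : ∫ ξ, Real.sin (v ξ / 2) ^ 2 * q ξ ≤ E)
    (hG : ∀ᵐ ξ, |coefG lam g t (k ξ)| ≤ C₁ * K) (hF : ∀ᵐ ξ, |coefF lam f t (k ξ)| ≤ C₂) (ξ : ℝ) :
    |Pt lam f g t k v q ξ| ≤ |C₁ * K| + C₂ * E := by
  have i1 := h.integrable_kern_mul_jac hm ξ
  have i2 := h.integrable_sin_sq hm
  have hE0 : 0 ≤ ∫ ξ, Real.sin (v ξ / 2) ^ 2 * q ξ := by
    refine integral_nonneg_of_ae ?_
    filter_upwards [h.le_q] with η h using mul_nonneg (sq_nonneg _) (hm.le.trans h)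
  have hb : |∫ η, integrand lam f g t k v q ξ η|
      ≤ ∫ η, (|C₁ * K| * (kern v q ξ η * jac v q η)
        + C₂ * (Real.sin (v η / 2) ^ 2 * q η)) := by
    rw [← Real.norm_eq_abs]
    refine norm_integral_le_of_norm_le ((i1.const_mul _).add (i2.const_mul _)) ?_
    filter_upwards [hG, hF, h.le_q] with η a b c
    have hq : 0 ≤ q η := hm.le.trans c
    have k0 := (kern_pos v q ξ η).le
    have k1 : kern v q ξ η ≤ 1 := Real.exp_le_one_iff.2 (by simp)
    rw [integrand_eq, density_eq, Real.norm_eq_abs, abs_mul, abs_mul, abs_of_nonneg k0,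
      abs_of_nonneg hq, jac]
    have t1 : |coefG lam g t (k η) * Real.cos (v η / 2) ^ 2
        + 1 / 2 * (coefF lam f t (k η) * Real.sin (v η / 2) ^ 2)|
        ≤ |C₁ * K| * Real.cos (v η / 2) ^ 2 + C₂ * Real.sin (v η / 2) ^ 2 := by
      refine (abs_add_le _ _).trans ?_
      rw [abs_mul, abs_mul, abs_mul, abs_of_nonneg (sq_nonneg (Real.cos (v η / 2))),
        abs_of_nonneg (sq_nonneg (Real.sin (v η / 2))), abs_of_pos (one_half_pos : (0 : ℝ) < 1 / 2)]
      have t2 := mul_le_mul_of_nonneg_right (a.trans (le_abs_self _))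
        (sq_nonneg (Real.cos (v η / 2)))
      have t3 := mul_le_mul_of_nonneg_right b (sq_nonneg (Real.sin (v η / 2)))
      have t4 : 0 ≤ |coefF lam f t (k η)| * Real.sin (v η / 2) ^ 2 := by positivity
      linarith
    have t5 := mul_le_mul_of_nonneg_left (mul_le_mul_of_nonneg_right t1 hq) k0
    have t6 : kern v q ξ η * (C₂ * Real.sin (v η / 2) ^ 2 * q η)
        ≤ C₂ * Real.sin (v η / 2) ^ 2 * q η := mul_le_of_le_one_left (by positivity) k1
    linarith
  rw [integral_add (i1.const_mul _) (i2.const_mul _), integral_const_mul, integral_const_mul] at hb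
  have t7 := mul_le_mul_of_nonneg_left (h.integral_kern_mul_jac_le hm ξ) (abs_nonneg (C₁ * K))
  have t8 := mul_le_mul_of_nonneg_left hE hC₂
  have t9 := mul_nonneg hC₂ hE0
  rw [Pt, abs_mul, abs_of_pos (one_half_pos : (0 : ℝ) < 1 / 2)]
  linarith

end Adm

section

variable (hlam : 0 < lam) (hf : ContDiff ℝ ∞ f) (hg : ContDiff ℝ ∞ g) (hg0 : g 0 = 0)

include hlam hf hg hg0

lemma IsCurve.compat {α : ℝ → X} (h : IsCurve lam f g T α) (h0 : Compat (α 0)) {t : ℝ}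
    (ht : t ∈ Icc 0 T) : Compat (α t) := by
  rw [compat_iff]
  intro S hS hμ
  rw [h.eq_of_stationary (Φ := defect S) (fun s hs => ?_) ht, (compat_iff _).1 h0 S hS hμ]
  obtain ⟨M, m, hm, hA⟩ := h.exists_admX hs
  exact exists_hasFDerivAt_defect hlam hf hg hg0 hm hs.1 hA hS hμ

lemma IsCurve.energy_eq {α : ℝ → X} (h : IsCurve lam f g T α) (h0 : Compat (α 0)) {t : ℝ}
    (ht : t ∈ Icc 0 T) : energy (α t) = energy (α 0) := by
  refine h.eq_of_stationary (fun s hs => ?_) ht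
  obtain ⟨M, m, hm, hA⟩ := h.exists_admX hs
  exact energy_stationary hlam hf hg hg0 hm hs.1 hA (h.compat hlam hf hg hg0 h0 hs)

omit hlam hf hg hg0 in
/-- If the logarithmic rate of change of `q` is bounded by `c`, then `q` stays between
`e^{-ct}` and `e^{ct}`; the two bounds correspond to the two signs `s`. -/
lemma IsCurve.q_bound {α : ℝ → X} (h : IsCurve lam f g T α) (h0 : X.q (α 0) =ᵐ[volume] fun _ => 1)
    {c : ℝ} (hc : ∀ t ∈ Icc 0 T, ∀ᵐ ξ,
      |X.q (field lam f g t (α t)) ξ| ≤ c * X.q (α t) ξ) {s : ℝ} (hs : s * s = 1) {t : ℝ}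
    (ht : t ∈ Icc 0 T) : ∀ᵐ ξ, 0 ≤ s * (X.q (α t) ξ * Real.exp (s * c * t) - 1) := by
  have hs1 : |s| = 1 := by
    have : |s| * |s| = 1 := by rw [← abs_mul, hs, abs_one]
    nlinarith [abs_nonneg s]
  refine ae_nonneg_of_forall_setIntegral_nonneg_of_sigmaFinite (fun S hS hμ => ?_)
    (fun S hS hμ => ?_)
  · have : IsFiniteMeasure (volume.restrict S) := ⟨by simpa using hμ⟩
    have h1 : IntegrableOn (X.q (α t)) S := ((memLp_q (α t)).restrict S).integrable (by simp)
    exact ((h1.mul_const _).sub (integrable_const 1)).const_mul s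
  set χ : ℝ → ℝ := S.indicator fun _ => (1 : ℝ) with hχ
  have χ1 : Integrable χ := memLp_one_iff_integrable.1 (memLp_indicator_one hS hμ.ne 1)
  have χ0 : ∀ ξ, 0 ≤ χ ξ := fun ξ => indicator_nonneg (fun _ _ => zero_le_one) ξ
  set L : X →L[ℝ] ℝ := (integralL χ χ1).comp qL with hL
  have eL : ∀ z, L z = ∫ ξ, χ ξ * X.q z ξ := fun z => rfl
  have iL : ∀ z, Integrable fun ξ => χ ξ * X.q z ξ := fun z => χ1.mul_of_top_left (memLp_q z)
  have hd : ∀ r ∈ Icc 0 T, HasDerivWithinAt (fun r => s * (L (α r) * Real.exp (s * c * r)))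
      (s * (L (field lam f g r (α r)) * Real.exp (s * c * r)
        + L (α r) * (Real.exp (s * c * r) * (s * c)))) (Icc 0 T) r := by
    intro r hr
    have d1 := HasFDerivAt.comp_hasDerivWithinAt (F := X) (E := ℝ) r L.hasFDerivAt (h.deriv r hr)
    have d2 : HasDerivAt (fun r => Real.exp (s * c * r)) (Real.exp (s * c * r) * (s * c)) r := by
      simpa using ((hasDerivAt_id r).const_mul (s * c)).exp
    exact (d1.mul d2.hasDerivWithinAt).const_mul s
  have hmono : MonotoneOn (fun r => s * (L (α r) * Real.exp (s * c * r))) (Icc 0 T) := by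
    refine monotoneOn_of_hasDerivWithinAt_nonneg (convex_Icc 0 T)
      (fun r hr => (hd r hr).continuousWithinAt)
      (fun r hr => (hd r (interior_subset hr)).mono interior_subset) ?_
    intro r hr
    have hr' := interior_subset hr
    have e1 : s * (L (field lam f g r (α r)) * Real.exp (s * c * r)
        + L (α r) * (Real.exp (s * c * r) * (s * c)))
        = Real.exp (s * c * r) * (s * L (field lam f g r (α r)) + c * L (α r)) := by
      linear_combination (L (α r) * Real.exp (s * c * r) * c) * hs
    rw [e1]
    refine mul_nonneg (Real.exp_pos _).le ?_
    rw [eL, eL, ← integral_const_mul, ← integral_const_mul,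
      ← integral_add ((iL _).const_mul s) ((iL _).const_mul c)]
    refine integral_nonneg_of_ae ?_
    filter_upwards [hc r hr'] with ξ hξ
    have e2 : s * (χ ξ * X.q (field lam f g r (α r)) ξ) + c * (χ ξ * X.q (α r) ξ)
        = χ ξ * (s * X.q (field lam f g r (α r)) ξ + c * X.q (α r) ξ) := by ring
    simp only [Pi.zero_apply]
    rw [e2]
    refine mul_nonneg (χ0 ξ) ?_
    have e3 : |s * X.q (field lam f g r (α r)) ξ| ≤ c * X.q (α r) ξ := by
      rwa [abs_mul, hs1, one_mul]
    linarith [neg_abs_le (s * X.q (field lam f g r (α r)) ξ)]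
  have hm := hmono ⟨le_rfl, ht.1.trans ht.2⟩ ht ht.1
  simp only [mul_zero, Real.exp_zero, mul_one] at hm
  have e0 : L (α 0) = ∫ ξ in S, (1 : ℝ) := by
    rw [eL, ← integral_indicator hS]
    refine integral_congr_ae ?_
    filter_upwards [h0] with ξ hξ
    rw [hξ, mul_one]
  have e4 : L (α t) = ∫ ξ in S, X.q (α t) ξ := by
    rw [eL, ← integral_indicator hS]
    refine integral_congr_ae (ae_of_all _ fun ξ => ?_)
    by_cases hξ : ξ ∈ S <;> simp [hχ, hξ]
  have : IsFiniteMeasure (volume.restrict S) := ⟨by simpa using hμ⟩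
  have h1 : IntegrableOn (X.q (α t)) S := ((memLp_q (α t)).restrict S).integrable (by simp)
  rw [integral_const_mul, integral_sub (h1.mul_const _) (integrable_const 1), integral_mul_const,
    ← e4, ← e0, mul_sub]
  linarith

/-- Along a solution curve the norm and the lower bound of `q` are controlled by the initial
value and the length of the time interval. -/
theorem exists_a_priori_bound {z₀ : X} (hz : Compat z₀) (hq : X.q z₀ =ᵐ[volume] fun _ => 1)
    (T : ℝ) : ∃ N m : ℝ, 0 < m ∧ ∀ T' ∈ Icc 0 T, ∀ α : ℝ → X, α 0 = z₀ → IsCurve lam f g T' α →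
      ∀ t ∈ Icc 0 T', ‖α t‖ ≤ N ∧ ∀ᵐ ξ, m ≤ X.q (α t) ξ := by
  set E := energy z₀ with hE
  set K := √E with hK
  have hK0 : 0 ≤ K := Real.sqrt_nonneg _
  obtain ⟨C₁, hC₁, HG⟩ := exists_coefG_bound hlam hg hg0 T K
  obtain ⟨C₂, hC₂, HF⟩ := exists_coefF_bound hlam hf T K
  -- `c` bounds the logarithmic rate `q_t / q`, because `|k| ≤ K`, `|G| ≤ C₁ K`, `|F| ≤ C₂` and
  -- `|P̃| ≤ C₁ K + C₂ E`.
  set c := C₂ + (C₁ * K + (C₁ * K + C₂ * E)) with hc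
  set M := max (max K E) (Real.exp (c * T)) with hM
  have hm : 0 < Real.exp (-(c * T)) := Real.exp_pos _
  obtain ⟨C, hC, HC⟩ := exists_field_bound hlam hf hg hg0 T M hm
  refine ⟨‖z₀‖ * Real.exp (C * T), Real.exp (-(c * T)), hm, ?_⟩
  intro T' hT' α h0 hα
  have hsub : Icc 0 T' ⊆ Icc 0 T := Icc_subset_Icc_right hT'.2
  rw [← h0] at hz hq
  have hq0 : ∀ t ∈ Icc 0 T', ∀ᵐ ξ, 0 ≤ X.q (α t) ξ := fun t ht => by
    obtain ⟨m, hm, h⟩ := hα.pos t ht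
    exact h.mono fun ξ hξ => hm.le.trans hξ
  have hcomp : ∀ t ∈ Icc 0 T', Compat (α t) := fun t ht => hα.compat hlam hf hg hg0 hz ht
  have hen : ∀ t ∈ Icc 0 T', energy (α t) = E := fun t ht => by
    rw [hα.energy_eq hlam hf hg hg0 hz ht, h0]
  have hk : ∀ t ∈ Icc 0 T', ∀ᵐ ξ, |X.k (α t) ξ| ≤ K := fun t ht => by
    filter_upwards [(hcomp t ht).sq_le_energy (hq0 t ht)] with ξ h
    rw [hen t ht] at h
    exact Real.abs_le_sqrt h
  have hs : ∀ t ∈ Icc 0 T', ∫ ξ, Real.sin (X.v (α t) ξ / 2) ^ 2 * X.q (α t) ξ ≤ E := fun t ht => by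
    rw [← hen t ht]; exact integral_sin_sq_le_energy (hq0 t ht)
  have hG : ∀ t ∈ Icc 0 T', ∀ᵐ ξ, |coefG lam g t (X.k (α t) ξ)| ≤ C₁ * K := fun t ht => by
    filter_upwards [hk t ht] with ξ h
    exact (HG t (hsub ht) t (hsub ht) _ _ h h).1.trans (mul_le_mul_of_nonneg_left h hC₁)
  have hF : ∀ t ∈ Icc 0 T', ∀ᵐ ξ, |coefF lam f t (X.k (α t) ξ)| ≤ C₂ := fun t ht => by
    filter_upwards [hk t ht] with ξ h
    exact (HF t (hsub ht) t (hsub ht) _ _ h h).1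
  have hrate : ∀ t ∈ Icc 0 T', ∀ᵐ ξ,
      |X.q (field lam f g t (α t)) ξ| ≤ c * X.q (α t) ξ := by
    intro t ht
    obtain ⟨M', m', hm', hA⟩ := hα.exists_admX ht
    have hP := Adm.abs_Pt_le (lam := lam) (f := f) (g := g) hm' hA hC₂ (hs t ht) (hG t ht) (hF t ht)
    rw [abs_of_nonneg (by positivity : 0 ≤ C₁ * K)] at hP
    filter_upwards [(field_isRhs hlam hf hg hg0 hm' ht.1 hA).2.2, hq0 t ht, hG t ht, hF t ht]
      with ξ e q0 b1 b2
    rw [e, rhsQ_eq, abs_mul, abs_of_nonneg q0, mul_comm]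
    refine mul_le_mul_of_nonneg_right ?_ q0
    refine (abs_add_le _ _).trans ?_
    have s1 := Real.abs_sin_le_one (X.v (α t) ξ)
    rw [abs_mul, abs_mul, abs_mul, abs_of_pos (one_half_pos : (0 : ℝ) < 1 / 2)]
    have u1 := mul_le_mul b2 s1 (abs_nonneg _) hC₂
    have u2 := (abs_sub (coefG lam g t (X.k (α t) ξ))
      (Pt lam f g t (X.k (α t)) (X.v (α t)) (X.q (α t)) ξ)).trans (add_le_add b1 (hP ξ))
    have u3 := mul_le_mul s1 u2 (abs_nonneg _) zero_le_one
    have u4 : 0 ≤ |coefF lam f t (X.k (α t) ξ)| * |Real.sin (X.v (α t) ξ)| := by positivity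
    linarith
  have hE0 : 0 ≤ E := by
    refine le_trans ?_ (hs 0 ⟨le_rfl, hT'.1⟩)
    refine integral_nonneg_of_ae ?_
    filter_upwards [hq0 0 ⟨le_rfl, hT'.1⟩] with ξ h using mul_nonneg (sq_nonneg _) h
  have hc0 : 0 ≤ c := by positivity
  have hlo : ∀ t ∈ Icc 0 T', ∀ᵐ ξ, Real.exp (-(c * T)) ≤ X.q (α t) ξ := by
    intro t ht
    filter_upwards [hα.q_bound hq hrate (one_mul 1) ht] with ξ h
    rw [one_mul, one_mul] at h
    have h1 := Real.exp_pos (c * t)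
    have h2 : Real.exp (-(c * t)) ≤ X.q (α t) ξ := by
      rw [Real.exp_neg, inv_le_iff_one_le_mul₀ h1]; linarith
    refine le_trans (Real.exp_le_exp.2 ?_) h2
    have := mul_le_mul_of_nonneg_left (hsub ht).2 hc0
    linarith
  have hhi : ∀ t ∈ Icc 0 T', ∀ᵐ ξ, X.q (α t) ξ ≤ Real.exp (c * T) := by
    intro t ht
    filter_upwards [hα.q_bound hq hrate (by norm_num : (-1 : ℝ) * -1 = 1) ht] with ξ h
    have h1 := Real.exp_pos (c * t)
    have h3 : X.q (α t) ξ * Real.exp (-(c * t)) ≤ 1 := by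
      rw [show -1 * c * t = -(c * t) by ring] at h; linarith
    have h2 : X.q (α t) ξ ≤ Real.exp (c * t) := by
      rw [Real.exp_neg, ← div_eq_mul_inv, div_le_one h1] at h3; exact h3
    refine h2.trans (Real.exp_le_exp.2 ?_)
    exact mul_le_mul_of_nonneg_left (hsub ht).2 hc0
  have hA : ∀ t ∈ Icc 0 T', AdmX M (Real.exp (-(c * T))) (α t) := fun t ht =>
    admX_of_bounds ((hk t ht).mono fun ξ h => h.trans ((le_max_left _ _).trans (le_max_left _ _)))
      (hlo t ht) ((hhi t ht).mono fun ξ h => h.trans (le_max_right _ _))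
      ((hs t ht).trans ((le_max_right _ _).trans (le_max_left _ _)))
  intro t ht
  refine ⟨?_, hlo t ht⟩
  -- On the admissible set found so far the vector field has linear growth.
  have hgr := norm_le_gronwallBound_of_norm_deriv_right_le (δ := ‖z₀‖) (K := C) (ε := 0)
    hα.continuousOn (fun s hs => hα.deriv_right hs) (by rw [h0])
    (fun s hs => by
      have h1 := Ico_subset_Icc_self hs
      rw [add_zero]
      exact (HC s (hsub h1) s (hsub h1) _ _ (hA s h1) (hA s h1)).1) t ht
  rw [gronwallBound_ε0, sub_zero] at hgr
  refine hgr.trans (mul_le_mul_of_nonneg_left (Real.exp_le_exp.2 ?_) (norm_nonneg _))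
  exact mul_le_mul_of_nonneg_left (hsub ht).2 hC

end

/-! ### Global solutions of ordinary differential equations -/

section ODE

open Metric NNReal

variable {E : Type*} [NormedAddCommGroup E] [NormedSpace ℝ E]

/-- `α` solves `α' = F(t, α)` on `[a, b]`. -/
def SolvesOn (F : ℝ → E → E) (a b : ℝ) (α : ℝ → E) : Prop :=
  ∀ t ∈ Icc a b, HasDerivWithinAt α (F t (α t)) (Icc a b) t

/-- Around the points of `A`, on balls of a fixed radius contained in `U`, the vector field `F` is
bounded, Lipschitz in space and continuous in time, uniformly for times in `[0, T]`. -/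
def UniformlyRegular (F : ℝ → E → E) (U : Set E) (T : ℝ) (A : Set E) : Prop :=
  ∃ r : ℝ, 0 < r ∧ ∃ B L : ℝ≥0, ∀ z ∈ A, closedBall z r ⊆ U ∧
    (∀ t ∈ Icc 0 T, LipschitzOnWith L (F t) (closedBall z r)) ∧
    (∀ x ∈ closedBall z r, ContinuousOn (fun t => F t x) (Icc 0 T)) ∧
    ∀ t ∈ Icc 0 T, ∀ x ∈ closedBall z r, ‖F t x‖ ≤ B

variable {F : ℝ → E → E} {U A : Set E} {a b c : ℝ} {α β : ℝ → E}

lemma SolvesOn.continuousOn (h : SolvesOn F a b α) : ContinuousOn α (Icc a b) :=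
  fun t ht => (h t ht).continuousWithinAt

lemma SolvesOn.mono (h : SolvesOn F a b α) (hc : c ≤ b) : SolvesOn F a c α := fun t ht =>
  (h t ⟨ht.1, ht.2.trans hc⟩).mono (Icc_subset_Icc_right hc)

lemma SolvesOn.congr (h : SolvesOn F a b α) (he : EqOn β α (Icc a b)) : SolvesOn F a b β := by
  intro t ht
  rw [he ht]
  exact (h t ht).congr he (he ht)

/-- Two solutions on adjacent intervals which agree at the common end point can be joined. -/
lemma SolvesOn.glue (hab : a ≤ b) (hbc : b ≤ c) (hα : SolvesOn F a b α) (hβ : SolvesOn F b c β)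
    (h : β b = α b) : SolvesOn F a c fun t => if t ≤ b then α t else β t := by
  set γ : ℝ → E := fun t => if t ≤ b then α t else β t with hγ
  have e1 : EqOn γ α (Icc a b) := fun t ht => if_pos ht.2
  have e2 : EqOn γ β (Icc b c) := by
    intro t ht
    rcases ht.1.eq_or_lt with h1 | h1
    · rw [← h1]; simp [hγ, h]
    · exact if_neg (not_le.2 h1)
  have h1 := hα.congr e1
  have h2 := hβ.congr e2
  intro t ht
  rcases lt_trichotomy t b with h3 | h3 | h3
  · refine (h1 t ⟨ht.1, h3.le⟩).mono_of_mem_nhdsWithin ?_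
    filter_upwards [self_mem_nhdsWithin, mem_nhdsWithin_of_mem_nhds (Iio_mem_nhds h3)] with s a b
    exact ⟨a.1, le_of_lt b⟩
  · subst h3
    have := (h1 t ⟨hab, le_rfl⟩).union (h2 t ⟨le_rfl, hbc⟩)
    rwa [Icc_union_Icc_eq_Icc hab hbc] at this
  · refine (h2 t ⟨h3.le, ht.2⟩).mono_of_mem_nhdsWithin ?_
    filter_upwards [self_mem_nhdsWithin, mem_nhdsWithin_of_mem_nhds (Ioi_mem_nhds h3)] with s a b
    exact ⟨le_of_lt b, a.2⟩

/-- A solution staying in a region where the vector field is locally Lipschitz is unique, also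
among the solutions for which nothing is known beforehand about the region. -/
lemma SolvesOn.eqOn
    (hF : ∀ z ∈ U, ∃ r : ℝ, 0 < r ∧ ∃ L : ℝ≥0, ∀ t ∈ Icc 0 T, LipschitzOnWith L (F t) (closedBall z r))
    (hα : SolvesOn F 0 T α) (hU : ∀ t ∈ Icc 0 T, α t ∈ U) (hβ : SolvesOn F 0 T β)
    (h0 : β 0 = α 0) : EqOn β α (Icc 0 T) := by
  have cl : IsClosed ({t | β t = α t} ∩ Icc 0 T) := by
    have := (hβ.continuousOn.prodMk hα.continuousOn).preimage_isClosed_of_isClosed isClosed_Icc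
      isClosed_diagonal
    rwa [inter_comm] at this
  refine cl.Icc_subset_of_forall_exists_gt h0 ?_
  rintro x ⟨hx, hxT⟩ y hy
  have hx' : x ∈ Icc 0 T := Ico_subset_Icc_self hxT
  obtain ⟨r, hr, L, hL⟩ := hF (α x) (hU x hx')
  have n1 : ∀ᶠ t in 𝓝[Icc 0 T] x, α t ∈ closedBall (α x) r :=
    (hα.continuousOn x hx').eventually (closedBall_mem_nhds _ hr)
  have n2 : ∀ᶠ t in 𝓝[Icc 0 T] x, β t ∈ closedBall (α x) r := by
    have h := hβ.continuousOn x hx'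
    rw [ContinuousWithinAt, show β x = α x from hx] at h
    exact h.eventually (closedBall_mem_nhds _ hr)
  obtain ⟨ε, hε, H⟩ := mem_nhdsWithin_iff.1 (n1.and n2)
  set c := min (x + ε / 2) (min y T) with hc
  have hxc : x < c := lt_min (by linarith) (lt_min hy hxT.2)
  have hcT : c ≤ T := (min_le_right _ _).trans (min_le_right _ _)
  have hmem : ∀ t ∈ Icc x c, t ∈ Icc 0 T := fun t ht => ⟨hxT.1.trans ht.1, ht.2.trans hcT⟩
  have hball : ∀ t ∈ Icc x c, α t ∈ closedBall (α x) r ∧ β t ∈ closedBall (α x) r := by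
    intro t ht
    refine H ⟨?_, hmem t ht⟩
    have h1 : t ≤ x + ε / 2 := ht.2.trans (min_le_left _ _)
    rw [mem_ball, Real.dist_eq, abs_of_nonneg (by linarith [ht.1])]
    linarith
  have right : ∀ {γ : ℝ → E}, SolvesOn F 0 T γ → ∀ t ∈ Ico x c,
      HasDerivWithinAt γ (F t (γ t)) (Ici t) t := fun hγ t ht =>
    (hγ t (hmem t (Ico_subset_Icc_self ht))).mono_of_mem_nhdsWithin
      (Icc_mem_nhdsGE_of_mem ⟨hxT.1.trans ht.1, ht.2.trans_le hcT⟩)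
  have := ODE_solution_unique_of_mem_Icc_right (v := F) (s := fun _ => closedBall (α x) r)
    (fun t ht => hL t (hmem t (Ico_subset_Icc_self ht)))
    (hβ.continuousOn.mono hmem) (right hβ) (fun t ht => (hball t (Ico_subset_Icc_self ht)).2)
    (hα.continuousOn.mono hmem) (right hα) (fun t ht => (hball t (Ico_subset_Icc_self ht)).1) hx
  exact ⟨c, this ⟨hxc.le, le_rfl⟩, hxc, (min_le_right _ _).trans (min_le_left _ _)⟩

variable [CompleteSpace E]

/-- The local solution of the Picard–Lindelöf theorem stays in the ball. -/
lemma exists_solvesOn_closedBall (hab : a ≤ b) {z : E} {r : ℝ} (hr : 0 ≤ r) {B L : ℝ≥0}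
    (h1 : ∀ t ∈ Icc a b, LipschitzOnWith L (F t) (closedBall z r))
    (h2 : ∀ x ∈ closedBall z r, ContinuousOn (fun t => F t x) (Icc a b))
    (h3 : ∀ t ∈ Icc a b, ∀ x ∈ closedBall z r, ‖F t x‖ ≤ B) (h4 : B * (b - a) ≤ r) :
    ∃ β : ℝ → E, β a = z ∧ SolvesOn F a b β ∧ ∀ t ∈ Icc a b, β t ∈ closedBall z r := by
  set R : ℝ≥0 := ⟨r, hr⟩ with hR
  have hf : IsPicardLindelof F (⟨a, le_rfl, hab⟩ : Icc a b) z R 0 B L := by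
    refine ⟨h1, h2, h3, ?_⟩
    simp only [sub_self, NNReal.coe_zero, sub_zero]
    rw [max_eq_left (by linarith)]
    exact h4
  obtain ⟨α, hα⟩ := ODE.FunSpace.exists_isFixedPt_next hf (mem_closedBall_self le_rfl)
  have hmem : ∀ t, α.compProj t ∈ closedBall z R := fun t => α.compProj_mem_closedBall hf.mul_max_le
  refine ⟨α.compProj, ?_, fun t ht => ?_, fun t _ => hmem t⟩
  · have := ODE.FunSpace.compProj_val (α := α) (t := (⟨a, le_rfl, hab⟩ : Icc a b))
    rw [this, ← hα, ODE.FunSpace.next_apply₀]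
  · refine (ODE.hasDerivWithinAt_picard_Icc (⟨a, le_rfl, hab⟩ : Icc a b).2 hf.continuousOn_uncurry
      α.continuous_compProj.continuousOn (fun t' _ => hmem t') z ht).congr_of_mem ?_ ht
    intro t' ht'
    nth_rw 1 [← hα]
    rw [ODE.FunSpace.compProj_of_mem ht', ODE.FunSpace.next_apply]

/-- A priori bounds in a region of uniform regularity give a solution on the whole interval: the
local solutions exist for a uniform time, so that finitely many steps suffice. -/
lemma exists_solvesOn_of_a_priori {z₀ : E} (hT : 0 ≤ T) (hz : z₀ ∈ U)
    (hreg : UniformlyRegular F U T A)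
    (hap : ∀ T' ∈ Icc 0 T, ∀ α : ℝ → E, α 0 = z₀ → SolvesOn F 0 T' α →
      (∀ t ∈ Icc 0 T', α t ∈ U) → ∀ t ∈ Icc 0 T', α t ∈ A) :
    ∃ α : ℝ → E, α 0 = z₀ ∧ SolvesOn F 0 T α ∧ ∀ t ∈ Icc 0 T, α t ∈ U := by
  obtain ⟨r, hr, B, L, H⟩ := hreg
  set h : ℝ := r / (B + 1) with hh
  have hB : (0 : ℝ) < B + 1 := by positivity
  have hh0 : 0 < h := div_pos hr hB
  have hBh : B * h ≤ r := by
    rw [hh, mul_div_assoc', div_le_iff₀ hB]; nlinarith [B.2]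
  have step : ∀ n : ℕ, ∃ α : ℝ → E, α 0 = z₀ ∧ SolvesOn F 0 (min (n * h) T) α ∧
      ∀ t ∈ Icc 0 (min (n * h) T), α t ∈ U := by
    intro n
    induction n with
    | zero =>
      refine ⟨fun _ => z₀, rfl, fun t ht => ?_, fun _ _ => hz⟩
      have e : min (((0 : ℕ) : ℝ) * h) T = 0 := by simp [hT]
      rw [e] at ht ⊢
      rw [Icc_self] at ht ⊢
      rw [mem_singleton_iff.1 ht]
      exact HasFDerivWithinAt.of_subsingleton subsingleton_singleton
    | succ n ih =>
      obtain ⟨α, h0, hα, hU⟩ := ih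
      set T₁ := min (n * h) T with hT1
      set T₂ := min (((n + 1 : ℕ) : ℝ) * h) T with hT2
      have t1 : 0 ≤ T₁ := le_min (by positivity) hT
      have t12 : T₁ ≤ T₂ := min_le_min_right _ (by push_cast; nlinarith)
      have t2 : T₂ ≤ T := min_le_right _ _
      have t3 : T₂ - T₁ ≤ h := by
        have : T₂ ≤ T₁ + h := by
          rcases le_total (n * h) T with h5 | h5
          · rw [hT1, min_eq_left h5, hT2]
            refine (min_le_left _ _).trans ?_
            push_cast; linarith
          · rw [hT1, min_eq_right h5]; linarith
        linarith
      have hA := hap T₁ ⟨t1, t12.trans t2⟩ α h0 hα hU T₁ ⟨t1, le_rfl⟩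
      obtain ⟨c1, c2, c3, c4⟩ := H _ hA
      have hsub : Icc T₁ T₂ ⊆ Icc 0 T := Icc_subset_Icc t1 t2
      obtain ⟨β, b0, hβ, hb⟩ := exists_solvesOn_closedBall t12 hr.le
        (fun t ht => c2 t (hsub ht)) (fun x hx => (c3 x hx).mono hsub)
        (fun t ht => c4 t (hsub ht))
        ((mul_le_mul_of_nonneg_left t3 B.2).trans hBh)
      refine ⟨_, ?_, hα.glue t1 t12 hβ b0, fun t ht => ?_⟩
      · simp [t1, h0]
      · by_cases h6 : t ≤ T₁
        · simp only [h6, if_true]; exact hU t ⟨ht.1, h6⟩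
        · simp only [h6, if_false]; exact c1 (hb t ⟨(not_le.1 h6).le, ht.2⟩)
  obtain ⟨n, hn⟩ := exists_nat_ge (T / h)
  have : min (n * h) T = T := min_eq_right ((div_le_iff₀ hh0).1 hn)
  have := this ▸ step n
  exact this

/-- Global existence and uniqueness under a priori bounds. -/
theorem exists_global_solution {z₀ : E} (hz : z₀ ∈ U)
    (hloc : ∀ T : ℝ, ∀ z ∈ U, ∃ r : ℝ, 0 < r ∧ ∃ L : ℝ≥0, ∀ t ∈ Icc 0 T,
      LipschitzOnWith L (F t) (closedBall z r))
    (hap : ∀ T : ℝ, 0 ≤ T → ∃ A : Set E, UniformlyRegular F U T A ∧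
      ∀ T' ∈ Icc 0 T, ∀ α : ℝ → E, α 0 = z₀ → SolvesOn F 0 T' α →
        (∀ t ∈ Icc 0 T', α t ∈ U) → ∀ t ∈ Icc 0 T', α t ∈ A) :
    ∃ z : ℝ → E, z 0 = z₀ ∧ (∀ t ∈ Ici (0 : ℝ), z t ∈ U) ∧
      (∀ t ∈ Ici (0 : ℝ), HasDerivWithinAt z (F t (z t)) (Ici 0) t) ∧
      ∀ (T : ℝ) (w : ℝ → E), w 0 = z₀ → SolvesOn F 0 T w → EqOn w z (Icc 0 T) := by
  have hex : ∀ n : ℕ, ∃ α : ℝ → E, α 0 = z₀ ∧ SolvesOn F 0 n α ∧ ∀ t ∈ Icc (0 : ℝ) n, α t ∈ U := by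
    intro n
    obtain ⟨A, hA, h⟩ := hap n n.cast_nonneg
    exact exists_solvesOn_of_a_priori n.cast_nonneg hz hA h
  choose α h0 hα hU using hex
  set z : ℝ → E := fun t => α ⌈t⌉₊ t with hzd
  have huniq : ∀ (n : ℕ) (T : ℝ) (w : ℝ → E), T ≤ n → w 0 = z₀ → SolvesOn F 0 T w →
      EqOn w (α n) (Icc 0 T) := fun n T w hn w0 hw =>
    SolvesOn.eqOn (hloc T) ((hα n).mono hn) (fun t ht => hU n t ⟨ht.1, ht.2.trans hn⟩) hw
      (w0.trans (h0 n).symm)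
  have hzα : ∀ n : ℕ, EqOn z (α n) (Icc 0 n) := by
    intro n t ht
    have h1 : ⌈t⌉₊ ≤ n := Nat.ceil_le.2 ht.2
    exact huniq n _ _ (by exact_mod_cast h1) (h0 _) (hα ⌈t⌉₊) ⟨ht.1, Nat.le_ceil t⟩
  refine ⟨z, ?_, fun t ht => hU _ t ⟨ht, Nat.le_ceil t⟩, fun t ht => ?_, fun T w w0 hw t ht => ?_⟩
  · simp [hzd, h0]
  · have ht' : 0 ≤ t := ht
    obtain ⟨n, hn⟩ := exists_nat_gt t
    refine ((hα n).congr (hzα n) t ⟨ht, hn.le⟩).mono_of_mem_nhdsWithin ?_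
    filter_upwards [self_mem_nhdsWithin, mem_nhdsWithin_of_mem_nhds (Iio_mem_nhds hn)] with s a b
    exact ⟨a, le_of_lt b⟩
  · obtain ⟨n, hn⟩ := exists_nat_ge T
    rw [huniq n T w hn w0 hw ht, hzα n ⟨ht.1, ht.2.trans hn⟩]

end ODE

/-! ### Global solutions of the system -/

/-- The points of `X` at which `q` is bounded below by a positive constant. -/
def posRegion : Set X := {z | ∃ m, 0 < m ∧ ∀ᵐ ξ, m ≤ X.q z ξ}

lemma half_le_q_of_mem_closedBall {z y : X} (hq : ∀ᵐ ξ, m ≤ X.q z ξ)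
    (hy : y ∈ Metric.closedBall z (m / 2)) : ∀ᵐ ξ, m / 2 ≤ X.q y ξ := by
  rw [Metric.mem_closedBall, dist_eq_norm] at hy
  filter_upwards [hq, ae_abs_q_le (y - z), X.q_sub y z] with ξ a b c
  have := neg_abs_le (X.q (y - z) ξ)
  linarith

section

variable (hlam : 0 < lam) (hf : ContDiff ℝ ∞ f) (hg : ContDiff ℝ ∞ g) (hg0 : g 0 = 0)

include hlam hf hg hg0

/-- On a ball of radius `m / 2` around a point with `q ≥ m` one still has `q ≥ m / 2`, so that the whole
ball is admissible. -/
lemma uniformlyRegular_field (T N : ℝ) (hm : 0 < m) :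
    UniformlyRegular (field lam f g) posRegion T {z | ‖z‖ ≤ N ∧ ∀ᵐ ξ, m ≤ X.q z ξ} := by
  have hm2 := half_pos hm
  set N' := |N| + m / 2 with hN'
  obtain ⟨C, hC, H⟩ := exists_field_bound hlam hf hg hg0 T (2 * N' + N' ^ 3) hm2
  refine ⟨m / 2, hm2, ⟨C * N', by positivity⟩, ⟨C * (1 + N') * 2, by positivity⟩, ?_⟩
  rintro z ⟨hz, hq⟩
  have hn : ∀ y ∈ Metric.closedBall z (m / 2), ‖y‖ ≤ N' := by
    intro y hy
    rw [Metric.mem_closedBall, dist_eq_norm] at hy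
    have h1 := norm_le_norm_add_norm_sub z y
    rw [norm_sub_rev] at h1
    have := le_abs_self N
    linarith
  have hA : ∀ y ∈ Metric.closedBall z (m / 2), AdmX (2 * N' + N' ^ 3) (m / 2) y := fun y hy =>
    admX_of_norm_le hm2 (hn y hy) (half_le_q_of_mem_closedBall hq hy)
  refine ⟨fun y hy => ⟨m / 2, hm2, half_le_q_of_mem_closedBall hq hy⟩, fun t ht => ?_,
    fun x hx => ?_, fun t ht x hx => ?_⟩
  · refine LipschitzOnWith.of_dist_le_mul fun x hx y hy => ?_
    have h1 := (H t ht t ht x y (hA x hx) (hA y hy)).2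
    rw [sub_self, abs_zero, add_zero] at h1
    rw [dist_eq_norm, dist_eq_norm]
    refine h1.trans ?_
    change _ ≤ C * (1 + N') * 2 * ‖x - y‖
    rw [← mul_assoc]
    gcongr
    exact hn y hy
  · have hL : LipschitzOnWith ⟨C * (1 + N'), by positivity⟩ (fun t => field lam f g t x)
        (Icc 0 T) := by
      refine LipschitzOnWith.of_dist_le_mul fun s hs t ht => ?_
      have h1 := (H s hs t ht x x (hA x hx) (hA x hx)).2
      rw [sub_self, norm_zero, mul_zero, zero_add] at h1
      rw [dist_eq_norm, Real.dist_eq]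
      refine h1.trans ?_
      change _ ≤ C * (1 + N') * |s - t|
      gcongr
      exact hn x hx
    exact hL.continuousOn
  · refine (H t ht t ht x x (hA x hx) (hA x hx)).1.trans ?_
    change _ ≤ C * N'
    exact mul_le_mul_of_nonneg_left (hn x hx) hC

lemma exists_global_curve {z₀ : X} (hz : Compat z₀) (hq : X.q z₀ =ᵐ[volume] fun _ => 1) :
    ∃ z : ℝ → X, z 0 = z₀ ∧ (∀ t ∈ Ici (0 : ℝ), z t ∈ posRegion) ∧
      (∀ t ∈ Ici (0 : ℝ), HasDerivWithinAt z (field lam f g t (z t)) (Ici 0) t) ∧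
      ∀ (T : ℝ) (w : ℝ → X), w 0 = z₀ → SolvesOn (field lam f g) 0 T w →
        EqOn w z (Icc 0 T) := by
  refine exists_global_solution (E := X) (F := field lam f g) (U := posRegion) ⟨1, one_pos, hq.mono fun ξ h => h.ge⟩ ?_ ?_
  · rintro T z ⟨m, hm, hz⟩
    obtain ⟨r, hr, B, L, H⟩ := uniformlyRegular_field hlam hf hg hg0 T ‖z‖ hm
    exact ⟨r, hr, L, (H z ⟨le_rfl, hz⟩).2.1⟩
  · intro T _
    obtain ⟨N, m, hm, H⟩ := exists_a_priori_bound hlam hf hg hg0 hz hq T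
    exact ⟨_, uniformlyRegular_field hlam hf hg hg0 T N hm,
      fun T' hT' α h0 hα hU => H T' hT' α h0 ⟨hα, hU⟩⟩

end

end WaveSystem

end

open WaveSystem

theorem theorem3p1 (lam : ℝ) (hlam : 0 < lam) (f g : ℝ → ℝ)
    (hf : ContDiff ℝ ∞ f) (hg : ContDiff ℝ ∞ g) (hg0 : g 0 = 0) (ubar : WaveSystem.H1) :
    ∃ z : ℝ → WaveSystem.X,
      WaveSystem.IsSolutionOn lam f g ubar (Ici 0) z ∧
      (∀ t ∈ Ici (0 : ℝ), ∀ ξ : ℝ,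
        Integrable (WaveSystem.integrand lam f g t (WaveSystem.X.k (z t))
          (WaveSystem.X.v (z t)) (WaveSystem.X.q (z t)) ξ)) ∧
      (∀ w : ℝ → WaveSystem.X, WaveSystem.IsSolutionOn lam f g ubar (Ici 0) w →
        EqOn w z (Ici 0)) ∧
      (∀ T : ℝ, 0 < T → ∀ w : ℝ → WaveSystem.X,
        WaveSystem.IsSolutionOn lam f g ubar (Ico 0 T) w → EqOn w z (Ico 0 T)) := by
  obtain ⟨z₀, hk, hv, hq, hc⟩ := exists_initial ubar
  obtain ⟨z, h0, hU, hz, huniq⟩ := exists_global_curve hlam hf hg hg0 hc hq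
  have hA : ∀ t ∈ Ici (0 : ℝ), ∃ M m, 0 < m ∧ AdmX M m (z t) := by
    intro t ht
    obtain ⟨m, hm, hq⟩ := hU t ht
    exact ⟨_, m, hm, admX_of_norm_le hm le_rfl hq⟩
  -- A solution in the sense of the statement solves `w' = field t w`, since a point of `X` is
  -- determined by the three a.e. equalities.
  have key : ∀ (I : Set ℝ) (w : ℝ → X), IsSolutionOn lam f g ubar I w → ∀ t, Icc 0 t ⊆ I →
      EqOn w z (Icc 0 t) := by
    intro I w hw t ht
    refine huniq t w (X.ext_ae (hw.init_k.trans hk.symm) (hw.init_v.trans hv.symm)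
      (hw.init_q.trans hq.symm)) fun s hs => ?_
    obtain ⟨w', hd, hr⟩ := hw.ode s (ht hs)
    rw [IsRhs.eq_field hr] at hd
    exact HasDerivWithinAt.mono (F := X) hd ht
  refine ⟨z, ⟨?_, ?_, ?_, ?_⟩, ?_, ?_, ?_⟩
  · rw [h0]; exact hk
  · rw [h0]; exact hv
  · rw [h0]; exact hq
  · intro t ht
    obtain ⟨M, m, hm, h⟩ := hA t ht
    exact ⟨_, hz t ht, field_isRhs hlam hf hg hg0 hm ht h⟩
  · intro t ht ξ
    obtain ⟨M, m, hm, h⟩ := hA t ht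
    exact h.integrable_integrand hlam hf hg hg0 hm ht ξ
  · intro w hw t ht
    exact key _ w hw t Icc_subset_Ici_self ⟨ht, le_rfl⟩
  · intro T _ w hw t ht
    exact key _ w hw t (fun s hs => ⟨hs.1, hs.2.trans_lt ht.2⟩) ⟨ht.1, le_rfl⟩
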